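/- **Setting.** Let $X$ and $S$ be complex manifolds and let $\pi:X\to S$ be a holomorphic submersion with connected, non-empty fibres. A *Lie algebroid* on $X$ is a sheaf $\mathscr A$ of $\mathcal O_X$-modules with an $\mathcal O_X$-linear anchor $a:\mathscr A\to T_X$ and a $\mathbb C$-bilinear skew-symmetric bracket which satisfies the Jacobi identity and $\{g u,v\}=g\{u,v\}-a(v)(g)\,u$. A *family* $\mathscr A_S$ over $\pi$ is a reflexive (coherent) sheaf on $X$, flat over $S$, with such a structure whose anchor $a_S$ takes values in the relative tangent sheaf $T_{X|S}\subseteq T_X$ (so that the bracket is $\pi^{-1}\mathcal O_S$-bilinear). An *unfolding* of $\mathscr A_S$ is a Lie algebroid $a:\mathscr A\to T_X$ whose underlying sheaf is reflexive, together with an injective morphism of Lie algebroids $\mathscr A_S\hookrightarrow\mathscr A$ whose image is $a^{-1}(\operatorname{Im}a_S)$, such that $\operatorname{rank}\mathscr A=\operatorname{rank}\mathscr A_S+\dim S$. It is *transversal* if the induced map $T_{X|S}/\operatorname{Im}a_S\to T_X/\operatorname{Im}a$ of cokernel sheaves is an isomorphism. Unfoldings are considered up to isomorphisms of Lie algebroids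 which are the identity on $\mathscr A_S$. Let $\mathscr D$ be the sheaf of pairs $(\psi,\sigma)$ where $\psi$ is a first order differential operator $\mathscr A_S\to\mathscr A_S$ with symbol the vector field $\sigma$ on $X$, i.e. $\psi(fs)=f\psi(s)+\sigma(f)s$, where $\psi$ is a derivation of the bracket of $\mathscr A_S$, and where $\sigma$ is locally projectable along $\pi$, i.e. its image in $\pi^*T_S$ lies in $\pi^{-1}T_S$. (Where $\mathscr A_S\neq 0$, $\sigma$ is determined by $\psi$.) The sections $s$ of $\mathscr A_S$ define sections $\operatorname{ad}_s=(\{s,\cdot\},a_S(s))$ of $\mathscr D$, and $\operatorname{ad}(\mathscr A_S)$ is an ideal of $\mathscr D$ for the commutator. Let $\mathfrak u(\mathscr A_S)=\mathscr D/\operatorname{ad}(\mathscr A_S)$ (quotient sheaf). Then $\pi_*\mathfrak u(\mathscr A_S)$, with the induced bracket and the anchor induced by $(\psi,\sigma)\mapsto\pi_*\sigma$, with values in $\pi_*\pi^{-1}T_S=T_S$, is a Lie algebroid on $S$. A *flat connection* on it is a bracket-preserving $\mathcal O_S$-linear section $T_S\to\pi_*\mathfrak u(\mathscr A_S)$ of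 the anchor. **Statement.** For every transversal unfolding $\mathscr A$ of $\mathscr A_S$ there is a flat connection $\nabla_{\mathscr A}$ on $\pi_*\mathfrak u(\mathscr A_S)$, depending only on the isomorphism class of $\mathscr A$, such that the following holds: if $v$ is a vector field on an open set $U\subseteq S$ and $u$ is a section of $\mathscr A$ over an open set $V\subseteq\pi^{-1}(U)$ whose anchor $a(u)$ projects to $v$, then $\{u,\cdot\}$ maps $\mathscr A_S|_V$ to itself and $\nabla_{\mathscr A}(v)|_V$ is the class of the operator $(\{u,\cdot\}|_{\mathscr A_S},a(u))$. Moreover, if the adjoint map $\mathscr A_S\to\mathrm{Der}_{\mathrm{Lie}}(\mathscr A_S)$, $s\mapsto\{s,\cdot\}$, is injective, then $\mathscr A\mapsto\nabla_{\mathscr A}$ is a one-to-one correspondence between isomorphism classes of transversal unfoldings of $\mathscr A_S$ and flat connections on $\pi_*\mathfrak u(\mathscr A_S)$. -/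

import Mathlib

open TopologicalSpace
open scoped Manifold ContDiff

universe u v w

namespace LieUnf

section Functions

variable (E : Type v) [NormedAddCommGroup E] [NormedSpace ℂ E]
  {X : Type u} [TopologicalSpace X] [ChartedSpace E X]

/-- The ring `𝒪_X(U)` of holomorphic functions on the open subset `U` of `X`. -/
def Hol (U : Opens X) : Type u := C^ω⟮𝓘(ℂ, E), U; 𝓘(ℂ, ℂ), ℂ⟯

noncomputable instance (U : Opens X) : CommRing (Hol E U) :=
  inferInstanceAs (CommRing C^ω⟮𝓘(ℂ, E), U; 𝓘(ℂ, ℂ), ℂ⟯)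

noncomputable instance (U : Opens X) : Algebra ℂ (Hol E U) :=
  inferInstanceAs (Algebra ℂ C^ω⟮𝓘(ℂ, E), U; 𝓘(ℂ, ℂ), ℂ⟯)

instance (U : Opens X) : FunLike (Hol E U) U ℂ :=
  inferInstanceAs (FunLike C^ω⟮𝓘(ℂ, E), U; 𝓘(ℂ, ℂ), ℂ⟯ U ℂ)

theorem Hol.contMDiff {U : Opens X} (f : Hol E U) : ContMDiff 𝓘(ℂ, E) 𝓘(ℂ, ℂ) ω f :=
  ContMDiffMap.contMDiff (I := 𝓘(ℂ, E)) (I' := 𝓘(ℂ, ℂ)) f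

@[ext] theorem Hol.ext {U : Opens X} {f g : Hol E U} (h : ∀ x, f x = g x) : f = g :=
  DFunLike.ext _ _ h

/-- Restriction of holomorphic functions. -/
noncomputable def holRes {U V : Opens X} (h : V ≤ U) : Hol E U →+* Hol E V :=
  ContMDiffMap.restrictRingHom 𝓘(ℂ, E) 𝓘(ℂ, ℂ) ℂ h

theorem holRes_apply {U V : Opens X} (h : V ≤ U) (f : Hol E U) (x : V) :
    holRes E h f x = f ⟨x, h x.2⟩ := rfl

theorem holRes_self {U : Opens X} (h : U ≤ U) (f : Hol E U) : holRes E h f = f := rfl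

theorem holRes_res {U V W : Opens X} (h : V ≤ U) (h' : W ≤ V) (f : Hol E U) :
    holRes E h' (holRes E h f) = holRes E (h'.trans h) f := rfl

/-- The vector fields on `U`: derivations of the sheaf of rings `𝒪_X|_U`, i.e. families of
`ℂ`-linear derivations of the rings `𝒪_X(W)`, `W ⊆ U` open, compatible with restrictions. -/
noncomputable def vfields (U : Opens X) :
    AddSubgroup (∀ W : {W : Opens X // W ≤ U}, Derivation ℂ (Hol E W.1) (Hol E W.1)) where
  carrier := {Y | ∀ (W W' : Opens X) (hW : W ≤ U) (h : W' ≤ W) (f : Hol E W),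
    holRes E h (Y ⟨W, hW⟩ f) = Y ⟨W', h.trans hW⟩ (holRes E h f)}
  add_mem' := by
    intro a b ha hb W W' hW h f
    simp [ha W W' hW h f, hb W W' hW h f]
  zero_mem' := by intro W W' hW h f; simp
  neg_mem' := by
    intro a ha W W' hW h f
    simp [ha W W' hW h f]

/-- The module `T_X(U)` of holomorphic vector fields on `U`. -/
abbrev VField (U : Opens X) : Type u := vfields E U

variable {E}

/-- A vector field on `U` as a derivation of `𝒪_X(W)`, for `W ⊆ U`. -/
noncomputable def VField.der {U : Opens X} (Y : VField E U) {W : Opens X} (h : W ≤ U) :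
    Derivation ℂ (Hol E W) (Hol E W) := Y.1 ⟨W, h⟩

theorem VField.res_der {U : Opens X} (Y : VField E U) {W W' : Opens X} (hW : W ≤ U) (h : W' ≤ W)
    (f : Hol E W) : holRes E h (Y.der hW f) = Y.der (h.trans hW) (holRes E h f) :=
  Y.2 W W' hW h f

@[ext] theorem VField.ext {U : Opens X} {Y Z : VField E U}
    (h : ∀ (W : Opens X) (hW : W ≤ U) (f : Hol E W), Y.der hW f = Z.der hW f) : Y = Z := by
  apply Subtype.ext; funext W; ext1 f; exact h W.1 W.2 f

@[simp] theorem VField.add_der {U : Opens X} (Y Z : VField E U) {W : Opens X} (hW : W ≤ U)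
    (f : Hol E W) : (Y + Z).der hW f = Y.der hW f + Z.der hW f := rfl

@[simp] theorem VField.zero_der {U : Opens X} {W : Opens X} (hW : W ≤ U)
    (f : Hol E W) : (0 : VField E U).der hW f = 0 := rfl

@[simp] theorem VField.neg_der {U : Opens X} (Y : VField E U) {W : Opens X} (hW : W ≤ U)
    (f : Hol E W) : (-Y).der hW f = -Y.der hW f := rfl

/-- Restriction of vector fields. -/
noncomputable def VField.res {U V : Opens X} (h : V ≤ U) : VField E U →+ VField E V where
  toFun Y := ⟨fun W => Y.der (W.2.trans h), fun _ _ hW h' f => Y.res_der (hW.trans h) h' f⟩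
  map_zero' := rfl
  map_add' _ _ := rfl

@[simp] theorem VField.der_res {U V : Opens X} (h : V ≤ U) (Y : VField E U) {W : Opens X}
    (hW : W ≤ V) (f : Hol E W) : (VField.res h Y).der hW f = Y.der (hW.trans h) f := rfl

/-- `T_X(U)` is a module over `𝒪_X(U)`. -/
noncomputable instance (U : Opens X) : Module (Hol E U) (VField E U) where
  smul g Y := ⟨fun W => holRes E W.2 g • Y.der W.2, fun W W' hW h f => by
    have := Y.res_der hW h f
    simp only [Derivation.smul_apply, smul_eq_mul, map_mul, this]
    rfl⟩
  one_smul Y := by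
    ext1 W hW f
    change holRes E hW 1 * _ = _
    simp
  mul_smul g g' Y := by
    ext1 W hW f
    change holRes E hW (g * g') * _ = holRes E hW g * (holRes E hW g' * _)
    rw [map_mul, mul_assoc]
  smul_zero g := by
    ext1 W hW f
    change holRes E hW g * 0 = 0
    simp
  smul_add g Y Z := by
    ext1 W hW f
    change holRes E hW g * (Y.der hW f + Z.der hW f) =
      holRes E hW g * Y.der hW f + holRes E hW g * Z.der hW f
    ring
  add_smul g g' Y := by
    ext1 W hW f
    change holRes E hW (g + g') * Y.der hW f =
      holRes E hW g * Y.der hW f + holRes E hW g' * Y.der hW f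
    rw [map_add]; ring
  zero_smul Y := by
    ext1 W hW f
    change holRes E hW 0 * _ = 0
    simp

@[simp] theorem VField.smul_der {U : Opens X} (g : Hol E U) (Y : VField E U) {W : Opens X}
    (hW : W ≤ U) (f : Hol E W) : (g • Y).der hW f = holRes E hW g * Y.der hW f := rfl

/-- The commutator of vector fields. -/
noncomputable instance (U : Opens X) : Bracket (VField E U) (VField E U) where
  bracket Y Z := ⟨fun W => ⁅Y.der W.2, Z.der W.2⁆, fun W W' hW h f => by
    simp only [Derivation.commutator_apply, map_sub, Y.res_der, Z.res_der]⟩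

@[simp] theorem VField.lie_der {U : Opens X} (Y Z : VField E U) {W : Opens X} (hW : W ≤ U)
    (f : Hol E W) : ⁅Y, Z⁆.der hW f = Y.der hW (Z.der hW f) - Z.der hW (Y.der hW f) :=
  Derivation.commutator_apply _

theorem VField.res_lie {U V : Opens X} (h : V ≤ U) (Y Z : VField E U) :
    VField.res h ⁅Y, Z⁆ = ⁅VField.res h Y, VField.res h Z⁆ := by
  ext1 W hW f
  simp only [VField.der_res, VField.lie_der]

theorem VField.res_smul {U V : Opens X} (h : V ≤ U) (g : Hol E U) (Y : VField E U) :
    VField.res h (g • Y) = holRes E h g • VField.res h Y := by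
  ext1 W hW f
  simp only [VField.der_res, VField.smul_der, holRes_res]

theorem VField.res_res {U V W : Opens X} (h : V ≤ U) (h' : W ≤ V) (Y : VField E U) :
    VField.res h' (VField.res h Y) = VField.res (h'.trans h) Y := rfl

theorem VField.res_self {U : Opens X} (h : U ≤ U) (Y : VField E U) : VField.res h Y = Y := rfl

/-- Holomorphy is a local property. -/
theorem contMDiff_of_local {U : Opens X} (f : U → ℂ)
    (h : ∀ x : U, ∃ (W : Opens X) (_ : x.1 ∈ W) (hW : W ≤ U) (g : Hol E W),
      ∀ y : W, f ⟨y, hW y.2⟩ = g y) : ContMDiff 𝓘(ℂ, E) 𝓘(ℂ, ℂ) ω f := by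
  intro x
  obtain ⟨W, hx, hW, g, hg⟩ := h x
  have hf : f = fun y : U => (Function.extend Subtype.val f 0 : X → ℂ) y := by
    funext y; exact (Subtype.val_injective.extend_apply f 0 y).symm
  have hg' : (g : W → ℂ) = fun y : W => (Function.extend Subtype.val f 0 : X → ℂ) y := by
    funext y
    rw [← hg y]
    exact (Subtype.val_injective.extend_apply f 0 ⟨y, hW y.2⟩).symm
  have h1 : ContMDiffAt 𝓘(ℂ, E) 𝓘(ℂ, ℂ) ω (g : W → ℂ) ⟨x, hx⟩ := g.contMDiff E _
  rw [hg', contMDiffAt_subtype_iff] at h1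
  rw [hf, contMDiffAt_subtype_iff]
  exact h1

end Functions

section Sheaves

variable (E : Type v) [NormedAddCommGroup E] [NormedSpace ℂ E]
  (X : Type u) [TopologicalSpace X] [ChartedSpace E X]

/-- Sheaves of `𝒪_X`-modules on the complex manifold `X`. -/
structure HolModule where
  /-- sections over an open set -/
  Γ : Opens X → Type u
  [addCommGroup : ∀ U, AddCommGroup (Γ U)]
  [module : ∀ U, Module (Hol E U) (Γ U)]
  /-- restriction maps -/
  res : ∀ {U V : Opens X}, V ≤ U → Γ U →+ Γ V
  res_smul : ∀ {U V : Opens X} (h : V ≤ U) (f : Hol E U) (s : Γ U),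
    res h (f • s) = holRes E h f • res h s
  res_self : ∀ {U : Opens X} (s : Γ U), res le_rfl s = s
  res_res : ∀ {U V W : Opens X} (h : V ≤ U) (h' : W ≤ V) (s : Γ U),
    res h' (res h s) = res (h'.trans h) s
  /-- gluing -/
  glue : ∀ {ι : Type u} (U : ι → Opens X) (s : ∀ i, Γ (U i)),
    (∀ i j, res (inf_le_left : U i ⊓ U j ≤ U i) (s i) =
      res (inf_le_right : U i ⊓ U j ≤ U j) (s j)) →
    ∃! t : Γ (iSup U), ∀ i, res (le_iSup U i) t = s i

attribute [instance] HolModule.addCommGroup HolModule.module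

variable {X}

/-- Open neighbourhoods of `x`, ordered by reverse inclusion. -/
structure Nhd (x : X) : Type u where
  carrier : Opens X
  mem : x ∈ carrier

instance (x : X) : Preorder (Nhd x) where
  le U V := V.1 ≤ U.1
  le_refl _ := le_rfl
  le_trans _ _ _ h h' := h'.trans h

instance (x : X) : IsDirectedOrder (Nhd x) where
  directed U V := ⟨⟨U.1 ⊓ V.1, ⟨U.2, V.2⟩⟩, (inf_le_left : U.1 ⊓ V.1 ≤ U.1), (inf_le_right : U.1 ⊓ V.1 ≤ V.1)⟩

instance (x : X) : Nonempty (Nhd x) := ⟨⟨⊤, trivial⟩⟩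

instance (x : X) : DirectedSystem (fun U : Nhd x => Hol E U.1)
    (fun (U V : Nhd x) (h : U ≤ V) => holRes E (show V.1 ≤ U.1 from h)) where
  map_self _ _ := rfl
  map_map _ _ _ _ _ _ := rfl

/-- The local ring `𝒪_{X,x}` of germs of holomorphic functions. -/
abbrev HolStalk (x : X) : Type u :=
  DirectLimit (fun U : Nhd x => Hol E U.1)
    (fun (U V : Nhd x) (h : U ≤ V) => holRes E (show V.1 ≤ U.1 from h))

/-- The germ of a holomorphic function. -/
noncomputable def holGerm {x : X} {U : Opens X} (hx : x ∈ U) (f : Hol E U) : HolStalk E x := ⟦⟨⟨U, hx⟩, f⟩⟧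

variable {E}

instance (A : HolModule E X) (x : X) : DirectedSystem (fun U : Nhd x => A.Γ U.1)
    (fun (U V : Nhd x) (h : U ≤ V) => A.res (show V.1 ≤ U.1 from h)) where
  map_self _ s := A.res_self s
  map_map _ _ _ h h' s := A.res_res h h' s

/-- The stalk `A_x` of a sheaf of `𝒪_X`-modules. -/
abbrev HolModule.Stalk (A : HolModule E X) (x : X) : Type u :=
  DirectLimit (fun U : Nhd x => A.Γ U.1)
    (fun (U V : Nhd x) (h : U ≤ V) => A.res (show V.1 ≤ U.1 from h))

/-- The germ of a section. -/
def HolModule.germ (A : HolModule E X) {x : X} {U : Opens X} (hx : x ∈ U) (s : A.Γ U) :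
    A.Stalk x := ⟦⟨⟨U, hx⟩, s⟩⟧

noncomputable instance (A : HolModule E X) (x : X) : SMul (HolStalk E x) (A.Stalk x) where
  smul := DirectLimit.map₂ _ _ _ (fun _ f s => f • s)
    (fun _ _ h f s => A.res_smul h f s)

theorem HolModule.smul_def (A : HolModule E X) {x : X} (U : Nhd x) (f : Hol E U.1)
    (s : A.Γ U.1) : (⟦⟨U, f⟩⟧ : HolStalk E x) • (⟦⟨U, s⟩⟧ : A.Stalk x) = ⟦⟨U, f • s⟩⟧ :=
  DirectLimit.map₂_def ..

theorem hol_mk_res {x : X} (U V : Nhd x) (h : U ≤ V) (f : Hol E U.1) :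
    (⟦⟨U, f⟩⟧ : HolStalk E x) = ⟦⟨V, holRes E (show V.1 ≤ U.1 from h) f⟩⟧ :=
  Quotient.sound ⟨V, h, le_rfl, rfl⟩

theorem HolModule.mk_res (A : HolModule E X) {x : X} (U V : Nhd x) (h : U ≤ V) (s : A.Γ U.1) :
    (⟦⟨U, s⟩⟧ : A.Stalk x) = ⟦⟨V, A.res (show V.1 ≤ U.1 from h) s⟩⟧ :=
  Quotient.sound ⟨V, h, le_rfl, (A.res_self _).symm⟩

/-- `A_x` is a module over `𝒪_{X,x}`. -/
noncomputable instance (A : HolModule E X) (x : X) : Module (HolStalk E x) (A.Stalk x) where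
  one_smul := DirectLimit.induction _ fun U s => by
    rw [DirectLimit.one_def U, HolModule.smul_def, one_smul]
  mul_smul := DirectLimit.induction₂ _ fun U f g s => by
    obtain ⟨W, t, rfl⟩ := DirectLimit.exists_eq_mk _ s
    obtain ⟨V, hU, hW⟩ := exists_ge_ge U W
    rw [hol_mk_res U V hU, hol_mk_res U V hU, A.mk_res W V hW, DirectLimit.mul_def,
      HolModule.smul_def, HolModule.smul_def, HolModule.smul_def, mul_smul]
  smul_zero := DirectLimit.induction _ fun U f => by
    rw [DirectLimit.zero_def U, HolModule.smul_def, smul_zero]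
  smul_add f := DirectLimit.induction₂ _ fun U s t => by
    obtain ⟨W, g, rfl⟩ := DirectLimit.exists_eq_mk _ f
    obtain ⟨V, hU, hW⟩ := exists_ge_ge U W
    rw [hol_mk_res W V hW, A.mk_res U V hU, A.mk_res U V hU, DirectLimit.add_def,
      HolModule.smul_def, HolModule.smul_def, HolModule.smul_def, DirectLimit.add_def, smul_add]
  add_smul f g s := by
    obtain ⟨U, f, g, rfl, rfl⟩ := DirectLimit.exists_eq_mk₂ _ f g
    obtain ⟨W, t, rfl⟩ := DirectLimit.exists_eq_mk _ s
    obtain ⟨V, hU, hW⟩ := exists_ge_ge U W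
    rw [hol_mk_res U V hU, hol_mk_res U V hU, A.mk_res W V hW, DirectLimit.add_def,
      HolModule.smul_def, HolModule.smul_def, HolModule.smul_def, DirectLimit.add_def, add_smul]
  zero_smul := DirectLimit.induction _ fun U s => by
    rw [DirectLimit.zero_def U, HolModule.smul_def, zero_smul, ← DirectLimit.zero_def U]

/-- Coherent sheaves: locally there is a presentation `𝒪^m → 𝒪^n → A → 0` (the generators are
`e`, the columns of the presentation matrix are `r`, exactness is checked on stalks). Over the
sheaf of holomorphic functions, which is coherent, this is the same as coherence. -/
def HolModule.IsCoherent (A : HolModule E X) : Prop :=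
  ∀ x : X, ∃ (U : Opens X) (_ : x ∈ U) (n m : ℕ) (e : Fin n → A.Γ U)
    (r : Fin m → Fin n → Hol E U), ∀ (y : X) (hy : y ∈ U),
      Submodule.span (HolStalk E y) (Set.range fun i => A.germ hy (e i)) = ⊤ ∧
      LinearMap.ker (Fintype.linearCombination (HolStalk E y) fun i => A.germ hy (e i)) =
        Submodule.span (HolStalk E y) (Set.range fun k i => holGerm E hy (r k i))

/-- Reflexive (coherent) sheaves: for a coherent sheaf the map to the double dual is an
isomorphism if and only if it is one on all stalks, and the dual commutes with stalks. -/
def HolModule.IsReflexive (A : HolModule E X) : Prop :=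
  A.IsCoherent ∧ ∀ x : X, Module.IsReflexive (HolStalk E x) (A.Stalk x)

/-- The rank of a coherent sheaf at `x`: the dimension of `A_x ⊗ Frac 𝒪_{X,x}`, i.e. the maximal
number of `𝒪_{X,x}`-linearly independent elements of `A_x`. -/
noncomputable def HolModule.rank (A : HolModule E X) (x : X) : ℕ :=
  Module.finrank (HolStalk E x) (A.Stalk x)

variable (E X)

/-- A Lie algebroid structure: a sheaf `A` of `𝒪_X`-modules with an `𝒪_X`-linear anchor
`A → T_X` and a bracket. The bracket is `ℂ`-bilinear: it is biadditive, and `leibniz` and `skew`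
with constant functions `g` give homogeneity. -/
structure LieAlgebroid extends HolModule E X where
  anchor : ∀ {U : Opens X}, Γ U →ₗ[Hol E U] VField E U
  anchor_res : ∀ {U V : Opens X} (h : V ≤ U) (s : Γ U), anchor (res h s) = (anchor s).res h
  bracket : ∀ {U : Opens X}, Γ U →+ Γ U →+ Γ U
  bracket_res : ∀ {U V : Opens X} (h : V ≤ U) (s t : Γ U),
    res h (bracket s t) = bracket (res h s) (res h t)
  skew : ∀ {U : Opens X} (s t : Γ U), bracket t s = -bracket s t
  jacobi : ∀ {U : Opens X} (s t r : Γ U),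
    bracket s (bracket t r) + bracket t (bracket r s) + bracket r (bracket s t) = 0
  leibniz : ∀ {U : Opens X} (g : Hol E U) (s t : Γ U),
    bracket (g • s) t = g • bracket s t - (anchor t).der le_rfl g • s

end Sheaves

section Domain

variable {E : Type v} [NormedAddCommGroup E] [NormedSpace ℂ E]
  {X : Type u} [TopologicalSpace X] [ChartedSpace E X] [IsManifold 𝓘(ℂ, E) ω X]

theorem hol_mul_eq_zero {x : X} {U : Opens X} (hx : x ∈ U) (f g : Hol E U) (h : f * g = 0) :
    ∃ (V : Opens X) (_ : x ∈ V) (hV : V ≤ U), holRes E hV f = 0 ∨ holRes E hV g = 0 := by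
  let c := chartAt E x
  have key : ∀ k : Hol E U, ContDiffOn ℂ ω
      ((Function.extend Subtype.val k 0 : X → ℂ) ∘ c.symm) (c.target ∩ c.symm ⁻¹' U) := by
    intro k
    rw [← contMDiffOn_iff_contDiffOn]
    have h1 : ContMDiffOn 𝓘(ℂ, E) 𝓘(ℂ, ℂ) ω (Function.extend Subtype.val k 0 : X → ℂ) U := by
      intro y hy
      apply ContMDiffAt.contMDiffWithinAt
      have h2 : ContMDiffAt 𝓘(ℂ, E) 𝓘(ℂ, ℂ) ω
          (fun y : U => (Function.extend Subtype.val k 0 : X → ℂ) y) ⟨y, hy⟩ := by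
        have : (fun y : U => (Function.extend Subtype.val k 0 : X → ℂ) y) = k := by
          funext y; exact Subtype.val_injective.extend_apply k 0 y
        rw [this]; exact k.contMDiff E _
      rwa [contMDiffAt_subtype_iff] at h2
    have h3 : ContMDiffOn 𝓘(ℂ, E) 𝓘(ℂ, E) ω c.symm c.target := contMDiffOn_chart_symm
    exact h1.comp (h3.mono Set.inter_subset_left) (fun y hy => hy.2)
  have hopen : IsOpen (c.target ∩ c.symm ⁻¹' U) := c.isOpen_inter_preimage_symm U.2
  have hmem : c x ∈ c.target ∩ c.symm ⁻¹' U := by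
    refine ⟨c.map_source (mem_chart_source E x), ?_⟩
    change c.symm (c x) ∈ U
    rwa [c.left_inv (mem_chart_source E x)]
  obtain ⟨r, hr, hball⟩ := Metric.isOpen_iff.1 hopen _ hmem
  have han : ∀ k : Hol E U, AnalyticOnNhd ℂ
      ((Function.extend Subtype.val k 0 : X → ℂ) ∘ c.symm) (Metric.ball (c x) r) := by
    intro k
    rw [← Metric.isOpen_ball.analyticOn_iff_analyticOnNhd]
    exact ((key k).mono hball).analyticOn
  let V : Opens X := ⟨c.source ∩ c ⁻¹' Metric.ball (c x) r,
    c.isOpen_inter_preimage Metric.isOpen_ball⟩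
  have hVU : V ≤ U := by
    intro y hy
    have := (hball hy.2).2
    change c.symm (c y) ∈ U at this
    rwa [c.left_inv hy.1] at this
  have hval : ∀ (k : Hol E U) (y : V), holRes E hVU k y =
      ((Function.extend Subtype.val k 0 : X → ℂ) ∘ c.symm) (c y) := by
    intro k y
    rw [Function.comp_apply, c.left_inv y.2.1]
    exact (Subtype.val_injective.extend_apply k 0 ⟨y, hVU y.2⟩).symm
  refine ⟨V, ⟨mem_chart_source E x, Metric.mem_ball_self hr⟩, hVU, ?_⟩
  by_contra! hcon
  obtain ⟨hf, hg⟩ := hcon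
  obtain ⟨y, hy⟩ : ∃ y, holRes E hVU f y ≠ 0 := by
    by_contra! hh
    exact hf (Hol.ext E hh)
  apply hg
  have hfy : ∀ᶠ z in nhds (c y), ((Function.extend Subtype.val f 0 : X → ℂ) ∘ c.symm) z ≠ 0 := by
    apply ((han f).continuousOn.continuousAt (Metric.isOpen_ball.mem_nhds y.2.2)).eventually_ne
    rwa [← hval]
  have hgy : ((Function.extend Subtype.val g 0 : X → ℂ) ∘ c.symm) =ᶠ[nhds (c y)] 0 := by
    filter_upwards [hfy, Metric.isOpen_ball.mem_nhds y.2.2] with z hz hzb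
    have hzU : c.symm z ∈ U := (hball hzb).2
    have e1 := Subtype.val_injective.extend_apply f 0 (⟨c.symm z, hzU⟩ : U)
    have e2 := Subtype.val_injective.extend_apply g 0 (⟨c.symm z, hzU⟩ : U)
    have e3 : f ⟨c.symm z, hzU⟩ * g ⟨c.symm z, hzU⟩ = 0 := by
      have := congrArg (fun k : Hol E U => k ⟨c.symm z, hzU⟩) h
      exact this
    rw [Function.comp_apply] at hz
    change Function.extend Subtype.val g 0 (c.symm z) = 0
    change Function.extend Subtype.val f 0 (c.symm z) ≠ 0 at hz
    rw [e1] at hz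
    rw [e2]
    exact (mul_eq_zero.1 e3).resolve_left hz
  have := (han g).eqOn_zero_of_preconnected_of_eventuallyEq_zero
    (convex_ball (c x) r).isPreconnected y.2.2 hgy
  apply Hol.ext E
  intro z
  rw [hval]
  exact this z.2.2

instance (x : X) : Nontrivial (HolStalk E x) := by
  refine ⟨0, 1, fun h => ?_⟩
  rw [DirectLimit.zero_def (⟨⊤, trivial⟩ : Nhd x), DirectLimit.one_def (⟨⊤, trivial⟩ : Nhd x)] at h
  obtain ⟨V, _, _, h⟩ := Quotient.exact h
  have h := congrArg (fun k : Hol E V.1 => k ⟨x, V.2⟩) h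
  exact zero_ne_one h

instance (x : X) : NoZeroDivisors (HolStalk E x) where
  eq_zero_or_eq_zero_of_mul_eq_zero := by
    intro a b
    refine DirectLimit.induction₂ _ (fun U f g => ?_) a b
    intro h
    rw [DirectLimit.mul_def, DirectLimit.exists_eq_zero] at h
    obtain ⟨W, hW, h⟩ := h
    change holRes E _ (f * g) = 0 at h
    rw [map_mul] at h
    obtain ⟨V, hx, hV, h⟩ := hol_mul_eq_zero W.2 _ _ h
    refine h.imp (fun h => ?_) (fun h => ?_) <;>
    · rw [DirectLimit.exists_eq_zero]
      exact ⟨⟨V, hx⟩, hV.trans hW, h⟩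

instance (x : X) : IsDomain (HolStalk E x) := NoZeroDivisors.to_isDomain _

end Domain

section Relative

variable {E : Type v} [NormedAddCommGroup E] [NormedSpace ℂ E]
  {F : Type w} [NormedAddCommGroup F] [NormedSpace ℂ F]
  {X : Type u} [TopologicalSpace X] [ChartedSpace E X]
  {S : Type u} [TopologicalSpace S] [ChartedSpace F S]
  (π : C^ω⟮𝓘(ℂ, E), X; 𝓘(ℂ, F), S⟯)

/-- The open set `π⁻¹(U)`. -/
def pre (U : Opens S) : Opens X := ⟨π ⁻¹' U, U.2.preimage π.contMDiff.continuous⟩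

theorem pre_mono {U V : Opens S} (h : U ≤ V) : pre π U ≤ pre π V := fun _ hx => h hx

/-- Pull-back of holomorphic functions, `g ↦ g ∘ π`, from `U ⊆ S` to `W ⊆ π⁻¹(U)`. -/
noncomputable def pull {U : Opens S} {W : Opens X} (h : W ≤ pre π U) : Hol F U →+* Hol E W where
  toFun g := ⟨fun x => g ⟨π x, h x.2⟩, by
    intro x
    have h1 : ContMDiffAt 𝓘(ℂ, F) 𝓘(ℂ, ℂ) ω
        (fun y : U => (Function.extend Subtype.val g 0 : S → ℂ) y) ⟨π x, h x.2⟩ := by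
      have : (fun y : U => (Function.extend Subtype.val g 0 : S → ℂ) y) = g := by
        funext y; exact Subtype.val_injective.extend_apply g 0 y
      rw [this]; exact g.contMDiff F _
    rw [contMDiffAt_subtype_iff] at h1
    have h2 : (fun x : W => g ⟨π x, h x.2⟩) =
        fun x : W => (Function.extend Subtype.val g 0 ∘ π : X → ℂ) x := by
      funext y; exact (Subtype.val_injective.extend_apply g 0 ⟨π y, h y.2⟩).symm
    rw [h2, contMDiffAt_subtype_iff]
    exact ContMDiffAt.comp (x.1 : X) h1 π.contMDiff.contMDiffAt⟩
  map_one' := rfl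
  map_mul' _ _ := rfl
  map_zero' := rfl
  map_add' _ _ := rfl

theorem pull_apply {U : Opens S} {W : Opens X} (h : W ≤ pre π U) (g : Hol F U) (x : W) :
    pull π h g x = g ⟨π x, h x.2⟩ := rfl

theorem res_pull {U : Opens S} {W W' : Opens X} (h : W ≤ pre π U) (h' : W' ≤ W) (g : Hol F U) :
    holRes E h' (pull π h g) = pull π (h'.trans h) g := rfl

theorem pull_res {U U' : Opens S} {W : Opens X} (h : W ≤ pre π U') (h' : U' ≤ U) (g : Hol F U) :
    pull π h (holRes F h' g) = pull π (h.trans (pre_mono π h')) g := rfl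

theorem pull_algebraMap {U : Opens S} {W : Opens X} (h : W ≤ pre π U) (c : ℂ) (g : Hol F U) :
    pull π h (c • g) = c • pull π h g := rfl

theorem mem_pre {x : X} {U : Opens S} (h : π x ∈ U) : x ∈ pre π U := h

/-- `π⁻¹` of a neighbourhood of `π x`. -/
def Nhd.pre {x : X} (U : Nhd (π x)) : Nhd x := ⟨LieUnf.pre π U.1, mem_pre π U.2⟩

/-- The homomorphism `𝒪_{S,π(x)} → 𝒪_{X,x}` as a map. -/
noncomputable def stalkPullFun (x : X) : HolStalk F (π x) → HolStalk E x :=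
  DirectLimit.lift _ (fun U g => ⟦⟨Nhd.pre π U, pull π le_rfl g⟩⟧)
    (fun _ V h _ => Quotient.sound ⟨Nhd.pre π V, pre_mono π h, le_rfl, rfl⟩)

theorem stalkPullFun_mk (x : X) (U : Nhd (π x)) (g : Hol F U.1) :
    stalkPullFun π x ⟦⟨U, g⟩⟧ = ⟦⟨Nhd.pre π U, pull π (le_refl (LieUnf.pre π U.1)) g⟩⟧ := rfl

/-- The homomorphism `𝒪_{S,π(x)} → 𝒪_{X,x}`. -/
noncomputable def stalkPull (x : X) : HolStalk F (π x) →+* HolStalk E x where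
  toFun := stalkPullFun π x
  map_one' := by
    rw [DirectLimit.one_def (⟨⊤, trivial⟩ : Nhd (π x)), stalkPullFun_mk, map_one]
    exact (DirectLimit.one_def (Nhd.pre π ⟨⊤, trivial⟩)).symm
  map_zero' := by
    rw [DirectLimit.zero_def (⟨⊤, trivial⟩ : Nhd (π x)), stalkPullFun_mk, map_zero]
    exact (DirectLimit.zero_def (Nhd.pre π ⟨⊤, trivial⟩)).symm
  map_mul' := DirectLimit.induction₂ _ fun U f g => by
    rw [DirectLimit.mul_def, stalkPullFun_mk, stalkPullFun_mk, stalkPullFun_mk, map_mul]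
    exact (DirectLimit.mul_def (Nhd.pre π U) _ _).symm
  map_add' := DirectLimit.induction₂ _ fun U f g => by
    rw [DirectLimit.add_def, stalkPullFun_mk, stalkPullFun_mk, stalkPullFun_mk, map_add]
    exact (DirectLimit.add_def (Nhd.pre π U) _ _).symm

/-- A sheaf of `𝒪_X`-modules is flat over `S` if every stalk `A_x` is flat over `𝒪_{S,π(x)}`. -/
def HolModule.IsFlatOver (A : HolModule E X) : Prop :=
  ∀ x : X, @Module.Flat (HolStalk F (π x)) (A.Stalk x) _ _
    (Module.compHom (A.Stalk x) (stalkPull π x))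

/-- Sections of the relative tangent sheaf `T_{X|S} ⊆ T_X`: vector fields killing the functions
pulled back from `S`. -/
def IsVertical {W : Opens X} (Y : VField E W) : Prop :=
  ∀ (U : Opens S) (W' : Opens X) (hW : W' ≤ W) (h : W' ≤ pre π U) (g : Hol F U),
    Y.der hW (pull π h g) = 0

/-- The vector field `Y` on `W` projects to the vector field `v` on `U` over `W ∩ π⁻¹(U)`:
`Y(g ∘ π) = v(g) ∘ π`. -/
def Related {W : Opens X} {U : Opens S} (Y : VField E W) (v : VField F U) : Prop :=
  ∀ (U' : Opens S) (hU : U' ≤ U) (W' : Opens X) (hW : W' ≤ W) (h : W' ≤ pre π U') (g : Hol F U'),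
    Y.der hW (pull π h g) = pull π h (v.der hU g)

/-- The image of `Y` under `T_X → π^*T_S` lies in the subsheaf `π⁻¹T_S`: locally `Y` projects to
a vector field on an open subset of `S`. -/
def IsProjectable {W : Opens X} (Y : VField E W) : Prop :=
  ∀ x ∈ W, ∃ (W' : Opens X) (hW : W' ≤ W) (U : Opens S) (v : VField F U),
    x ∈ W' ∧ W' ≤ pre π U ∧ Related π (Y.res hW) v

variable {π}

theorem Related.res {W W' : Opens X} {U U' : Opens S} {Y : VField E W} {v : VField F U}
    (h : Related π Y v) (hW : W' ≤ W) (hU : U' ≤ U) : Related π (Y.res hW) (v.res hU) :=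
  fun U'' hU'' W'' hW'' h'' g => h U'' (hU''.trans hU) W'' (hW''.trans hW) h'' g

theorem Related.add {W : Opens X} {U : Opens S} {Y Z : VField E W} {v v' : VField F U}
    (h : Related π Y v) (h' : Related π Z v') : Related π (Y + Z) (v + v') := by
  intro U'' hU W'' hW hs g
  simp [h U'' hU W'' hW hs g, h' U'' hU W'' hW hs g]

theorem Related.neg {W : Opens X} {U : Opens S} {Y : VField E W} {v : VField F U}
    (h : Related π Y v) : Related π (-Y) (-v) := by
  intro U'' hU W'' hW hs g
  simp [h U'' hU W'' hW hs g]

theorem Related.lie {W : Opens X} {U : Opens S} {Y Z : VField E W} {v v' : VField F U}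
    (h : Related π Y v) (h' : Related π Z v') : Related π ⁅Y, Z⁆ ⁅v, v'⁆ := by
  intro U'' hU W'' hW hs g
  simp [h U'' hU W'' hW hs, h' U'' hU W'' hW hs]

theorem Related.smul {W : Opens X} {U U₀ : Opens S} {Y : VField E W} {v : VField F U}
    (h : Related π Y v) (hU₀ : U ≤ U₀) (hW₀ : W ≤ pre π U₀) (f : Hol F U₀) :
    Related π (pull π hW₀ f • Y) (holRes F hU₀ f • v) := by
  intro U'' hU W'' hW hs g
  simp only [VField.smul_der, h U'' hU W'' hW hs g, map_mul]
  rfl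

theorem IsVertical.related {W : Opens X} {Y : VField E W} (h : IsVertical π Y) (U : Opens S) :
    Related π Y (0 : VField F U) := by
  intro U'' hU W'' hW hs g
  simp [h U'' W'' hW hs g]

theorem IsVertical.projectable {W : Opens X} {Y : VField E W} (h : IsVertical π Y) :
    IsProjectable π Y := fun _ hx =>
  ⟨W, le_rfl, ⊤, 0, hx, fun _ _ => trivial, h.related ⊤⟩

theorem IsProjectable.res {W W' : Opens X} {Y : VField E W} (h : IsProjectable π Y)
    (hW : W' ≤ W) : IsProjectable π (Y.res hW) := by
  intro x hx
  obtain ⟨V, hV, U, v, hxV, hVU, hr⟩ := h x (hW hx)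
  exact ⟨V ⊓ W', inf_le_right, U, v, ⟨hxV, hx⟩, inf_le_left.trans hVU,
    hr.res inf_le_left le_rfl⟩

theorem IsProjectable.two {W : Opens X} {Y Z : VField E W} (h : IsProjectable π Y)
    (h' : IsProjectable π Z) (x : X) (hx : x ∈ W) :
    ∃ (W' : Opens X) (hW : W' ≤ W) (U : Opens S) (v v' : VField F U),
      x ∈ W' ∧ W' ≤ pre π U ∧ Related π (Y.res hW) v ∧ Related π (Z.res hW) v' := by
  obtain ⟨V, hV, U, v, hxV, hVU, hr⟩ := h x hx
  obtain ⟨V', hV', U', v', hxV', hVU', hr'⟩ := h' x hx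
  exact ⟨V ⊓ V', inf_le_left.trans hV, U ⊓ U', v.res inf_le_left, v'.res inf_le_right,
    ⟨hxV, hxV'⟩, fun y hy => ⟨hVU hy.1, hVU' hy.2⟩, hr.res inf_le_left inf_le_left,
    hr'.res inf_le_right inf_le_right⟩

theorem IsProjectable.add {W : Opens X} {Y Z : VField E W} (h : IsProjectable π Y)
    (h' : IsProjectable π Z) : IsProjectable π (Y + Z) := by
  intro x hx
  obtain ⟨W', hW, U, v, v', hx', hWU, h1, h2⟩ := h.two h' x hx
  refine ⟨W', hW, U, v + v', hx', hWU, ?_⟩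
  rw [map_add]
  exact h1.add h2

theorem IsProjectable.lie {W : Opens X} {Y Z : VField E W} (h : IsProjectable π Y)
    (h' : IsProjectable π Z) : IsProjectable π ⁅Y, Z⁆ := by
  intro x hx
  obtain ⟨W', hW, U, v, v', hx', hWU, h1, h2⟩ := h.two h' x hx
  refine ⟨W', hW, U, ⁅v, v'⁆, hx', hWU, ?_⟩
  rw [VField.res_lie]
  exact h1.lie h2

theorem IsProjectable.neg {W : Opens X} {Y : VField E W} (h : IsProjectable π Y) :
    IsProjectable π (-Y) := by
  intro x hx
  obtain ⟨W', hW, U, v, hx', hWU, h1⟩ := h x hx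
  refine ⟨W', hW, U, -v, hx', hWU, ?_⟩
  rw [map_neg]
  exact h1.neg

theorem IsProjectable.smul {W : Opens X} {Y : VField E W} (h : IsProjectable π Y)
    {U₀ : Opens S} (hW₀ : W ≤ pre π U₀) (f : Hol F U₀) :
    IsProjectable π (pull π hW₀ f • Y) := by
  intro x hx
  obtain ⟨W', hW, U, v, hx', hWU, h1⟩ := h x hx
  refine ⟨W', hW, U ⊓ U₀, holRes F (inf_le_right : U ⊓ U₀ ≤ U₀) f • v.res (inf_le_left : U ⊓ U₀ ≤ U), hx',
    fun y hy => ⟨hWU hy, hW₀ (hW hy)⟩, ?_⟩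
  rw [VField.res_smul, res_pull]
  have h2 : Related π (Y.res hW) (v.res (inf_le_left : U ⊓ U₀ ≤ U)) :=
    fun U'' hU'' W'' hW'' h'' g => h1 U'' (hU''.trans inf_le_left) W'' hW'' h'' g
  exact h2.smul inf_le_right (hW.trans hW₀) f

variable (π)

/-- A family of Lie algebroids over `π : X → S`: a reflexive sheaf, flat over `S`, with a bracket
and an anchor with values in `T_{X|S}`. As the anchor is vertical, `leibniz` shows that the
bracket is `π⁻¹𝒪_S`-bilinear. -/
structure Family extends LieAlgebroid E X where
  vertical : ∀ {U : Opens X} (s : Γ U), IsVertical π (anchor s)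
  reflexive : toHolModule.IsReflexive
  flat : toHolModule.IsFlatOver π

variable {π}

/-- The map `𝒜_S → Der_Lie(𝒜_S)`, `s ↦ {s, ·}`, is injective. -/
def Family.AdInjective (A : Family π) : Prop :=
  ∀ (U : Opens X) (s : A.Γ U),
    (∀ (W : Opens X) (h : W ≤ U) (t : A.Γ W), A.bracket (A.res h s) t = 0) → s = 0

/-- An unfolding of the family `A`: a Lie algebroid `L` on `X`, which is reflexive, containing `A`
as a subalgebroid such that `A = a⁻¹(Im a_S)` and `rank L = rank A + dim S`. -/
structure Unfolding (A : Family π) where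
  L : LieAlgebroid E X
  reflexive : L.IsReflexive
  /-- the inclusion of `A` -/
  incl : ∀ {U : Opens X}, A.Γ U →ₗ[Hol E U] L.Γ U
  incl_injective : ∀ {U : Opens X}, Function.Injective (incl (U := U))
  incl_res : ∀ {U V : Opens X} (h : V ≤ U) (s : A.Γ U), incl (A.res h s) = L.res h (incl s)
  incl_bracket : ∀ {U : Opens X} (s t : A.Γ U), incl (A.bracket s t) = L.bracket (incl s) (incl t)
  anchor_incl : ∀ {U : Opens X} (s : A.Γ U), L.anchor (incl s) = A.anchor s
  /-- a section whose image under the anchor lies in the image sheaf of `a_S` belongs to `A` -/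
  preimage : ∀ {U : Opens X} (s : L.Γ U),
    (∀ x ∈ U, ∃ (W : Opens X) (_ : x ∈ W) (h : W ≤ U) (t : A.Γ W),
      (L.anchor s).res h = A.anchor t) → ∃ t : A.Γ U, incl t = s
  rank_eq : ∀ x : X, L.rank x = A.rank x + Module.finrank ℂ F

/-- The map of cokernel sheaves `T_{X|S} / Im a_S → T_X / Im a` is an isomorphism: it is a
monomorphism and an epimorphism. -/
def Unfolding.IsTransversal {A : Family π} (L : Unfolding A) : Prop :=
  (∀ (U : Opens X) (Y : VField E U), IsVertical π Y →
    (∃ s : L.L.Γ U, L.L.anchor s = Y) →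
    ∀ x ∈ U, ∃ (W : Opens X) (_ : x ∈ W) (h : W ≤ U) (t : A.Γ W), A.anchor t = Y.res h) ∧
  (∀ (U : Opens X) (Y : VField E U), ∀ x ∈ U, ∃ (W : Opens X) (_ : x ∈ W) (h : W ≤ U)
    (Z : VField E W) (s : L.L.Γ W), IsVertical π Z ∧ Y.res h = Z + L.L.anchor s)

/-- Isomorphisms of unfoldings of `A`: isomorphisms of Lie algebroids which are the identity
on `A`. -/
structure Unfolding.Iso {A : Family π} (L M : Unfolding A) where
  equiv : ∀ {U : Opens X}, L.L.Γ U ≃ₗ[Hol E U] M.L.Γ U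
  equiv_res : ∀ {U V : Opens X} (h : V ≤ U) (s : L.L.Γ U),
    equiv (L.L.res h s) = M.L.res h (equiv s)
  equiv_bracket : ∀ {U : Opens X} (s t : L.L.Γ U),
    equiv (L.L.bracket s t) = M.L.bracket (equiv s) (equiv t)
  anchor_equiv : ∀ {U : Opens X} (s : L.L.Γ U), M.L.anchor (equiv s) = L.L.anchor s
  equiv_incl : ∀ {U : Opens X} (s : A.Γ U), equiv (L.incl s) = M.incl s

/-- Transversal unfoldings of `A`. -/
abbrev TransversalUnfolding (A : Family π) := {L : Unfolding A // L.IsTransversal}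

/-- Being isomorphic, as an equivalence relation on transversal unfoldings. -/
instance unfoldingSetoid (A : Family π) : Setoid (TransversalUnfolding A) where
  r L M := Nonempty (Unfolding.Iso L.1 M.1)
  iseqv := {
    refl := fun L => ⟨⟨LinearEquiv.refl _ _, fun _ _ => rfl, fun _ _ => rfl, fun _ => rfl,
      fun _ => rfl⟩⟩
    symm := fun {L M} ⟨e⟩ => ⟨⟨e.equiv.symm, fun h s => by
        rw [LinearEquiv.symm_apply_eq, e.equiv_res, LinearEquiv.apply_symm_apply], fun s t => by
        rw [LinearEquiv.symm_apply_eq, e.equiv_bracket, LinearEquiv.apply_symm_apply,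
          LinearEquiv.apply_symm_apply], fun s => by
        rw [← e.anchor_equiv, LinearEquiv.apply_symm_apply], fun s => by
        rw [LinearEquiv.symm_apply_eq, e.equiv_incl]⟩⟩
    trans := fun {L M N} ⟨e⟩ ⟨e'⟩ => ⟨⟨e.equiv.trans e'.equiv, fun h s => by
        simp [e.equiv_res, e'.equiv_res], fun s t => by
        simp [e.equiv_bracket, e'.equiv_bracket], fun s => by
        simp [e.anchor_equiv, e'.anchor_equiv], fun s => by
        simp [e.equiv_incl, e'.equiv_incl]⟩⟩ }

variable (A : Family π)

/-- The sheaf of `D^{≤1}_X(𝒜_S) ∩ Der_Lie(𝒜_S)`, restricted to the operators whose symbol is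
projectable. A section over `V` is a pair `(ψ, σ)` of an endomorphism `ψ` of the sheaf of abelian
groups `𝒜_S|_V` and a vector field `σ`, the symbol of `ψ`, such that `ψ ∘ f - f ∘ ψ = σ(f)` for
functions `f`, and `ψ` is a derivation of the bracket. (`ψ` is `ℂ`-linear, as `σ` kills
constants, and `σ` is determined by `ψ` where `𝒜_S` is not zero.) -/
def lieOps (V : Opens X) :
    AddSubgroup ((∀ W : {W : Opens X // W ≤ V}, A.Γ W.1 →+ A.Γ W.1) × VField E V) where
  carrier := {p |
    (∀ (W W' : Opens X) (hW : W ≤ V) (h : W' ≤ W) (s : A.Γ W),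
      A.res h (p.1 ⟨W, hW⟩ s) = p.1 ⟨W', h.trans hW⟩ (A.res h s)) ∧
    (∀ (W : Opens X) (hW : W ≤ V) (f : Hol E W) (s : A.Γ W),
      p.1 ⟨W, hW⟩ (f • s) - f • p.1 ⟨W, hW⟩ s = p.2.der hW f • s) ∧
    (∀ (W : Opens X) (hW : W ≤ V) (s t : A.Γ W),
      p.1 ⟨W, hW⟩ (A.bracket s t) =
        A.bracket (p.1 ⟨W, hW⟩ s) t + A.bracket s (p.1 ⟨W, hW⟩ t)) ∧
    IsProjectable π p.2}
  zero_mem' := ⟨fun W W' hW h s => by simp, fun W hW f s => by simp, fun W hW s t => by simp,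
    IsVertical.projectable fun _ _ _ _ _ => rfl⟩
  add_mem' := by
    rintro p q ⟨hp1, hp2, hp3, hp4⟩ ⟨hq1, hq2, hq3, hq4⟩
    refine ⟨fun W W' hW h s => ?_, fun W hW f s => ?_, fun W hW s t => ?_, hp4.add hq4⟩
    · simp [hp1 W W' hW h s, hq1 W W' hW h s]
    · simp only [Prod.fst_add, Prod.snd_add, Pi.add_apply, AddMonoidHom.add_apply,
        VField.add_der, smul_add, add_smul, ← hp2 W hW f s, ← hq2 W hW f s]
      abel
    · simp only [Prod.fst_add, Pi.add_apply, AddMonoidHom.add_apply, hp3, hq3, map_add]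
      abel
  neg_mem' := by
    rintro p ⟨hp1, hp2, hp3, hp4⟩
    refine ⟨fun W W' hW h s => ?_, fun W hW f s => ?_, fun W hW s t => ?_, hp4.neg⟩
    · simp [hp1 W W' hW h s]
    · simp only [Prod.fst_neg, Prod.snd_neg, Pi.neg_apply, AddMonoidHom.neg_apply,
        VField.neg_der, smul_neg, neg_smul, ← hp2 W hW f s]
      abel
    · simp only [Prod.fst_neg, Pi.neg_apply, AddMonoidHom.neg_apply, hp3, map_neg]
      abel

/-- The group of sections over `V` of `D^{≤1}_X(𝒜_S) ∩ Der_Lie(𝒜_S)` with projectable symbol. -/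
def LieOp (V : Opens X) : Type u := lieOps A V

noncomputable instance (V : Opens X) : AddCommGroup (LieOp A V) :=
  inferInstanceAs (AddCommGroup (lieOps A V))

namespace LieOp

variable {A}

/-- The underlying operator `𝒜_S(W) → 𝒜_S(W)`. -/
def op {V : Opens X} (p : LieOp A V) {W : Opens X} (h : W ≤ V) : A.Γ W →+ A.Γ W := p.1.1 ⟨W, h⟩

/-- The symbol. -/
def symbol {V : Opens X} (p : LieOp A V) : VField E V := p.1.2

theorem res_op {V : Opens X} (p : LieOp A V) {W W' : Opens X} (hW : W ≤ V) (h : W' ≤ W)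
    (s : A.Γ W) : A.res h (p.op hW s) = p.op (h.trans hW) (A.res h s) := p.2.1 W W' hW h s

theorem op_smul {V : Opens X} (p : LieOp A V) {W : Opens X} (hW : W ≤ V) (f : Hol E W)
    (s : A.Γ W) : p.op hW (f • s) = p.symbol.der hW f • s + f • p.op hW s :=
  sub_eq_iff_eq_add.1 (p.2.2.1 W hW f s)

theorem op_bracket {V : Opens X} (p : LieOp A V) {W : Opens X} (hW : W ≤ V) (s t : A.Γ W) :
    p.op hW (A.bracket s t) = A.bracket (p.op hW s) t + A.bracket s (p.op hW t) :=
  p.2.2.2.1 W hW s t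

theorem projectable {V : Opens X} (p : LieOp A V) : IsProjectable π p.symbol := p.2.2.2.2

theorem ext {V : Opens X} {p q : LieOp A V}
    (h : ∀ (W : Opens X) (hW : W ≤ V) (s : A.Γ W), p.op hW s = q.op hW s)
    (h' : p.symbol = q.symbol) : p = q := by
  apply Subtype.ext
  refine Prod.ext (funext fun W => ?_) h'
  ext s
  exact h W.1 W.2 s

@[simp] theorem add_op {V : Opens X} (p q : LieOp A V) {W : Opens X} (h : W ≤ V) (s : A.Γ W) :
    (p + q).op h s = p.op h s + q.op h s := rfl

@[simp] theorem neg_op {V : Opens X} (p : LieOp A V) {W : Opens X} (h : W ≤ V) (s : A.Γ W) :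
    (-p).op h s = -p.op h s := rfl

@[simp] theorem sub_op {V : Opens X} (p q : LieOp A V) {W : Opens X} (h : W ≤ V) (s : A.Γ W) :
    (p - q).op h s = p.op h s - q.op h s := by
  rw [sub_eq_add_neg, add_op, neg_op, sub_eq_add_neg]

@[simp] theorem zero_op {V : Opens X} {W : Opens X} (h : W ≤ V) (s : A.Γ W) :
    (0 : LieOp A V).op h s = 0 := rfl

@[simp] theorem add_symbol {V : Opens X} (p q : LieOp A V) :
    (p + q).symbol = p.symbol + q.symbol := rfl

@[simp] theorem sub_symbol {V : Opens X} (p q : LieOp A V) :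
    (p - q).symbol = p.symbol - q.symbol := rfl

@[simp] theorem neg_symbol {V : Opens X} (p : LieOp A V) : (-p).symbol = -p.symbol := rfl

@[simp] theorem zero_symbol {V : Opens X} : (0 : LieOp A V).symbol = 0 := rfl

/-- Restriction of operators. -/
noncomputable def res {V V' : Opens X} (h : V' ≤ V) : LieOp A V →+ LieOp A V' where
  toFun p := ⟨⟨fun W => p.op (W.2.trans h), p.symbol.res h⟩,
    fun _ _ hW h' s => p.res_op (hW.trans h) h' s,
    fun W hW f s => p.2.2.1 W (hW.trans h) f s,
    fun _ hW s t => p.op_bracket (hW.trans h) s t, p.projectable.res h⟩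
  map_zero' := rfl
  map_add' _ _ := rfl

@[simp] theorem res_op_apply {V V' : Opens X} (h : V' ≤ V) (p : LieOp A V) {W : Opens X}
    (hW : W ≤ V') (s : A.Γ W) : (res h p).op hW s = p.op (hW.trans h) s := rfl

@[simp] theorem res_symbol {V V' : Opens X} (h : V' ≤ V) (p : LieOp A V) :
    (res h p).symbol = p.symbol.res h := rfl

/-- The commutator of operators. -/
noncomputable def comm {V : Opens X} (p q : LieOp A V) : LieOp A V :=
  ⟨⟨fun W => (p.op W.2).comp (q.op W.2) - (q.op W.2).comp (p.op W.2), ⁅p.symbol, q.symbol⁆⟩, by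
    refine ⟨fun W W' hW h s => ?_, fun W hW f s => ?_, fun W hW s t => ?_,
      p.projectable.lie q.projectable⟩
    · simp [res_op]
    · simp only [AddMonoidHom.sub_apply, AddMonoidHom.comp_apply, op_smul, map_add,
        VField.lie_der, smul_sub, sub_smul]
      abel
    · simp only [AddMonoidHom.sub_apply, AddMonoidHom.comp_apply, op_bracket, map_add, map_sub]
      abel⟩

@[simp] theorem comm_op {V : Opens X} (p q : LieOp A V) {W : Opens X} (h : W ≤ V) (s : A.Γ W) :
    (comm p q).op h s = p.op h (q.op h s) - q.op h (p.op h s) := rfl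

@[simp] theorem comm_symbol {V : Opens X} (p q : LieOp A V) :
    (comm p q).symbol = ⁅p.symbol, q.symbol⁆ := rfl

theorem comm_add {V : Opens X} (p q r : LieOp A V) : comm p (q + r) = comm p q + comm p r := by
  apply ext
  · intro W hW s; simp; abel
  · ext1 W hW f; simp; abel

theorem add_comm' {V : Opens X} (p q r : LieOp A V) : comm (p + q) r = comm p r + comm q r := by
  apply ext
  · intro W hW s; simp; abel
  · ext1 W hW f; simp; abel

theorem comm_skew {V : Opens X} (p q : LieOp A V) : comm q p = -comm p q := by
  apply ext
  · intro W hW s; simp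
  · ext1 W hW f; simp

theorem comm_jacobi {V : Opens X} (p q r : LieOp A V) :
    comm p (comm q r) + comm q (comm r p) + comm r (comm p q) = 0 := by
  apply ext
  · intro W hW s; simp; abel
  · ext1 W hW f; simp; abel

theorem res_comm {V V' : Opens X} (h : V' ≤ V) (p q : LieOp A V) :
    res h (comm p q) = comm (res h p) (res h q) := rfl

theorem res_self {V : Opens X} (h : V ≤ V) (p : LieOp A V) : res h p = p := rfl

theorem res_res {V V' V'' : Opens X} (h : V' ≤ V) (h' : V'' ≤ V') (p : LieOp A V) :
    res h' (res h p) = res (h'.trans h) p := rfl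

end LieOp

/-- `𝒜_S → D^{≤1}_X(𝒜_S) ∩ Der_Lie(𝒜_S)`, `s ↦ {s, ·}`; the symbol is the anchor of `s`. -/
noncomputable def ad {V : Opens X} : A.Γ V →+ LieOp A V where
  toFun s := ⟨⟨fun W => A.bracket (A.res W.2 s), A.anchor s⟩, by
    refine ⟨fun W W' hW h t => ?_, fun W hW f t => ?_, fun W hW t r => ?_,
      (A.vertical s).projectable⟩
    · simp [A.bracket_res, A.res_res]
    · change A.bracket (A.res hW s) (f • t) - f • A.bracket (A.res hW s) t = _
      rw [A.skew, A.leibniz, A.skew t (A.res hW s), A.anchor_res]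
      simp
    · have := A.jacobi (A.res hW s) t r
      change A.bracket (A.res hW s) (A.bracket t r) =
        A.bracket (A.bracket (A.res hW s) t) r + A.bracket t (A.bracket (A.res hW s) r)
      rw [A.skew (A.res hW s) r, A.skew (A.bracket (A.res hW s) t) r] at this
      simp only [map_neg] at this
      rw [← sub_eq_zero, ← this]
      abel⟩
  map_zero' := by
    apply LieOp.ext
    · intro W hW t
      change A.bracket (A.res hW 0) t = 0
      simp
    · exact map_zero _
  map_add' s s' := by
    apply LieOp.ext
    · intro W hW t
      change A.bracket (A.res hW (s + s')) t = A.bracket (A.res hW s) t + A.bracket (A.res hW s') t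
      simp
    · exact map_add _ _ _

theorem ad_op {V W : Opens X} (h : W ≤ V) (s : A.Γ V) (t : A.Γ W) :
    (ad A s).op h t = A.bracket (A.res h s) t := rfl

theorem ad_symbol {V : Opens X} (s : A.Γ V) : (ad A s).symbol = A.anchor s := rfl

theorem res_ad {V V' : Opens X} (h : V' ≤ V) (s : A.Γ V) :
    LieOp.res h (ad A s) = ad A (A.res h s) := by
  apply LieOp.ext
  · intro W hW t
    rw [LieOp.res_op_apply, ad_op, ad_op, A.res_res]
  · rw [LieOp.res_symbol, ad_symbol, ad_symbol, A.anchor_res]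

theorem bracket_smul {V : Opens X} (f : Hol E V) (s t : A.Γ V) :
    A.bracket s (f • t) = f • A.bracket s t + (A.anchor s).der le_rfl f • t := by
  rw [A.skew (f • t) s, A.leibniz, A.skew s t]
  simp [sub_eq_add_neg, add_comm]

variable {A} in
/-- An auxiliary identity: the defect of `[σ, a(s)] = a(ψ(s))` kills all sections. -/
theorem defect_smul {V : Opens X} (p : LieOp A V) (s : A.Γ V) {W : Opens X} (hW : W ≤ V)
    (f : Hol E W) (t : A.Γ W) :
    (⁅p.symbol, A.anchor s⁆ - A.anchor (p.op le_rfl s)).der hW f • t = 0 := by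
  have h := p.op_bracket hW (A.res hW s) (f • t)
  rw [bracket_smul, map_add, p.op_smul, p.op_smul, p.op_smul, p.op_bracket, map_add,
    bracket_smul, bracket_smul, bracket_smul, ← p.res_op le_rfl hW] at h
  simp only [A.anchor_res, VField.der_res] at h
  rw [sub_eq_add_neg, VField.add_der, VField.neg_der, VField.lie_der]
  rw [add_smul, sub_smul, neg_smul]
  rw [smul_add, ← sub_eq_zero] at h
  rw [← h]
  abel

variable [IsManifold 𝓘(ℂ, E) ω X]

variable {A} in
/-- Symbols are compatible with the anchor. -/
theorem lie_anchor {V : Opens X} (p : LieOp A V) (s : A.Γ V) :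
    ⁅p.symbol, A.anchor s⁆ = A.anchor (p.op le_rfl s) := by
  rw [← sub_eq_zero]
  ext1 W hW f
  apply Hol.ext E
  intro x
  rw [VField.zero_der]
  suffices h : ∃ (W' : Opens X) (_ : x.1 ∈ W') (h : W' ≤ W), holRes E h
      ((⁅p.symbol, A.anchor s⁆ - A.anchor (p.op le_rfl s)).der hW f) = 0 by
    obtain ⟨W', hx, h, h0⟩ := h
    exact congrArg (fun k : Hol E W' => k ⟨x.1, hx⟩) h0
  by_cases hsub : Subsingleton (A.Stalk x.1)
  · have h0 : (⟦⟨⟨V, hW x.2⟩, s⟩⟧ : A.Stalk x.1) = 0 := Subsingleton.elim _ _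
    rw [DirectLimit.exists_eq_zero] at h0
    obtain ⟨W', hW', h0⟩ := h0
    change A.res hW' s = 0 at h0
    refine ⟨W'.1 ⊓ W, ⟨W'.2, x.2⟩, inf_le_right, ?_⟩
    rw [VField.res_der]
    have h1 : A.res (inf_le_left.trans hW' : W'.1 ⊓ W ≤ V) s = 0 := by
      rw [← A.res_res hW' inf_le_left, h0, map_zero]
    have h2 : VField.res (inf_le_left.trans hW' : W'.1 ⊓ W ≤ V)
        (⁅p.symbol, A.anchor s⁆ - A.anchor (p.op le_rfl s)) = 0 := by
      rw [map_sub, VField.res_lie, ← A.anchor_res, ← A.anchor_res, p.res_op, h1, map_zero,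
        map_zero, map_zero, sub_zero]
      ext1 W'' hW'' f
      simp
    have h3 := congrArg (fun Y : VField E (W'.1 ⊓ W) => Y.der le_rfl (holRes E inf_le_right f)) h2
    exact h3
  · rw [not_subsingleton_iff_nontrivial] at hsub
    obtain ⟨m, hm⟩ := exists_ne (0 : A.Stalk x.1)
    obtain ⟨W₀, t, rfl⟩ := DirectLimit.exists_eq_mk _ m
    let W₁ : Nhd x.1 := ⟨W₀.1 ⊓ W, W₀.2, x.2⟩
    have hW₁ : W₀ ≤ W₁ := (inf_le_left : W₀.1 ⊓ W ≤ W₀.1)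
    rw [A.mk_res W₀ W₁ hW₁] at hm
    have h1 := defect_smul p s (inf_le_right.trans hW : W₁.1 ≤ V)
      (holRes E (inf_le_right : W₁.1 ≤ W) f) (A.res hW₁ t)
    rw [← VField.res_der _ hW] at h1
    have h2 : (⟦⟨W₁, holRes E (inf_le_right : W₁.1 ≤ W)
        ((⁅p.symbol, A.anchor s⁆ - A.anchor (p.op le_rfl s)).der hW f)⟩⟧ : HolStalk E x.1) •
        (⟦⟨W₁, A.res hW₁ t⟩⟧ : A.Stalk x.1) = 0 := by
      rw [HolModule.smul_def, h1, ← DirectLimit.zero_def]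
    have := A.reflexive.2 x.1
    have h3 := (smul_eq_zero.1 h2).resolve_right hm
    rw [DirectLimit.exists_eq_zero] at h3
    obtain ⟨W', hW', h0⟩ := h3
    have hle : W'.1 ≤ W₁.1 := hW'
    exact ⟨W'.1, W'.2, hle.trans inf_le_right, h0⟩

theorem comm_ad {V : Opens X} (p : LieOp A V) (s : A.Γ V) :
    LieOp.comm p (ad A s) = ad A (p.op le_rfl s) := by
  apply LieOp.ext
  · intro W hW t
    rw [LieOp.comm_op, ad_op, ad_op, ad_op, p.op_bracket, p.res_op]
    abel
  · exact lie_anchor p s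


end Relative

section Quotient

variable {E : Type v} [NormedAddCommGroup E] [NormedSpace ℂ E]
  {F : Type w} [NormedAddCommGroup F] [NormedSpace ℂ F]
  {X : Type u} [TopologicalSpace X] [ChartedSpace E X]
  {S : Type u} [TopologicalSpace S] [ChartedSpace F S]
  {π : C^ω⟮𝓘(ℂ, E), X; 𝓘(ℂ, F), S⟯} (A : Family π)

theorem mem_inter {x : X} {V W : Opens X} (h : x ∈ V) (h' : x ∈ W) : x ∈ V ⊓ W := ⟨h, h'⟩

variable {A} in
/-- Multiplication of operators by functions pulled back from `S`. -/
noncomputable def LieOp.baseSmul {V : Opens X} {U : Opens S} (h : V ≤ pre π U) (g : Hol F U)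
    (p : LieOp A V) : LieOp A V :=
  ⟨⟨fun W => (DistribSMul.toAddMonoidHom (A.Γ W.1) (pull π (W.2.trans h) g)).comp (p.op W.2),
    pull π h g • p.symbol⟩, by
    refine ⟨fun W W' hW h' s => ?_, fun W hW f s => ?_, fun W hW s t => ?_,
      p.projectable.smul h g⟩
    · change A.res h' (pull π (hW.trans h) g • p.op hW s) =
        pull π ((h'.trans hW).trans h) g • p.op (h'.trans hW) (A.res h' s)
      rw [A.res_smul, p.res_op, res_pull]
    · change pull π (hW.trans h) g • p.op hW (f • s) - f • pull π (hW.trans h) g • p.op hW s =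
        (pull π h g • p.symbol).der hW f • s
      rw [p.op_smul, VField.smul_der, res_pull, smul_add, smul_comm f, add_sub_cancel_right,
        mul_smul]
    · change pull π (hW.trans h) g • p.op hW (A.bracket s t) =
        A.bracket (pull π (hW.trans h) g • p.op hW s) t +
          A.bracket s (pull π (hW.trans h) g • p.op hW t)
      rw [p.op_bracket, A.leibniz, bracket_smul, A.vertical t _ _ le_rfl _ g,
        A.vertical s _ _ le_rfl _ g]
      simp⟩

section BaseSmul

variable {A} {V : Opens X} {U : Opens S} (h : V ≤ pre π U) (g g' : Hol F U) (p q : LieOp A V)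

@[simp] theorem LieOp.baseSmul_op {W : Opens X} (hW : W ≤ V) (s : A.Γ W) :
    (baseSmul h g p).op hW s = pull π (hW.trans h) g • p.op hW s := rfl

@[simp] theorem LieOp.baseSmul_symbol : (baseSmul h g p).symbol = pull π h g • p.symbol := rfl

theorem LieOp.baseSmul_add : baseSmul h g (p + q) = baseSmul h g p + baseSmul h g q := by
  apply LieOp.ext
  · intro W hW s; simp
  · simp

theorem LieOp.add_baseSmul : baseSmul h (g + g') p = baseSmul h g p + baseSmul h g' p := by
  apply LieOp.ext
  · intro W hW s; simp [add_smul]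
  · simp [add_smul]

theorem LieOp.mul_baseSmul : baseSmul h (g * g') p = baseSmul h g (baseSmul h g' p) := by
  apply LieOp.ext
  · intro W hW s; simp [mul_smul]
  · simp [mul_smul]

theorem LieOp.one_baseSmul : baseSmul h 1 p = p := by
  apply LieOp.ext
  · intro W hW s; simp
  · simp

theorem LieOp.zero_baseSmul : baseSmul h 0 p = 0 := by
  apply LieOp.ext
  · intro W hW s; simp
  · simp

theorem LieOp.res_baseSmul {V' : Opens X} (hV : V' ≤ V) :
    res hV (baseSmul h g p) = baseSmul (hV.trans h) g (res hV p) := by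
  apply LieOp.ext
  · intro W hW s; simp
  · simp [VField.res_smul, res_pull]

theorem LieOp.baseSmul_ad (s : A.Γ V) : baseSmul h g (ad A s) = ad A (pull π h g • s) := by
  apply LieOp.ext
  · intro W hW t
    rw [baseSmul_op, ad_op, ad_op, A.res_smul, A.leibniz, res_pull,
      A.vertical t _ _ le_rfl _ g]
    simp
  · rw [baseSmul_symbol, ad_symbol, ad_symbol, map_smul]

/-- If `σ(ψ)` projects to `v`, then `[ψ, g ψ'] = g [ψ, ψ'] + v(g) ψ'`. -/
theorem LieOp.comm_baseSmul (v : VField F U) (hv : Related π p.symbol v) :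
    comm p (baseSmul h g q) = baseSmul h g (comm p q) + baseSmul h (v.der le_rfl g) q := by
  apply LieOp.ext
  · intro W hW s
    have := hv U le_rfl W hW (hW.trans h) g
    simp only [comm_op, baseSmul_op, p.op_smul, add_op, this, smul_sub]
    abel
  · ext1 W hW f
    have := hv U le_rfl W hW (hW.trans h) g
    simp only [comm_symbol, baseSmul_symbol, add_symbol, VField.lie_der, VField.smul_der,
      VField.add_der, res_pull, Derivation.leibniz, this, smul_eq_mul]
    ring

end BaseSmul

instance (x : X) : DirectedSystem (fun U : Nhd x => LieOp A U.1)
    (fun (U V : Nhd x) (h : U ≤ V) => LieOp.res (show V.1 ≤ U.1 from h)) where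
  map_self _ _ := rfl
  map_map _ _ _ _ _ _ := rfl

/-- The stalk at `x` of the sheaf of operators `LieOp A`. -/
def OpStalk (x : X) : Type u :=
  DirectLimit (fun U : Nhd x => LieOp A U.1)
    (fun (U V : Nhd x) (h : U ≤ V) => LieOp.res (show V.1 ≤ U.1 from h))

noncomputable instance (x : X) : AddCommGroup (OpStalk A x) :=
  inferInstanceAs (AddCommGroup (DirectLimit (fun U : Nhd x => LieOp A U.1)
    (fun (U V : Nhd x) (h : U ≤ V) => LieOp.res (show V.1 ≤ U.1 from h))))

section OpGerm

variable {A} {x : X}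

/-- The germ of an operator. -/
noncomputable def opGerm {V : Opens X} (hx : x ∈ V) : LieOp A V → OpStalk A x :=
  fun p => (⟦⟨⟨V, hx⟩, p⟩⟧ : DirectLimit (fun U : Nhd x => LieOp A U.1)
    (fun (U V : Nhd x) (h : U ≤ V) => LieOp.res (show V.1 ≤ U.1 from h)))

theorem exists_opGerm (q : OpStalk A x) :
    ∃ (V : Opens X) (hx : x ∈ V) (p : LieOp A V), q = opGerm hx p := by
  obtain ⟨U, p, h⟩ := DirectLimit.exists_eq_mk _ q
  exact ⟨U.1, U.2, p, h⟩

theorem opGerm_add {V : Opens X} (hx : x ∈ V) (p q : LieOp A V) :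
    opGerm hx (p + q) = opGerm hx p + opGerm hx q :=
  (DirectLimit.add_def (G := fun U : Nhd x => LieOp A U.1)
    (f := fun (U V : Nhd x) (h : U ≤ V) => LieOp.res (show V.1 ≤ U.1 from h)) ⟨V, hx⟩ p q).symm

theorem opGerm_zero {V : Opens X} (hx : x ∈ V) : opGerm hx (0 : LieOp A V) = 0 :=
  (DirectLimit.zero_def (G := fun U : Nhd x => LieOp A U.1)
    (f := fun (U V : Nhd x) (h : U ≤ V) => LieOp.res (show V.1 ≤ U.1 from h)) ⟨V, hx⟩).symm

theorem opGerm_neg {V : Opens X} (hx : x ∈ V) (p : LieOp A V) :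
    opGerm hx (-p) = -opGerm hx p := by
  rw [eq_neg_iff_add_eq_zero, ← opGerm_add, neg_add_cancel, opGerm_zero]

theorem opGerm_res {V V' : Opens X} (hx : x ∈ V) (hx' : x ∈ V') (h : V' ≤ V) (p : LieOp A V) :
    opGerm hx' (LieOp.res h p) = opGerm hx p :=
  Quotient.sound ⟨⟨V', hx'⟩, le_rfl, h, rfl⟩

theorem opGerm_eq {V V' : Opens X} {hx : x ∈ V} {hx' : x ∈ V'} {p : LieOp A V}
    {q : LieOp A V'} (h : opGerm hx p = opGerm hx' q) :
    ∃ (W : Opens X) (_ : x ∈ W) (h : W ≤ V) (h' : W ≤ V'), LieOp.res h p = LieOp.res h' q := by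
  obtain ⟨W, h1, h2, h⟩ := Quotient.exact h
  exact ⟨W.1, W.2, h1, h2, h⟩

/-- Maps out of the stalk. -/
noncomputable def opLift {M : Type*} [AddCommGroup M]
    (φ : ∀ (V : Opens X), x ∈ V → LieOp A V →+ M)
    (hφ : ∀ (V V' : Opens X) (hx : x ∈ V) (hx' : x ∈ V') (h : V' ≤ V) (p : LieOp A V),
      φ V' hx' (LieOp.res h p) = φ V hx p) : OpStalk A x →+ M where
  toFun := DirectLimit.lift (F := fun U : Nhd x => LieOp A U.1)
    (fun (U V : Nhd x) (h : U ≤ V) => LieOp.res (show V.1 ≤ U.1 from h))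
    (fun U p => φ U.1 U.2 p) (fun U V h p => (hφ U.1 V.1 U.2 V.2 h p).symm)
  map_zero' := map_zero (φ (Classical.arbitrary (Nhd x)).1 (Classical.arbitrary (Nhd x)).2)
  map_add' p q := by
    obtain ⟨V, hx, p, rfl⟩ := exists_opGerm p
    obtain ⟨V', hx', q, rfl⟩ := exists_opGerm q
    have hW : x ∈ V ⊓ V' := ⟨hx, hx'⟩
    rw [← opGerm_res hx hW inf_le_left p, ← opGerm_res hx' hW inf_le_right q, ← opGerm_add]
    exact map_add (φ _ hW) _ _

theorem opLift_opGerm {M : Type*} [AddCommGroup M]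
    (φ : ∀ (V : Opens X), x ∈ V → LieOp A V →+ M)
    (hφ : ∀ (V V' : Opens X) (hx : x ∈ V) (hx' : x ∈ V') (h : V' ≤ V) (p : LieOp A V),
      φ V' hx' (LieOp.res h p) = φ V hx p) {V : Opens X} (hx : x ∈ V) (p : LieOp A V) :
    opLift φ hφ (opGerm hx p) = φ V hx p := rfl

end OpGerm

/-- Germs of the operators `{s, ·}`. -/
noncomputable def adGerms (x : X) : AddSubgroup (OpStalk A x) where
  carrier := {q | ∃ (V : Opens X) (hx : x ∈ V) (s : A.Γ V), q = opGerm hx (ad A s)}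
  zero_mem' := ⟨⊤, Opens.mem_top x, 0, by rw [map_zero, opGerm_zero]⟩
  add_mem' := by
    rintro _ _ ⟨U, hU, s, rfl⟩ ⟨V, hV, t, rfl⟩
    have hW : x ∈ U ⊓ V := mem_inter hU hV
    refine ⟨U ⊓ V, hW, A.res inf_le_left s + A.res inf_le_right t, ?_⟩
    rw [map_add, opGerm_add, ← res_ad, ← res_ad, opGerm_res hU, opGerm_res hV]
  neg_mem' := by
    rintro _ ⟨U, hU, s, rfl⟩
    exact ⟨U, hU, -s, by rw [map_neg, opGerm_neg]⟩

/-- The stalk at `x` of `𝔲(𝒜_S)`, the quotient sheaf `LieOp A / 𝒜_S`. -/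
def UStalk (x : X) : Type u := OpStalk A x ⧸ adGerms A x

noncomputable instance (x : X) : AddCommGroup (UStalk A x) :=
  inferInstanceAs (AddCommGroup (OpStalk A x ⧸ adGerms A x))

/-- The class in `𝔲(𝒜_S)_x` of a germ of an operator. -/
noncomputable def uMk (x : X) : OpStalk A x →+ UStalk A x := QuotientAddGroup.mk' (adGerms A x)

theorem uMk_eq_zero {x : X} {q : OpStalk A x} : uMk A x q = 0 ↔ q ∈ adGerms A x :=
  QuotientAddGroup.eq_zero_iff q

variable {A} in
/-- The class in `𝔲(𝒜_S)_x` of an operator defined near `x`. -/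
noncomputable def uGerm {x : X} {V : Opens X} (hx : x ∈ V) (p : LieOp A V) : UStalk A x :=
  uMk A x (opGerm hx p)

section UGerm

variable {A} {x : X}

theorem exists_uGerm (q : UStalk A x) :
    ∃ (V : Opens X) (hx : x ∈ V) (p : LieOp A V), q = uGerm hx p := by
  obtain ⟨q, rfl⟩ := QuotientAddGroup.mk'_surjective (adGerms A x) q
  obtain ⟨V, hx, p, rfl⟩ := exists_opGerm q
  exact ⟨V, hx, p, rfl⟩

theorem uGerm_res {V V' : Opens X} (hx : x ∈ V) (hx' : x ∈ V') (h : V' ≤ V) (p : LieOp A V) :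
    uGerm hx' (LieOp.res h p) = uGerm hx p :=
  congrArg (uMk A x) (opGerm_res hx hx' h p)

theorem uGerm_add {V : Opens X} (hx : x ∈ V) (p q : LieOp A V) :
    uGerm hx (p + q) = uGerm hx p + uGerm hx q := by
  simp only [uGerm, opGerm_add, map_add]

theorem uGerm_neg {V : Opens X} (hx : x ∈ V) (p : LieOp A V) :
    uGerm hx (-p) = -uGerm hx p := by
  simp only [uGerm, opGerm_neg, map_neg]

theorem uGerm_zero {V : Opens X} (hx : x ∈ V) : uGerm hx (0 : LieOp A V) = 0 := by
  simp only [uGerm, opGerm_zero, map_zero]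

theorem uGerm_ad {V : Opens X} (hx : x ∈ V) (s : A.Γ V) : uGerm hx (ad A s) = 0 :=
  (uMk_eq_zero A).2 ⟨V, hx, s, rfl⟩

theorem uGerm_eq_iff {V V' : Opens X} {hx : x ∈ V} {hx' : x ∈ V'} {p : LieOp A V}
    {q : LieOp A V'} : uGerm hx p = uGerm hx' q ↔
      ∃ (W : Opens X) (_ : x ∈ W) (h : W ≤ V) (h' : W ≤ V') (s : A.Γ W),
        LieOp.res h p = LieOp.res h' q + ad A s := by
  constructor
  · intro h
    have hW : x ∈ V ⊓ V' := ⟨hx, hx'⟩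
    rw [← uGerm_res hx hW inf_le_left, ← uGerm_res hx' hW inf_le_right, ← sub_eq_zero,
      sub_eq_add_neg, ← uGerm_neg, ← uGerm_add] at h
    obtain ⟨W, h1, s, h2⟩ := (uMk_eq_zero A).1 h
    obtain ⟨W', h3, h4, h5, h6⟩ := opGerm_eq h2
    refine ⟨W', h3, h4.trans inf_le_left, h4.trans inf_le_right, A.res h5 s, ?_⟩
    rw [← res_ad, ← h6, map_add, map_neg, LieOp.res_res, LieOp.res_res]
    abel
  · rintro ⟨W, hW, h, h', s, he⟩
    rw [← uGerm_res hx hW h, he, uGerm_add, uGerm_ad, add_zero, uGerm_res]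

theorem exists_uGerm₂ (q r : UStalk A x) :
    ∃ (V : Opens X) (hx : x ∈ V) (p p' : LieOp A V), q = uGerm hx p ∧ r = uGerm hx p' := by
  obtain ⟨V, hx, p, rfl⟩ := exists_uGerm q
  obtain ⟨V', hx', p', rfl⟩ := exists_uGerm r
  exact ⟨V ⊓ V', mem_inter hx hx', LieOp.res inf_le_left p, LieOp.res inf_le_right p',
    (uGerm_res _ _ _ _).symm, (uGerm_res _ _ _ _).symm⟩

/-- Maps out of the stalk of `𝔲(𝒜_S)`. -/
noncomputable def uLift {M : Type*} [AddCommGroup M]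
    (φ : ∀ (V : Opens X), x ∈ V → LieOp A V →+ M)
    (hφ : ∀ (V V' : Opens X) (hx : x ∈ V) (hx' : x ∈ V') (h : V' ≤ V) (p : LieOp A V),
      φ V' hx' (LieOp.res h p) = φ V hx p)
    (h0 : ∀ (V : Opens X) (hx : x ∈ V) (s : A.Γ V), φ V hx (ad A s) = 0) : UStalk A x →+ M :=
  QuotientAddGroup.lift (adGerms A x) (opLift φ hφ) (by
    rintro _ ⟨V, hx, s, rfl⟩
    exact h0 V hx s)

theorem uLift_uGerm {M : Type*} [AddCommGroup M]
    (φ : ∀ (V : Opens X), x ∈ V → LieOp A V →+ M)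
    (hφ : ∀ (V V' : Opens X) (hx : x ∈ V) (hx' : x ∈ V') (h : V' ≤ V) (p : LieOp A V),
      φ V' hx' (LieOp.res h p) = φ V hx p)
    (h0 : ∀ (V : Opens X) (hx : x ∈ V) (s : A.Γ V), φ V hx (ad A s) = 0)
    {V : Opens X} (hx : x ∈ V) (p : LieOp A V) :
    uLift φ hφ h0 (uGerm hx p) = φ V hx p := rfl

/-- Multiplication by a function `g`, defined near `π x`, on the stalk of `𝔲(𝒜_S)`. -/
noncomputable def uSmul {U : Opens S} (hx : x ∈ pre π U) (g : Hol F U) :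
    UStalk A x →+ UStalk A x :=
  uLift (fun V hV => AddMonoidHom.mk'
      (fun p => uGerm (mem_inter hV hx)
        (LieOp.baseSmul inf_le_right g (LieOp.res inf_le_left p))) (fun p q => by
      rw [map_add, LieOp.baseSmul_add, uGerm_add]))
    (fun V V' hV hV' h p => by
      refine (uGerm_res (mem_inter hV hx) (⟨hV', hx⟩ : x ∈ V' ⊓ pre π U)
        (inf_le_inf_right _ h) _).symm.trans ?_ |>.symm
      rw [LieOp.res_baseSmul]; rfl)
    (fun V hV s => by
      change uGerm _ (LieOp.baseSmul inf_le_right g (LieOp.res inf_le_left (ad A s))) = 0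
      rw [res_ad, LieOp.baseSmul_ad, uGerm_ad])

theorem uSmul_uGerm {U : Opens S} (hx : x ∈ pre π U) (g : Hol F U) {V : Opens X} (hV : x ∈ V)
    (h : V ≤ pre π U) (p : LieOp A V) :
    uSmul hx g (uGerm hV p) = uGerm hV (LieOp.baseSmul h g p) := by
  refine Eq.trans ?_ (uGerm_res hV (mem_inter hV hx) inf_le_left _)
  rw [LieOp.res_baseSmul]; rfl

end UGerm

section UBracket

variable [IsManifold 𝓘(ℂ, E) ω X]

variable {A} in
/-- The bracket with the class of an operator `p` defined near `x`. -/
noncomputable def uBracketAux {x : X} {V : Opens X} (hx : x ∈ V) (p : LieOp A V) :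
    UStalk A x →+ UStalk A x :=
  uLift (fun W hW => AddMonoidHom.mk'
      (fun q => uGerm (mem_inter hx hW)
        (LieOp.comm (LieOp.res inf_le_left p) (LieOp.res inf_le_right q))) (fun q r => by
      rw [map_add, LieOp.comm_add, uGerm_add]))
    (fun W W' hW hW' h q => by
      refine (uGerm_res (mem_inter hx hW) (⟨hx, hW'⟩ : x ∈ V ⊓ W')
        (inf_le_inf_left _ h) _).symm.trans ?_ |>.symm
      rw [LieOp.res_comm]; rfl)
    (fun W hW s => by
      change uGerm _ (LieOp.comm (LieOp.res inf_le_left p) (LieOp.res inf_le_right (ad A s))) = 0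
      rw [res_ad, comm_ad, uGerm_ad])

variable {A} in
theorem uBracketAux_uGerm {x : X} {V : Opens X} (hx : x ∈ V) (p q : LieOp A V) :
    uBracketAux hx p (uGerm hx q) = uGerm hx (LieOp.comm p q) := by
  refine Eq.trans ?_ (uGerm_res hx (mem_inter hx hx) inf_le_left _)
  rw [LieOp.res_comm]; rfl

variable {A} in
theorem uBracketAux_res {x : X} {V V' : Opens X} (hx : x ∈ V) (hx' : x ∈ V') (h : V' ≤ V)
    (p : LieOp A V) : uBracketAux hx' (LieOp.res h p) = uBracketAux hx p := by
  ext q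
  obtain ⟨W, hW, q, rfl⟩ := exists_uGerm q
  have h0 : x ∈ V' ⊓ W := ⟨hx', hW⟩
  refine (uGerm_res (mem_inter hx hW) h0 (inf_le_inf_right _ h) _).symm.trans ?_ |>.symm
  rw [LieOp.res_comm]; rfl

/-- The bracket on the stalk of `𝔲(𝒜_S)`. -/
noncomputable def uBracket (x : X) : UStalk A x →+ UStalk A x →+ UStalk A x :=
  uLift (fun V hV => AddMonoidHom.mk' (fun p => uBracketAux hV p) (fun p p' => by
      ext q
      obtain ⟨W, hW, q, rfl⟩ := exists_uGerm q
      have h0 : x ∈ V ⊓ W := mem_inter hV hW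
      rw [AddMonoidHom.add_apply, ← uGerm_res hW h0 inf_le_right,
        ← uBracketAux_res hV h0 inf_le_left, ← uBracketAux_res hV h0 inf_le_left,
        ← uBracketAux_res hV h0 inf_le_left, uBracketAux_uGerm, uBracketAux_uGerm,
        uBracketAux_uGerm, map_add, LieOp.add_comm', uGerm_add]))
    (fun V V' hV hV' h p => uBracketAux_res hV hV' h p)
    (fun V hV s => by
      ext q
      obtain ⟨W, hW, q, rfl⟩ := exists_uGerm q
      have h0 : x ∈ V ⊓ W := mem_inter hV hW
      change uBracketAux hV (ad A s) _ = 0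
      rw [← uGerm_res hW h0 inf_le_right, ← uBracketAux_res hV h0 inf_le_left, res_ad,
        uBracketAux_uGerm, LieOp.comm_skew, comm_ad, uGerm_neg, uGerm_ad, neg_zero])

variable {A} in
theorem uBracket_uGerm {x : X} {V : Opens X} (hx : x ∈ V) (p q : LieOp A V) :
    uBracket A x (uGerm hx p) (uGerm hx q) = uGerm hx (LieOp.comm p q) :=
  uBracketAux_uGerm hx p q

end UBracket

section Sections

/-- The sections over `V` of the quotient sheaf `𝔲(𝒜_S) = LieOp A / 𝒜_S`: families of elements of
the stalks which are locally given by operators. -/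
noncomputable def uSections (V : Opens X) : AddSubgroup (∀ x : V, UStalk A x.1) where
  carrier := {t | ∀ x : V, ∃ (W : Opens X) (_ : x.1 ∈ W) (h : W ≤ V) (p : LieOp A W),
    ∀ (y : X) (hy : y ∈ W), t ⟨y, h hy⟩ = uGerm hy p}
  zero_mem' := fun x => ⟨V, x.2, le_rfl, 0, fun y hy => (uGerm_zero hy).symm⟩
  add_mem' := by
    intro t t' ht ht' x
    obtain ⟨W, hx, h, p, hp⟩ := ht x
    obtain ⟨W', hx', h', p', hp'⟩ := ht' x
    refine ⟨W ⊓ W', mem_inter hx hx', inf_le_left.trans h,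
      LieOp.res inf_le_left p + LieOp.res inf_le_right p', fun y hy => ?_⟩
    rw [uGerm_add, uGerm_res hy.1, uGerm_res hy.2, ← hp, ← hp']
    rfl
  neg_mem' := by
    intro t ht x
    obtain ⟨W, hx, h, p, hp⟩ := ht x
    exact ⟨W, hx, h, -p, fun y hy => by rw [uGerm_neg, ← hp]; rfl⟩

/-- The group `𝔲(𝒜_S)(V)`. -/
def USec (V : Opens X) : Type u := uSections A V

noncomputable instance (V : Opens X) : AddCommGroup (USec A V) :=
  inferInstanceAs (AddCommGroup (uSections A V))

namespace USec

variable {A}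

/-- The germ at `x` of a section of `𝔲(𝒜_S)`. -/
def germ {V : Opens X} (t : USec A V) {x : X} (hx : x ∈ V) : UStalk A x := t.1 ⟨x, hx⟩

/-- The operator `p` represents the section `t` on `W`. -/
def Rep {V : Opens X} (t : USec A V) {W : Opens X} (h : W ≤ V) (p : LieOp A W) : Prop :=
  ∀ (y : X) (hy : y ∈ W), t.germ (h hy) = uGerm hy p

theorem exists_rep {V : Opens X} (t : USec A V) {x : X} (hx : x ∈ V) :
    ∃ (W : Opens X) (_ : x ∈ W) (h : W ≤ V) (p : LieOp A W), t.Rep h p := t.2 ⟨x, hx⟩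

theorem ext {V : Opens X} {t t' : USec A V}
    (h : ∀ (x : X) (hx : x ∈ V), t.germ hx = t'.germ hx) : t = t' :=
  Subtype.ext (funext fun x => h x.1 x.2)

@[simp] theorem germ_add {V : Opens X} (t t' : USec A V) {x : X} (hx : x ∈ V) :
    (t + t').germ hx = t.germ hx + t'.germ hx := rfl

@[simp] theorem germ_zero {V : Opens X} {x : X} (hx : x ∈ V) : (0 : USec A V).germ hx = 0 := rfl

@[simp] theorem germ_neg {V : Opens X} (t : USec A V) {x : X} (hx : x ∈ V) :
    (-t).germ hx = -t.germ hx := rfl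

@[simp] theorem germ_sub {V : Opens X} (t t' : USec A V) {x : X} (hx : x ∈ V) :
    (t - t').germ hx = t.germ hx - t'.germ hx := by
  rw [sub_eq_add_neg, germ_add, germ_neg, sub_eq_add_neg]

theorem Rep.res {V : Opens X} {t : USec A V} {W W' : Opens X} {h : W ≤ V} {p : LieOp A W}
    (hp : t.Rep h p) (h' : W' ≤ W) : t.Rep (h'.trans h) (LieOp.res h' p) :=
  fun y hy => (hp y (h' hy)).trans (uGerm_res (h' hy) hy h' p).symm

theorem exists_rep₂ {V : Opens X} (t t' : USec A V) {x : X} (hx : x ∈ V) :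
    ∃ (W : Opens X) (_ : x ∈ W) (h : W ≤ V) (p p' : LieOp A W), t.Rep h p ∧ t'.Rep h p' := by
  obtain ⟨W, hW, h, p, hp⟩ := t.exists_rep hx
  obtain ⟨W', hW', h', p', hp'⟩ := t'.exists_rep hx
  exact ⟨W ⊓ W', mem_inter hW hW', inf_le_left.trans h, LieOp.res inf_le_left p,
    LieOp.res inf_le_right p', hp.res _, hp'.res _⟩

/-- Restriction of sections. -/
noncomputable def res {V V' : Opens X} (h : V' ≤ V) : USec A V →+ USec A V' where
  toFun t := ⟨fun x => t.germ (h x.2), fun x => by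
    obtain ⟨W, hx, hW, p, hp⟩ := t.exists_rep (h x.2)
    exact ⟨W ⊓ V', mem_inter hx x.2, inf_le_right, LieOp.res inf_le_left p,
      fun y hy => hp.res inf_le_left y hy⟩⟩
  map_zero' := rfl
  map_add' _ _ := rfl

@[simp] theorem germ_res {V V' : Opens X} (h : V' ≤ V) (t : USec A V) {x : X} (hx : x ∈ V') :
    (res h t).germ hx = t.germ (h hx) := rfl

theorem Rep.add {V : Opens X} {t t' : USec A V} {W : Opens X} {h : W ≤ V} {p p' : LieOp A W}
    (hp : t.Rep h p) (hp' : t'.Rep h p') : (t + t').Rep h (p + p') := fun y hy => by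
  rw [germ_add, hp y hy, hp' y hy, uGerm_add]

/-- Multiplication of a section over `π⁻¹(U)` by a function on `U`. -/
noncomputable def baseSmul {U : Opens S} (g : Hol F U) (t : USec A (pre π U)) :
    USec A (pre π U) :=
  ⟨fun x => uSmul x.2 g (t.germ x.2), fun x => by
    obtain ⟨W, hx, hW, p, hp⟩ := t.exists_rep x.2
    exact ⟨W, hx, hW, LieOp.baseSmul hW g p, fun y hy => by
      change uSmul _ g (t.germ (hW hy)) = _
      rw [hp y hy, uSmul_uGerm _ g hy hW]⟩⟩

theorem germ_baseSmul {U : Opens S} (g : Hol F U) (t : USec A (pre π U)) {x : X}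
    (hx : x ∈ pre π U) : (baseSmul g t).germ hx = uSmul hx g (t.germ hx) := rfl

theorem Rep.baseSmul {U : Opens S} {t : USec A (pre π U)} {W : Opens X} {h : W ≤ pre π U}
    {p : LieOp A W} (hp : t.Rep h p) (g : Hol F U) :
    (USec.baseSmul g t).Rep h (LieOp.baseSmul h g p) := fun y hy => by
  rw [germ_baseSmul, hp y hy, uSmul_uGerm _ g hy h]

/-- `π_*𝔲(𝒜_S)` is a sheaf of `𝒪_S`-modules. -/
noncomputable instance (U : Opens S) : Module (Hol F U) (USec A (pre π U)) where
  smul := baseSmul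
  one_smul t := ext fun x hx => by
    obtain ⟨W, hW, h, p, hp⟩ := t.exists_rep hx
    exact ((hp.baseSmul 1) x hW).trans (by rw [LieOp.one_baseSmul, ← hp x hW])
  mul_smul g g' t := ext fun x hx => by
    obtain ⟨W, hW, h, p, hp⟩ := t.exists_rep hx
    exact ((hp.baseSmul (g * g')) x hW).trans
      (by rw [LieOp.mul_baseSmul]; exact ((hp.baseSmul g').baseSmul g x hW).symm)
  smul_zero g := ext fun x hx => map_zero (uSmul hx g)
  smul_add g t t' := ext fun x hx => map_add (uSmul hx g) _ _
  add_smul g g' t := ext fun x hx => by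
    obtain ⟨W, hW, h, p, hp⟩ := t.exists_rep hx
    exact ((hp.baseSmul (g + g')) x hW).trans
      (by rw [LieOp.add_baseSmul]; exact ((hp.baseSmul g).add (hp.baseSmul g') x hW).symm)
  zero_smul t := ext fun x hx => by
    obtain ⟨W, hW, h, p, hp⟩ := t.exists_rep hx
    exact ((hp.baseSmul 0) x hW).trans (by rw [LieOp.zero_baseSmul, uGerm_zero]; rfl)

theorem Rep.smul {U : Opens S} {t : USec A (pre π U)} {W : Opens X} {h : W ≤ pre π U}
    {p : LieOp A W} (hp : t.Rep h p) (g : Hol F U) : (g • t).Rep h (LieOp.baseSmul h g p) :=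
  hp.baseSmul g

section Bracket

variable [IsManifold 𝓘(ℂ, E) ω X]

/-- The bracket of `𝔲(𝒜_S)`. -/
noncomputable def bracket {V : Opens X} : USec A V →+ USec A V →+ USec A V :=
  AddMonoidHom.mk' (fun t => AddMonoidHom.mk'
      (fun t' => ⟨fun x => uBracket A x.1 (t.germ x.2) (t'.germ x.2), fun x => by
        obtain ⟨W, hx, h, p, p', hp, hp'⟩ := exists_rep₂ t t' x.2
        exact ⟨W, hx, h, LieOp.comm p p', fun y hy => by
          change uBracket A y (t.germ (h hy)) (t'.germ (h hy)) = _
          rw [hp y hy, hp' y hy, uBracket_uGerm]⟩⟩)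
      (fun t' t'' => ext fun x hx => map_add (uBracket A x (t.germ hx)) _ _))
    (fun t t' => AddMonoidHom.ext fun t'' => ext fun x hx => by
      change uBracket A x ((t + t').germ hx) (t''.germ hx) =
        uBracket A x (t.germ hx) (t''.germ hx) + uBracket A x (t'.germ hx) (t''.germ hx)
      rw [germ_add, map_add, AddMonoidHom.add_apply])

theorem germ_bracket {V : Opens X} (t t' : USec A V) {x : X} (hx : x ∈ V) :
    (bracket t t').germ hx = uBracket A x (t.germ hx) (t'.germ hx) := rfl

theorem Rep.bracket {V : Opens X} {t t' : USec A V} {W : Opens X} {h : W ≤ V} {p p' : LieOp A W}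
    (hp : t.Rep h p) (hp' : t'.Rep h p') : (USec.bracket t t').Rep h (LieOp.comm p p') :=
  fun y hy => by rw [germ_bracket, hp y hy, hp' y hy, uBracket_uGerm]

theorem bracket_skew {V : Opens X} (t t' : USec A V) : bracket t' t = -bracket t t' :=
  ext fun x hx => by
    obtain ⟨W, hW, h, p, p', hp, hp'⟩ := exists_rep₂ t t' hx
    refine ((hp'.bracket hp) x hW).trans ?_
    rw [LieOp.comm_skew, uGerm_neg, ← (hp.bracket hp') x hW]
    rfl

theorem bracket_jacobi {V : Opens X} (t t' t'' : USec A V) :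
    bracket t (bracket t' t'') + bracket t' (bracket t'' t) + bracket t'' (bracket t t') = 0 :=
  ext fun x hx => by
    obtain ⟨W, hW, h, p, p', hp, hp'⟩ := exists_rep₂ t t' hx
    obtain ⟨W', hW', h', q, hq⟩ := t''.exists_rep hx
    have hp := hp.res (inf_le_left : W ⊓ W' ≤ W)
    have hp' := hp'.res (inf_le_left : W ⊓ W' ≤ W)
    have hq := hq.res (inf_le_right : W ⊓ W' ≤ W')
    refine (((hp.bracket (hp'.bracket hq)).add (hp'.bracket (hq.bracket hp))).add
      (hq.bracket (hp.bracket hp')) x (mem_inter hW hW')).trans ?_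
    rw [LieOp.comm_jacobi, uGerm_zero]
    rfl

end Bracket

end USec

end Sections

section Anchor

/-- Submersions are open. -/
theorem isOpenMap_of_submersion (hπ : Manifold.IsSubmersion 𝓘(ℂ, E) 𝓘(ℂ, F) ω π) :
    IsOpenMap π := by
  refine isOpenMap_iff_nhds_le.2 fun x => ?_
  let h := hπ.isSubmersionAt x
  have hx := h.mem_domChart_source
  have hy := h.mem_codChart_source
  set φ := h.domChart with hφ
  set ψ := h.codChart with hψ
  have hw : Set.EqOn (ψ ∘ π ∘ φ.symm) (Prod.fst ∘ h.equiv) φ.target := by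
    have := h.writtenInCharts
    simpa using this
  have e1 : nhds x = Filter.map φ.symm (nhds (φ x)) := (φ.symm_map_nhds_eq hx).symm
  have e2 : Filter.map ψ (Filter.map π (nhds x)) = Filter.map (Prod.fst ∘ h.equiv) (nhds (φ x)) := by
    rw [e1, Filter.map_map, Filter.map_map]
    apply Filter.map_congr
    filter_upwards [φ.open_target.mem_nhds (φ.map_source hx)] with z hz
    exact hw hz
  have e3 : Filter.map (Prod.fst ∘ h.equiv) (nhds (φ x)) = nhds (ψ (π x)) := by
    have : IsOpenMap (Prod.fst ∘ h.equiv) :=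
      isOpenMap_fst.comp h.equiv.toHomeomorph.isOpenMap
    have hc : Continuous (Prod.fst ∘ h.equiv) := continuous_fst.comp h.equiv.continuous
    have e4 : ψ (π x) = (Prod.fst ∘ h.equiv) (φ x) := by
      rw [← hw (φ.map_source hx)]
      simp [φ.left_inv hx]
    rw [e4]
    exact le_antisymm hc.continuousAt (this.nhds_le _)
  rw [e3] at e2
  have e5 := congrArg (Filter.map ψ.symm) e2
  rw [Filter.map_map, ψ.symm_map_nhds_eq hy] at e5
  rw [← e5]
  apply le_of_eq
  symm
  have e6 : Filter.map (ψ.symm ∘ ψ) (Filter.map π (nhds x)) =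
      Filter.map id (Filter.map π (nhds x)) := Filter.map_congr ?_
  · exact (e6.trans Filter.map_id).symm
  have hc : Filter.Tendsto π (nhds x) (nhds (π x)) := π.contMDiff.continuous.continuousAt
  filter_upwards [hc (ψ.open_source.mem_nhds hy)] with z hz
  exact ψ.left_inv hz

/-- A function on `π⁻¹(U)` which is locally the pull-back of holomorphic functions descends to
`U`, if `π` is open with connected non-empty fibres. -/
theorem exists_descent (hπ : IsOpenMap π) (hfib : ∀ s, IsConnected (π ⁻¹' {s})) {U : Opens S}
    (e : pre π U → ℂ)
    (he : ∀ x : pre π U, ∃ (W : Opens X) (_ : x.1 ∈ W) (U' : Opens S) (hU : U' ≤ U)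
      (hW : W ≤ pre π U') (k : Hol F U'),
      ∀ y : W, e ⟨y, pre_mono π hU (hW y.2)⟩ = pull π hW k y) :
    ∃ k : Hol F U, ∀ x, e x = pull π le_rfl k x := by
  have hconst : ∀ x y : pre π U, π x = π y → e x = e y := by
    intro x y hxy
    have hc : PreconnectedSpace (π ⁻¹' {π y.1}) :=
      isPreconnected_iff_preconnectedSpace.1 (hfib (π y.1)).isPreconnected
    have hmem : ∀ z : π ⁻¹' {π y.1}, z.1 ∈ pre π U := fun z => by
      change π z.1 ∈ U
      rw [show π z.1 = π y.1 from z.2]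
      exact y.2
    have hl : IsLocallyConstant (fun z : π ⁻¹' {π y.1} => e ⟨z.1, hmem z⟩) := by
      rw [IsLocallyConstant.iff_exists_open]
      intro z
      obtain ⟨W, hz, U', hU, hW, k, hk⟩ := he ⟨z.1, hmem z⟩
      refine ⟨Subtype.val ⁻¹' W, W.2.preimage continuous_subtype_val, hz, fun z' hz' => ?_⟩
      have h1 := hk ⟨z.1, hz⟩
      have h2 := hk ⟨z'.1, hz'⟩
      rw [pull_apply] at h1 h2
      refine h2.trans (Eq.trans ?_ h1.symm)
      congr 1
      exact Subtype.ext ((show π z'.1 = π y.1 from z'.2).trans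
        (show π z.1 = π y.1 from z.2).symm)
    exact hl.apply_eq_of_preconnectedSpace ⟨x.1, hxy⟩ ⟨y.1, rfl⟩
  choose σ hσ using fun s : S => (hfib s).nonempty
  have hσ' : ∀ s : S, π (σ s) = s := hσ
  have hmem : ∀ s : U, σ s ∈ pre π U := fun s => by
    change π (σ s) ∈ U
    rw [hσ']; exact s.2
  have hval : ∀ x : pre π U, e ⟨σ (π x), hmem ⟨π x, x.2⟩⟩ = e x := fun x =>
    hconst _ _ (hσ' _)
  refine ⟨⟨fun s => e ⟨σ s, hmem s⟩, contMDiff_of_local _ fun s => ?_⟩, fun x => (hval x).symm⟩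
  obtain ⟨W, hx, U', hU, hW, k, hk⟩ := he ⟨σ s, hmem s⟩
  have hle : (⟨π '' W, hπ W W.2⟩ : Opens S) ≤ U' := by
    rintro _ ⟨y, hy, rfl⟩; exact hW hy
  refine ⟨⟨π '' W, hπ W W.2⟩, ⟨σ s, hx, hσ' s⟩, hle.trans hU, holRes F hle k, ?_⟩
  rintro ⟨_, y, hy, rfl⟩
  exact (hval ⟨y, pre_mono π hU (hW hy)⟩).trans (hk ⟨y, hy⟩)

theorem pull_injective (hfib : ∀ s, IsConnected (π ⁻¹' {s})) {U : Opens S} {k k' : Hol F U}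
    (h : ∀ x : pre π U, pull π le_rfl k x = pull π le_rfl k' x) : k = k' := by
  apply Hol.ext F
  rintro ⟨s, hs⟩
  obtain ⟨x, hx⟩ := (hfib s).nonempty
  have hx : π x = s := hx
  subst hx
  exact h ⟨x, hs⟩

variable {A}

namespace USec

/-- The vector field `v` on `U` is the image of the section `t` of `π_*𝔲(𝒜_S)` under the anchor:
the symbols of the operators which represent `t` project to `v`. -/
def IsAnchor {U : Opens S} (t : USec A (pre π U)) (v : VField F U) : Prop :=
  ∀ (W : Opens X) (h : W ≤ pre π U) (p : LieOp A W), t.Rep h p → Related π p.symbol v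

/-- The function `k` on `U'` is the derivative of `g` in the direction of the symbol of `t`. -/
def IsVal {U : Opens S} (t : USec A (pre π U)) {U' : Opens S} (g k : Hol F U') : Prop :=
  ∀ (W : Opens X) (h : W ≤ pre π U) (p : LieOp A W), t.Rep h p →
    ∀ (W' : Opens X) (hW : W' ≤ W) (h' : W' ≤ pre π U'),
      p.symbol.der hW (pull π h' g) = pull π h' k

/-- Two representatives have the same derivative of `g`. -/
theorem Rep.val_eq {V : Opens X} {t : USec A V} {W₁ W₂ : Opens X} {h₁ : W₁ ≤ V} {h₂ : W₂ ≤ V}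
    {p₁ : LieOp A W₁} {p₂ : LieOp A W₂} (hp₁ : t.Rep h₁ p₁) (hp₂ : t.Rep h₂ p₂)
    {U' : Opens S} (g : Hol F U') {W₁' W₂' : Opens X} (hW₁ : W₁' ≤ W₁) (hW₂ : W₂' ≤ W₂)
    (h₁' : W₁' ≤ pre π U') (h₂' : W₂' ≤ pre π U') {x : X} (hx₁ : x ∈ W₁') (hx₂ : x ∈ W₂') :
    p₁.symbol.der hW₁ (pull π h₁' g) ⟨x, hx₁⟩ = p₂.symbol.der hW₂ (pull π h₂' g) ⟨x, hx₂⟩ := by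
  have h := (hp₁ x (hW₁ hx₁)).symm.trans (hp₂ x (hW₂ hx₂))
  obtain ⟨W, hx, k₁, k₂, s, hs⟩ := uGerm_eq_iff.1 h
  have hs' := congrArg LieOp.symbol hs
  rw [LieOp.add_symbol, LieOp.res_symbol, LieOp.res_symbol, ad_symbol] at hs'
  let W' : Opens X := W ⊓ (W₁' ⊓ W₂')
  have hx' : x ∈ W' := mem_inter hx (mem_inter hx₁ hx₂)
  have l₁ : W' ≤ W₁' := inf_le_right.trans inf_le_left
  have l₂ : W' ≤ W₂' := inf_le_right.trans inf_le_right
  have e := congrArg (fun Y : VField E W => Y.der (inf_le_left : W' ≤ W)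
    (pull π (l₁.trans h₁') g) ⟨x, hx'⟩) hs'
  have e₁ := congrArg (fun k : Hol E W' => k ⟨x, hx'⟩)
    (VField.res_der p₁.symbol hW₁ l₁ (pull π h₁' g))
  have e₂ := congrArg (fun k : Hol E W' => k ⟨x, hx'⟩)
    (VField.res_der p₂.symbol hW₂ l₂ (pull π h₂' g))
  have ev := A.vertical s U' W' inf_le_left (l₁.trans h₁') g
  simp only [VField.der_res, VField.add_der, ev, add_zero] at e
  exact e₁.trans (e.trans e₂.symm)

theorem exists_isVal (hπ : IsOpenMap π) (hfib : ∀ s, IsConnected (π ⁻¹' {s})) {U : Opens S}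
    (t : USec A (pre π U)) {U' : Opens S} (hU : U' ≤ U) (g : Hol F U') :
    ∃ k : Hol F U', t.IsVal g k := by
  choose W hW h p hp using fun x : pre π U' => t.exists_rep (pre_mono π hU x.2)
  let e : pre π U' → ℂ := fun x =>
    (p x).symbol.der inf_le_left (pull π (inf_le_right : W x ⊓ pre π U' ≤ pre π U') g)
      ⟨x.1, mem_inter (hW x) x.2⟩
  obtain ⟨k, hk⟩ := exists_descent hπ hfib e (by
    intro x
    obtain ⟨W₁, l₁, U₁, v, hx, hWU, hr⟩ := (p x).projectable x.1 (hW x)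
    have hWi : W₁ ⊓ pre π U' ≤ pre π (U₁ ⊓ U') := fun y hy => ⟨hWU hy.1, hy.2⟩
    refine ⟨W₁ ⊓ pre π U', mem_inter hx x.2, U₁ ⊓ U', inf_le_right,
      hWi, v.der inf_le_left (holRes F inf_le_right g), fun y => ?_⟩
    have e₁ := congrArg (fun k : Hol E (W₁ ⊓ pre π U') => k y)
      (hr (U₁ ⊓ U') inf_le_left (W₁ ⊓ pre π U') inf_le_left hWi
        (holRes F inf_le_right g))
    refine Eq.trans ?_ e₁
    exact Rep.val_eq (hp _) (hp x) g _ (inf_le_left.trans l₁) _ inf_le_right _ y.2)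
  refine ⟨k, fun W' h' q hq W'' l h'' => Hol.ext E fun y => ?_⟩
  have := hk ⟨y.1, h'' y.2⟩
  refine Eq.trans ?_ this
  exact Rep.val_eq hq (hp _) g _ _ _ _ _ _

theorem IsVal.unique (hfib : ∀ s, IsConnected (π ⁻¹' {s})) {U : Opens S} {t : USec A (pre π U)}
    {U' : Opens S} (hU : U' ≤ U) {g k k' : Hol F U'} (hk : t.IsVal g k) (hk' : t.IsVal g k') :
    k = k' := by
  apply pull_injective hfib
  intro x
  obtain ⟨W, hx, h, p, hp⟩ := t.exists_rep (pre_mono π hU x.2)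
  have e := (hk W h p hp (W ⊓ pre π U') inf_le_left inf_le_right).symm.trans
    (hk' W h p hp (W ⊓ pre π U') inf_le_left inf_le_right)
  exact congrArg (fun k : Hol E (W ⊓ pre π U') => k ⟨x.1, mem_inter hx x.2⟩) e

theorem exists_anchor (hπ : IsOpenMap π) (hfib : ∀ s, IsConnected (π ⁻¹' {s})) {U : Opens S}
    (t : USec A (pre π U)) : ∃ v : VField F U, t.IsAnchor v := by
  choose k hk using fun (U' : {U' : Opens S // U' ≤ U}) (g : Hol F U'.1) =>
    exists_isVal hπ hfib t U'.2 g
  let D : ∀ U' : {U' : Opens S // U' ≤ U}, Derivation ℂ (Hol F U'.1) (Hol F U'.1) := fun U' =>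
    Derivation.mk' { toFun := k U'
                     map_add' := fun g g' => IsVal.unique hfib U'.2 (hk U' (g + g'))
                       fun W h p hp W' hW h' => by
                         rw [map_add, map_add, map_add, hk U' g W h p hp, hk U' g' W h p hp]
                     map_smul' := fun c g => IsVal.unique hfib U'.2 (hk U' (c • g))
                       fun W h p hp W' hW h' => by
                         change _ = pull π h' (c • k U' g)
                         rw [pull_algebraMap, pull_algebraMap, Derivation.map_smul,
                           hk U' g W h p hp] }
      (fun g g' => IsVal.unique hfib U'.2 (hk U' (g * g')) fun W h p hp W' hW h' => by
        change _ = pull π h' (g • k U' g' + g' • k U' g)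
        rw [map_mul, Derivation.leibniz, hk U' g W h p hp, hk U' g' W h p hp]
        simp only [smul_eq_mul, map_add, map_mul])
  refine ⟨⟨D, fun W W' hW h g => ?_⟩, fun W h p hp U' hU W' hW h' g => ?_⟩
  · refine IsVal.unique hfib (h.trans hW) ?_ (hk ⟨W', h.trans hW⟩ (holRes F h g))
    intro V hV p hp V' hV' h'
    rw [pull_res, pull_res]
    exact hk ⟨W, hW⟩ g V hV p hp V' hV' _
  · exact hk ⟨U', hU⟩ g W h p hp W' hW h'

theorem anchor_unique (hfib : ∀ s, IsConnected (π ⁻¹' {s})) {U : Opens S} (t : USec A (pre π U))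
    {v v' : VField F U} (h : t.IsAnchor v)
    (h' : ∀ x ∈ pre π U, ∃ (W : Opens X) (_ : x ∈ W) (h : W ≤ pre π U) (p : LieOp A W),
      t.Rep h p ∧ Related π p.symbol v') : v = v' := by
  ext1 U' hU g
  apply pull_injective hfib
  intro x
  obtain ⟨W, hx, hW, p, hp, hr⟩ := h' x.1 (pre_mono π hU x.2)
  have e := (h W hW p hp U' hU (W ⊓ pre π U') inf_le_left inf_le_right g).symm.trans
    (hr U' hU (W ⊓ pre π U') inf_le_left inf_le_right g)
  exact congrArg (fun k : Hol E (W ⊓ pre π U') => k ⟨x.1, mem_inter hx x.2⟩) e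

end USec

end Anchor

section Pushforward

variable (hπ : Manifold.IsSubmersion 𝓘(ℂ, E) 𝓘(ℂ, F) ω π) (hfib : ∀ s, IsConnected (π ⁻¹' {s}))

/-- The anchor of `π_*𝔲(𝒜_S)`. -/
noncomputable def uAnchor {U : Opens S} (t : USec A (pre π U)) : VField F U :=
  (USec.exists_anchor (isOpenMap_of_submersion hπ) hfib t).choose

theorem uAnchor_spec {U : Opens S} (t : USec A (pre π U)) : t.IsAnchor (uAnchor A hπ hfib t) :=
  (USec.exists_anchor (isOpenMap_of_submersion hπ) hfib t).choose_spec

theorem uAnchor_eq {U : Opens S} (t : USec A (pre π U)) (v : VField F U)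
    (h : ∀ x ∈ pre π U, ∃ (W : Opens X) (_ : x ∈ W) (h : W ≤ pre π U) (p : LieOp A W),
      t.Rep h p ∧ Related π p.symbol v) : uAnchor A hπ hfib t = v :=
  USec.anchor_unique hfib t (uAnchor_spec A hπ hfib t) h

variable [IsManifold 𝓘(ℂ, E) ω X]

/-- The Lie algebroid `π_*𝔲(𝒜_S)` on `S`. -/
noncomputable def pushforward : LieAlgebroid F S where
  Γ U := USec A (pre π U)
  res h := USec.res (pre_mono π h)
  res_smul h g t := USec.ext fun x hx => by
    obtain ⟨W, hW, h', p, hp⟩ := (USec.res (pre_mono π h) t).exists_rep hx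
    have hp' : t.Rep (h'.trans (pre_mono π h)) p := hp
    exact (hp'.smul g x hW).trans (hp.smul (holRes F h g) x hW).symm
  res_self _ := rfl
  res_res _ _ _ := rfl
  glue U s hs := by
    have hmem : ∀ x : pre π (iSup U), ∃ i, x.1 ∈ pre π (U i) := fun x => by
      have : π x.1 ∈ iSup U := x.2
      obtain ⟨i, hi⟩ := Opens.mem_iSup.1 this
      exact ⟨i, hi⟩
    have hcomp : ∀ (i j) (x : X) (hi : x ∈ pre π (U i)) (hj : x ∈ pre π (U j)),
        (s i).germ hi = (s j).germ hj := fun i j x hi hj =>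
      congrArg (fun t : USec A (pre π (U i ⊓ U j)) => t.germ (mem_inter hi hj)) (hs i j)
    choose c hc using hmem
    refine ⟨⟨fun x => (s (c x)).germ (hc x), fun x => ?_⟩, fun i => USec.ext fun x hx => ?_,
      fun t ht => USec.ext fun x hx => ?_⟩
    · obtain ⟨W, hW, h, p, hp⟩ := (s (c x)).exists_rep (hc x)
      exact ⟨W, hW, h.trans (pre_mono π (le_iSup U (c x))), p, fun y hy =>
        (hcomp _ _ y _ (h hy)).trans (hp y hy)⟩
    · exact hcomp _ _ x _ _
    · exact congrArg (fun t : USec A (pre π (U (c ⟨x, hx⟩))) => t.germ (hc ⟨x, hx⟩))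
        (ht (c ⟨x, hx⟩))
  anchor := {
    toFun := uAnchor A hπ hfib
    map_add' := fun t t' => uAnchor_eq A hπ hfib _ _ fun x hx => by
      obtain ⟨W, hW, h, p, p', hp, hp'⟩ := USec.exists_rep₂ t t' hx
      exact ⟨W, hW, h, p + p', hp.add hp',
        (uAnchor_spec A hπ hfib t W h p hp).add (uAnchor_spec A hπ hfib t' W h p' hp')⟩
    map_smul' := fun g t => uAnchor_eq A hπ hfib _ _ fun x hx => by
      obtain ⟨W, hW, h, p, hp⟩ := t.exists_rep hx
      exact ⟨W, hW, h, _, hp.smul g,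
        (uAnchor_spec A hπ hfib t W h p hp).smul le_rfl h g⟩ }
  anchor_res h t := uAnchor_eq A hπ hfib _ _ fun x hx => by
    obtain ⟨W, hW, h', p, hp⟩ := (USec.res (pre_mono π h) t).exists_rep hx
    exact ⟨W, hW, h', p, hp,
      (uAnchor_spec A hπ hfib t W (h'.trans (pre_mono π h)) p hp).res le_rfl h⟩
  bracket := USec.bracket
  bracket_res _ _ _ := rfl
  skew := USec.bracket_skew
  jacobi := USec.bracket_jacobi
  leibniz {U} g t t' := USec.ext fun x hx => by
    obtain ⟨W, hW, h, p, p', hp, hp'⟩ := USec.exists_rep₂ t t' hx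
    have hv := uAnchor_spec A hπ hfib t' W h p' hp'
    have e := LieOp.comm_baseSmul h g p' p _ hv
    have e₁ := (hp.bracket hp').smul g x hW
    have e₂ := hp.smul ((uAnchor A hπ hfib t').der le_rfl g) x hW
    refine (((hp.smul g).bracket hp') x hW).trans ?_
    refine Eq.trans ?_ (USec.germ_sub _ _ hx).symm
    refine Eq.trans ?_ (congrArg₂ (· - ·) e₁ e₂).symm
    have e₃ : LieOp.baseSmul h g (LieOp.comm p' p) = -LieOp.baseSmul h g (LieOp.comm p p') := by
      rw [eq_neg_iff_add_eq_zero, ← LieOp.baseSmul_add, LieOp.comm_skew p p', neg_add_cancel]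
      exact LieOp.ext (fun W hW s => by simp) (by simp)
    rw [LieOp.comm_skew, e, e₃, neg_add, neg_neg, uGerm_add, uGerm_neg, ← sub_eq_add_neg]

end Pushforward

/-- A flat connection on a Lie algebroid `L`: a bracket-preserving morphism of sheaves of
`𝒪`-modules which is a section of the anchor. -/
structure FlatConnection {F : Type w} [NormedAddCommGroup F] [NormedSpace ℂ F]
    {S : Type u} [TopologicalSpace S] [ChartedSpace F S] (L : LieAlgebroid F S) where
  map : ∀ {U : Opens S}, VField F U →ₗ[Hol F U] L.Γ U
  map_res : ∀ {U V : Opens S} (h : V ≤ U) (v : VField F U), map (v.res h) = L.res h (map v)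
  map_lie : ∀ {U : Opens S} (v v' : VField F U), map ⁅v, v'⁆ = L.bracket (map v) (map v')
  anchor_map : ∀ {U : Opens S} (v : VField F U), L.anchor (map v) = v

end Quotient

end LieUnf

open LieUnf

/-!
The proof compares unfoldings and connections through the way in which sections of an unfolding
act on `𝒜_S`.

*From unfoldings to connections.* By transversality, every vector field `v` on an open subset of
`S` lifts locally to sections `u` of a transversal unfolding whose anchor projects to `v`, and two
such lifts differ by a section with vertical anchor, which belongs to `𝒜_S`. As the stalks are
torsion-free modules over domains, the anchor preserves brackets, so `{u, ·}` preserves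
`𝒜_S` (`Unfolding.Acts.exists_of_projectable`), and its class modulo `ad(𝒜_S)` depends on `v` only.
This defines the flat connection `Unfolding.connection`, which is determined by the action of
sections (`Unfolding.IsConn`) and hence invariant under isomorphisms.

*From connections to unfoldings.* Let `∇` be a flat connection and assume that the adjoint map is
injective. Over a pair `W ⊆ π⁻¹(U)` of open subsets (`Patch`) consider the operators `p` over `W`
which represent `∇(v)` for a vector field `v` on `U` (`Ops`). The prolongation (`Prol`) is the
`𝒪(W)`-module generated by them, modulo `𝒪(U)`-linearity and modulo the relations
`ad(f s) = f ad(s)`; the commutator extends to it by the Leibniz rule. In coordinates `tᵢ` on `U`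
with operators `qᵢ` over the coordinate fields (`Frame`), every operator is uniquely of the form
`ad(s) + ∑ v(tᵢ) qᵢ`, because an operator whose class in `𝔲(𝒜_S)` vanishes is `ad(s)` for a unique
section `s`. Hence the prolongation is `𝒜_S(W) ⊕ 𝒪(W)^m`, where `m = dim S` (`Frame.equiv`). It
follows that the prolongations glue to a Lie algebroid on `X` (`prolAlgebroid`), which is an
extension of `𝒜_S` by a locally free sheaf, so it is reflexive of the correct rank, and which is a
transversal unfolding (`prolUnfolding`).

*The two constructions are inverse to each other.* The generator `p` of the prolongation acts on
`𝒜_S` as `p`, so the connection of `prolUnfolding` is `∇` (`prolUnfolding_connection`). Conversely,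
if `∇` is the connection of a transversal unfolding `L`, then every operator which represents
`∇(v)` is the action of a unique section of `L`. This defines a homomorphism from the prolongation
to `L` (`Unfolding.prolHom`), which is bijective, as both are extensions of the same free
module by `𝒜_S` (`Unfolding.isoProl`).

The analytic input consists of coordinate vector fields, of Hadamard's lemma, which shows that a
vector field is determined by its values on coordinates, and of the lifting of
coordinate fields along a submersion (`exists_coords_lift`).
-/

namespace LieUnf

set_option linter.unusedSectionVars false

/-! ### Coordinate vector fields and lifting along submersions -/

section Charts

variable {E : Type v} [NormedAddCommGroup E] [NormedSpace ℂ E]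
  {X : Type u} [TopologicalSpace X] [ChartedSpace E X]

/-- The extension by zero of a function on the open set `U`. -/
noncomputable def holExt {U : Opens X} (f : Hol E U) : X → ℂ := Function.extend Subtype.val f 0

theorem holExt_apply {U : Opens X} (f : Hol E U) (x : U) : holExt f x.1 = f x :=
  Subtype.val_injective.extend_apply f 0 x

theorem holExt_of_mem {U : Opens X} (f : Hol E U) {x : X} (hx : x ∈ U) :
    holExt f x = f ⟨x, hx⟩ :=
  holExt_apply f ⟨x, hx⟩

theorem contMDiffAt_holExt {U : Opens X} (f : Hol E U) {x : X} (hx : x ∈ U) :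
    ContMDiffAt 𝓘(ℂ, E) 𝓘(ℂ, ℂ) ω (holExt f) x := by
  have h2 : ContMDiffAt 𝓘(ℂ, E) 𝓘(ℂ, ℂ) ω (fun y : U => holExt f y.1) ⟨x, hx⟩ := by
    have : (fun y : U => holExt f y.1) = f := funext fun y => holExt_apply f y
    rw [this]
    exact f.contMDiff E _
  exact contMDiffAt_subtype_iff.1 h2

/-- A function which is holomorphic on a neighbourhood of each point of `U`, as an element of
`𝒪_X(U)`. -/
def Hol.ofFun {U : Opens X} (k : X → ℂ)
    (hk : ∀ x ∈ U, ContMDiffAt 𝓘(ℂ, E) 𝓘(ℂ, ℂ) ω k x) : Hol E U :=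
  ⟨fun x => k x.1, fun x => contMDiffAt_subtype_iff.2 (hk x.1 x.2)⟩

/-- Evaluation at a point. -/
def Hol.ev {U : Opens X} (x : U) : Hol E U →+* ℂ where
  toFun f := f x
  map_one' := rfl
  map_mul' _ _ := rfl
  map_zero' := rfl
  map_add' _ _ := rfl

theorem Hol.add_apply {U : Opens X} (f g : Hol E U) (x : U) : (f + g) x = f x + g x := rfl

theorem Hol.mul_apply {U : Opens X} (f g : Hol E U) (x : U) : (f * g) x = f x * g x := rfl

theorem Hol.sum_apply {U : Opens X} {ι : Type*} (s : Finset ι) (f : ι → Hol E U) (x : U) :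
    (∑ i ∈ s, f i) x = ∑ i ∈ s, f i x := map_sum (Hol.ev x) f s

variable {c : OpenPartialHomeomorph X E}

theorem analyticAt_chart (hc : c ∈ IsManifold.maximalAtlas 𝓘(ℂ, E) ω X)
    {k : X → ℂ} {x : X} (hx : x ∈ c.source)
    (hk : ContMDiffAt 𝓘(ℂ, E) 𝓘(ℂ, ℂ) ω k x) : AnalyticAt ℂ (k ∘ c.symm) (c x) := by
  have h1 : ContMDiffAt 𝓘(ℂ, E) 𝓘(ℂ, E) ω c.symm (c x) :=
    contMDiffAt_symm_of_mem_maximalAtlas hc (c.map_source hx)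
  have h2 : ContMDiffAt 𝓘(ℂ, E) 𝓘(ℂ, ℂ) ω k (c.symm (c x)) := by rwa [c.left_inv hx]
  exact (h2.comp (c x) h1).contDiffAt.analyticAt

theorem contMDiffAt_comp_chart (hc : c ∈ IsManifold.maximalAtlas 𝓘(ℂ, E) ω X)
    {k : E → ℂ} {x : X} (hx : x ∈ c.source)
    (hk : AnalyticAt ℂ k (c x)) : ContMDiffAt 𝓘(ℂ, E) 𝓘(ℂ, ℂ) ω (k ∘ c) x :=
  ContMDiffAt.comp x hk.contDiffAt.contMDiffAt (contMDiffAt_of_mem_maximalAtlas hc hx)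

/-- The derivative at `x` in the direction of the vector `e`, in the chart `c`. -/
noncomputable def chartDeriv (c : OpenPartialHomeomorph X E) (e : E) (k : X → ℂ) (x : X) : ℂ :=
  fderiv ℂ (k ∘ c.symm) (c x) e

theorem eventuallyEq_chart {k k' : X → ℂ} {x : X} (hx : x ∈ c.source)
    (h : k =ᶠ[nhds x] k') : k ∘ c.symm =ᶠ[nhds (c x)] k' ∘ c.symm := by
  have h1 : Filter.Tendsto c.symm (nhds (c x)) (nhds x) := by
    have := c.continuousAt_symm (c.map_source hx)
    rwa [ContinuousAt, c.left_inv hx] at this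
  exact h1.eventually h

theorem chartDeriv_congr {e : E} {k k' : X → ℂ} {x : X} (hx : x ∈ c.source)
    (h : k =ᶠ[nhds x] k') : chartDeriv c e k x = chartDeriv c e k' x := by
  rw [chartDeriv, (eventuallyEq_chart hx h).fderiv_eq, chartDeriv]

theorem holExt_eventuallyEq {U : Opens X} (f : Hol E U) {k : X → ℂ} {x : X} (hx : x ∈ U)
    (h : ∀ y : U, f y = k y.1) : holExt f =ᶠ[nhds x] k := by
  filter_upwards [U.2.mem_nhds hx] with y hy
  rw [holExt_of_mem f hy, h]

theorem contMDiffAt_chartDeriv (hc : c ∈ IsManifold.maximalAtlas 𝓘(ℂ, E) ω X)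
    (e : E) {k : X → ℂ} {x : X} (hx : x ∈ c.source)
    (hk : ContMDiffAt 𝓘(ℂ, E) 𝓘(ℂ, ℂ) ω k x) :
    ContMDiffAt 𝓘(ℂ, E) 𝓘(ℂ, ℂ) ω (chartDeriv c e k) x := by
  refine contMDiffAt_comp_chart hc (k := fun z => fderiv ℂ (k ∘ c.symm) z e) hx ?_
  exact (ContinuousLinearMap.apply ℂ ℂ e).analyticAt _ |>.comp
    (analyticAt_chart hc hx hk).fderiv

/-- The coordinate vector field `∂/∂e` in the chart `c`, where `e` is a vector in the model
space. -/
noncomputable def coordField (hc : c ∈ IsManifold.maximalAtlas 𝓘(ℂ, E) ω X) (e : E) :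
    VField E (⟨c.source, c.open_source⟩ : Opens X) :=
  ⟨fun W => Derivation.mk'
    { toFun := fun f => Hol.ofFun (chartDeriv c e (holExt f))
        fun x hx => contMDiffAt_chartDeriv hc e (W.2 hx) (contMDiffAt_holExt f hx)
      map_add' := fun f g => Hol.ext E fun x => by
        have hx : x.1 ∈ c.source := W.2 x.2
        have h1 := (analyticAt_chart hc hx (contMDiffAt_holExt f x.2)).differentiableAt
        have h2 := (analyticAt_chart hc hx (contMDiffAt_holExt g x.2)).differentiableAt
        have h3 : holExt (f + g) =ᶠ[nhds x.1] holExt f + holExt g :=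
          holExt_eventuallyEq _ x.2 fun y => by
            rw [Pi.add_apply, holExt_apply, holExt_apply]; rfl
        refine (chartDeriv_congr hx h3).trans ?_
        exact congrArg (fun l => l e) (fderiv_add h1 h2)
      map_smul' := fun a f => Hol.ext E fun x => by
        have hx : x.1 ∈ c.source := W.2 x.2
        have h1 := (analyticAt_chart hc hx (contMDiffAt_holExt f x.2)).differentiableAt
        have h3 : holExt (a • f) =ᶠ[nhds x.1] a • holExt f :=
          holExt_eventuallyEq _ x.2 fun y => by
            rw [Pi.smul_apply, holExt_apply]; rfl
        refine (chartDeriv_congr hx h3).trans ?_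
        exact congrArg (fun l => l e) (fderiv_const_smul h1 a) }
    (fun f g => Hol.ext E fun x => by
        have hx : x.1 ∈ c.source := W.2 x.2
        have h1 := (analyticAt_chart hc hx (contMDiffAt_holExt f x.2)).differentiableAt
        have h2 := (analyticAt_chart hc hx (contMDiffAt_holExt g x.2)).differentiableAt
        have h3 : holExt (f * g) =ᶠ[nhds x.1] holExt f * holExt g :=
          holExt_eventuallyEq _ x.2 fun y => by
            rw [Pi.mul_apply, holExt_apply, holExt_apply]; rfl
        refine (chartDeriv_congr hx h3).trans ?_
        refine (congrArg (fun l => l e) (fderiv_mul h1 h2)).trans ?_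
        simp only [Function.comp_apply, c.left_inv hx, holExt_apply]
        rfl),
    fun W W' hW h f => Hol.ext E fun x => by
      have hx : x.1 ∈ c.source := hW (h x.2)
      refine chartDeriv_congr hx ?_
      filter_upwards [W'.2.mem_nhds x.2] with y hy
      rw [holExt_of_mem f (h hy), holExt_of_mem _ hy]
      rfl⟩

theorem coordField_der (hc : c ∈ IsManifold.maximalAtlas 𝓘(ℂ, E) ω X) (e : E) {W : Opens X}
    (hW : W ≤ ⟨c.source, c.open_source⟩) (f : Hol E W)
    (x : W) : (coordField hc e).der hW f x = chartDeriv c e (holExt f) x.1 := rfl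

theorem coordField_linear (hc : c ∈ IsManifold.maximalAtlas 𝓘(ℂ, E) ω X) (e : E)
    (l : E →L[ℂ] ℂ) {W : Opens X}
    (hW : W ≤ ⟨c.source, c.open_source⟩) (f : Hol E W) (hf : ∀ x : W, f x = l (c x.1)) (x : W) :
    (coordField hc e).der hW f x = l e := by
  have hx : x.1 ∈ c.source := hW x.2
  rw [coordField_der, chartDeriv]
  have h : holExt f ∘ c.symm =ᶠ[nhds (c x.1)] l := by
    refine (eventuallyEq_chart hx (holExt_eventuallyEq f x.2 (k := l ∘ c) hf)).trans ?_
    filter_upwards [c.open_target.mem_nhds (c.map_source hx)] with z hz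
    simp [c.right_inv hz]
  rw [h.fderiv_eq, l.fderiv]

end Charts

/-- Hadamard's lemma for analytic functions. -/
theorem exists_hadamard {E : Type v} [NormedAddCommGroup E] [NormedSpace ℂ E] {f : E → ℂ} {z₀ : E}
    (hf : AnalyticAt ℂ f z₀) :
    ∃ h : E → (E →L[ℂ] ℂ), AnalyticAt ℂ h z₀ ∧ ∀ᶠ z in nhds z₀, f z = f z₀ + h z (z - z₀) := by
  obtain ⟨p, r, hp⟩ := hf
  have hr : p.shift.radius = p.radius := p.radius_shift
  have hq : 0 < p.shift.radius := hr ▸ hp.r_pos.trans_le hp.r_le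
  refine ⟨fun z => p.shift.sum (z - z₀), ?_, ?_⟩
  · have h1 := p.shift.hasFPowerSeriesOnBall hq
    have h2 : AnalyticAt ℂ p.shift.sum (z₀ - z₀) := by rw [sub_self]; exact h1.analyticAt
    exact AnalyticAt.comp (f := fun z => z - z₀) h2 (by fun_prop)
  · filter_upwards [Metric.eball_mem_nhds z₀ hp.r_pos] with z hz
    have hz' : z - z₀ ∈ Metric.eball (0 : E) r := by
      simpa [Metric.mem_eball, edist_eq_enorm_sub] using hz
    have hs := hp.hasSum hz'
    rw [add_sub_cancel] at hs
    have h1 := (p.shift.hasFPowerSeriesOnBall hq).hasSum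
      (y := z - z₀) (Metric.eball_subset_eball (hp.r_le.trans_eq hr.symm) hz')
    rw [zero_add] at h1
    have h2 := h1.mapL (ContinuousLinearMap.apply ℂ ℂ (z - z₀))
    have h3 := (hasSum_nat_add_iff' 1).2 hs
    rw [Finset.sum_range_one, hp.coeff_zero] at h3
    have h4 := h3.unique (h2.congr_fun (fun n => ?_))
    · exact (sub_eq_iff_eq_add'.1 h4)
    · change _ = p (n + 1) (Fin.snoc (fun _ => z - z₀) (z - z₀))
      congr 1
      exact (Fin.snoc_init_self (fun _ : Fin (n + 1) => z - z₀)).symm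

section VFieldBasic

variable {E : Type v} [NormedAddCommGroup E] [NormedSpace ℂ E]
  {X : Type u} [TopologicalSpace X] [ChartedSpace E X]

/-- The action of vector fields on a function, as a homomorphism. -/
noncomputable def VField.derHom {U : Opens X} {W : Opens X} (hW : W ≤ U) (f : Hol E W) :
    VField E U →+ Hol E W where
  toFun Y := Y.der hW f
  map_zero' := rfl
  map_add' _ _ := rfl

theorem VField.sum_der {U : Opens X} {ι : Type*} (s : Finset ι) (Y : ι → VField E U)
    {W : Opens X} (hW : W ≤ U) (f : Hol E W) :
    (∑ i ∈ s, Y i).der hW f = ∑ i ∈ s, (Y i).der hW f :=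
  map_sum (VField.derHom hW f) Y s

end VFieldBasic

section Coordinates

variable {F : Type w} [NormedAddCommGroup F] [NormedSpace ℂ F]
  {S : Type u} [TopologicalSpace S] [ChartedSpace F S]

/-- Holomorphic functions `tᵢ` and vector fields `ξᵢ` on `U`, such that `ξᵢ(tⱼ) = δᵢⱼ`, such that
every vector field `v` on an open subset of `U` is equal to `∑ v(tᵢ) ξᵢ`, and such that near each
point `x` the functions `tᵢ - tᵢ(x)` generate the ideal of the functions vanishing at `x`. -/
structure Coords (F : Type w) [NormedAddCommGroup F] [NormedSpace ℂ F]
    {S : Type u} [TopologicalSpace S] [ChartedSpace F S] (m : ℕ) (U : Opens S) where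
  t : Fin m → Hol F U
  ξ : Fin m → VField F U
  ξ_t : ∀ i j, (ξ i).der le_rfl (t j) = if i = j then 1 else 0
  expand : ∀ {U' : Opens S} (h : U' ≤ U) (v : VField F U'),
    v = ∑ i, v.der le_rfl (holRes F h (t i)) • (ξ i).res h
  hadamard : ∀ {U' : Opens S} (h : U' ≤ U) (f : Hol F U') (x : U'),
    ∃ (W : Opens S) (_ : x.1 ∈ W) (hW : W ≤ U') (k : Fin m → Hol F W),
      holRes F hW f = algebraMap ℂ _ (f x) +
        ∑ i, (holRes F (hW.trans h) (t i) - algebraMap ℂ _ (t i ⟨x, h x.2⟩)) * k i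

/-- Hadamard's lemma in the linear coordinates of a chart. -/
theorem exists_hadamard_coords [FiniteDimensional ℂ F] {c : OpenPartialHomeomorph S F}
    (hc : c ∈ IsManifold.maximalAtlas 𝓘(ℂ, F) ω S)
    {U : Opens S} (hU : U ≤ ⟨c.source, c.open_source⟩) {m : ℕ} (b : Module.Basis (Fin m) ℂ F)
    (t : Fin m → Hol F U) (ht : ∀ i (x : U), t i x = b.repr (c x.1) i)
    (f : Hol F U) (x : U) :
    ∃ (W : Opens S) (_ : x.1 ∈ W) (hW : W ≤ U) (k : Fin m → Hol F W),
      holRes F hW f = algebraMap ℂ _ (f x) +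
        ∑ i, (holRes F hW (t i) - algebraMap ℂ _ (t i x)) * k i := by
  have hx : x.1 ∈ c.source := hU x.2
  obtain ⟨h, hh, he⟩ := exists_hadamard (analyticAt_chart hc hx (contMDiffAt_holExt f x.2))
  have h1 : ∀ᶠ y in nhds x.1, AnalyticAt ℂ h (c y) ∧
      (holExt f ∘ c.symm) (c y) = (holExt f ∘ c.symm) (c x.1) + h (c y) (c y - c x.1) :=
    (c.continuousAt hx).eventually (hh.eventually_analyticAt.and he)
  obtain ⟨W, hW, hWo, hxW⟩ := eventually_nhds_iff.1 h1
  have hW' : (⟨W, hWo⟩ ⊓ U : Opens S) ≤ U := inf_le_right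
  refine ⟨⟨W, hWo⟩ ⊓ U, ⟨hxW, x.2⟩, hW', fun i => Hol.ofFun ((fun z => h z (b i)) ∘ c)
    fun y hy => contMDiffAt_comp_chart hc (hU (hW' hy))
      ((ContinuousLinearMap.apply ℂ ℂ (b i)).analyticAt _ |>.comp (hW y hy.1).1), ?_⟩
  apply Hol.ext F
  intro y
  have hy : y.1 ∈ c.source := hU (hW' y.2)
  have e := (hW y.1 y.2.1).2
  simp only [Function.comp_apply, c.left_inv hy, c.left_inv hx] at e
  rw [holExt_of_mem f (hW' y.2), holExt_of_mem f x.2] at e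
  have e2 : c y.1 - c x.1 = ∑ i, (t i ⟨y.1, hW' y.2⟩ - t i x) • b i := by
    conv_lhs => rw [← b.sum_repr (c y.1 - c x.1)]
    simp [ht]
  rw [e2, map_sum] at e
  refine e.trans ?_
  rw [Hol.add_apply, Hol.sum_apply]
  congr 1
  refine Finset.sum_congr rfl fun i _ => ?_
  rw [map_smul]
  rfl

/-- Vector fields are determined by their values on linear coordinates. -/
theorem vfield_apply_eq_sum [FiniteDimensional ℂ F] {c : OpenPartialHomeomorph S F}
    (hc : c ∈ IsManifold.maximalAtlas 𝓘(ℂ, F) ω S)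
    {U : Opens S} (hU : U ≤ ⟨c.source, c.open_source⟩) {m : ℕ} (b : Module.Basis (Fin m) ℂ F)
    (t : Fin m → Hol F U) (ht : ∀ i (x : U), t i x = b.repr (c x.1) i)
    (f : Hol F U) (x : U) :
    ∃ a : Fin m → ℂ, ∀ v : VField F U, v.der le_rfl f x = ∑ i, v.der le_rfl (t i) x * a i := by
  obtain ⟨W', hx', hW', k, hf⟩ := exists_hadamard_coords hc hU b t ht f x
  refine ⟨fun i => k i ⟨x, hx'⟩, fun v => ?_⟩
  have e1 := congrArg (fun g : Hol F W' => g ⟨x.1, hx'⟩) (v.res_der le_rfl hW' f)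
  have e3 : ∀ i, v.der hW' (holRes F hW' (t i)) ⟨x.1, hx'⟩ = v.der le_rfl (t i) x := fun i =>
    (congrArg (fun g : Hol F W' => g ⟨x.1, hx'⟩) (v.res_der le_rfl hW' (t i))).symm
  refine e1.trans ?_
  rw [hf]
  simp only [map_add, map_sum, Derivation.leibniz, Derivation.map_algebraMap, map_sub, sub_zero,
    zero_add, Hol.sum_apply, Hol.add_apply, smul_eq_mul, Hol.mul_apply]
  refine Finset.sum_congr rfl fun i _ => ?_
  have e4 : (holRes F hW' (t i) - algebraMap ℂ _ (t i x)) ⟨x.1, hx'⟩ = 0 := sub_self (t i x)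
  rw [e4, e3, zero_mul, zero_add, mul_comm]

/-- The linear coordinates of a chart. -/
noncomputable def chartCoords [FiniteDimensional ℂ F] {c : OpenPartialHomeomorph S F}
    (hc : c ∈ IsManifold.maximalAtlas 𝓘(ℂ, F) ω S) {m : ℕ} (b : Module.Basis (Fin m) ℂ F) :
    Coords F m (⟨c.source, c.open_source⟩ : Opens S) where
  t i := Hol.ofFun ((b.coord i).toContinuousLinearMap ∘ c) fun _ hx =>
    contMDiffAt_comp_chart hc hx (ContinuousLinearMap.analyticAt _ _)
  ξ i := coordField hc (b i)
  ξ_t i j := Hol.ext F fun x => by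
    refine (coordField_linear hc (b i) (b.coord j).toContinuousLinearMap le_rfl _
      (fun _ => rfl) x).trans ?_
    have : (b.coord j).toContinuousLinearMap (b i) = if i = j then 1 else 0 := by
      simp [Finsupp.single_apply]
    rw [this]
    split_ifs <;> rfl
  hadamard h f x := exists_hadamard_coords hc h b
    (fun i => holRes F h (Hol.ofFun ((b.coord i).toContinuousLinearMap ∘ c) fun _ hx =>
      contMDiffAt_comp_chart hc hx (ContinuousLinearMap.analyticAt _ _))) (fun _ _ => rfl) f x
  expand {U'} h v := by
    ext1 W hW f
    apply Hol.ext F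
    intro x
    obtain ⟨a, ha⟩ := vfield_apply_eq_sum hc (hW.trans h) b
      (fun i => holRes F (hW.trans h) (Hol.ofFun ((b.coord i).toContinuousLinearMap ∘ c) fun _ hx =>
        contMDiffAt_comp_chart hc hx (ContinuousLinearMap.analyticAt _ _)))
      (fun i y => rfl) f x
    have e1 : ∀ i, (coordField hc (b i)).der (hW.trans h) f x = a i := fun i => by
      refine (ha ((coordField hc (b i)).res (hW.trans h))).trans ?_
      rw [Finset.sum_eq_single i]
      · refine Eq.trans (congrArg (· * a i) (coordField_linear hc (b i)
          (b.coord i).toContinuousLinearMap (hW.trans h) _ (fun _ => rfl) x)) ?_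
        simp
      · intro j _ hj
        refine Eq.trans (congrArg (· * a j) (coordField_linear hc (b i)
          (b.coord j).toContinuousLinearMap (hW.trans h) _ (fun _ => rfl) x)) ?_
        simp [hj.symm]
      · simp
    refine (ha (v.res hW)).trans ?_
    rw [VField.sum_der, Hol.sum_apply]
    refine Finset.sum_congr rfl fun i _ => ?_
    rw [VField.smul_der, v.res_der, ← e1]
    rfl

end Coordinates

section Submersion

variable {E : Type v} [NormedAddCommGroup E] [NormedSpace ℂ E]
  {F : Type w} [NormedAddCommGroup F] [NormedSpace ℂ F] [FiniteDimensional ℂ F]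
  {X : Type u} [TopologicalSpace X] [ChartedSpace E X]
  {S : Type u} [TopologicalSpace S] [ChartedSpace F S]
  {π : C^ω⟮𝓘(ℂ, E), X; 𝓘(ℂ, F), S⟯}

/-- Near each point of `X` there are coordinates on `S`, the coordinate fields of which lift
to `X`. -/
theorem exists_coords_lift (hπ : Manifold.IsSubmersion 𝓘(ℂ, E) 𝓘(ℂ, F) ω π) (x : X) :
    ∃ (U : Opens S) (W : Opens X) (_ : x ∈ W) (_ : W ≤ pre π U)
      (C : Coords F (Module.finrank ℂ F) U) (Ξ : Fin (Module.finrank ℂ F) → VField E W),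
      ∀ i, Related π (Ξ i) (C.ξ i) := by
  let h := hπ.isSubmersionAt x
  have hx := h.mem_domChart_source
  have hy := h.mem_codChart_source
  let φ := h.domChart
  let ψ := h.codChart
  have hφ : φ ∈ IsManifold.maximalAtlas 𝓘(ℂ, E) ω X := h.domChart_mem_maximalAtlas
  have hψ : ψ ∈ IsManifold.maximalAtlas 𝓘(ℂ, F) ω S := h.codChart_mem_maximalAtlas
  have hw : Set.EqOn (ψ ∘ π ∘ φ.symm) (Prod.fst ∘ h.equiv) φ.target := by
    have := h.writtenInCharts
    simpa using this
  let b := Module.finBasis ℂ F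
  let U : Opens S := ⟨ψ.source, ψ.open_source⟩
  let W : Opens X := ⟨φ.source, φ.open_source⟩ ⊓ pre π U
  refine ⟨U, W, ⟨hx, hy⟩, inf_le_right, chartCoords hψ b,
    fun i => (coordField hφ (h.equiv.symm (b i, 0))).res inf_le_left, fun i => ?_⟩
  intro U' hU W' hW hWU g
  apply Hol.ext E
  intro y
  have hyφ : y.1 ∈ φ.source := (hW y.2).1
  have hyψ : π y.1 ∈ ψ.source := (hW y.2).2
  change chartDeriv φ (h.equiv.symm (b i, 0)) (holExt (pull π hWU g)) y.1 =
    chartDeriv ψ (b i) (holExt g) (π y.1)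
  let L : E →L[ℂ] F := (ContinuousLinearMap.fst ℂ F h.complement).comp h.equiv.toContinuousLinearMap
  have hL : L (φ y.1) = ψ (π y.1) := by
    have := hw (φ.map_source hyφ)
    simp only [Function.comp_apply, φ.left_inv hyφ] at this
    exact this.symm
  have hcomp : holExt (pull π hWU g) ∘ φ.symm =ᶠ[nhds (φ y.1)] (holExt g ∘ ψ.symm) ∘ L := by
    refine (eventuallyEq_chart hyφ (k' := holExt g ∘ π)
      (holExt_eventuallyEq _ y.2 fun y' => (holExt_of_mem g (hWU y'.2)).symm)).trans ?_
    have hc : ContinuousAt (π ∘ φ.symm) (φ y.1) := by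
      refine ContinuousAt.comp π.contMDiff.continuous.continuousAt
        (φ.continuousAt_symm (φ.map_source hyφ))
    have hmem : (π ∘ φ.symm) (φ y.1) ∈ ψ.source := by
      rw [Function.comp_apply, φ.left_inv hyφ]; exact hyψ
    filter_upwards [φ.open_target.mem_nhds (φ.map_source hyφ),
      hc (ψ.open_source.mem_nhds hmem)] with z hz hz'
    have e : L z = ψ (π (φ.symm z)) := (hw hz).symm
    simp only [Function.comp_apply, e]
    exact congrArg (holExt g) (ψ.left_inv hz').symm
  rw [chartDeriv, hcomp.fderiv_eq, fderiv_comp]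
  · rw [hL, L.fderiv, ContinuousLinearMap.comp_apply, chartDeriv]
    congr 1
    simp [L]
  · rw [hL]
    exact (analyticAt_chart hψ hyψ (contMDiffAt_holExt g (hWU y.2))).differentiableAt
  · exact L.differentiableAt

end Submersion

/-! ### Gluing sections -/

section Gluing

variable {E : Type v} [NormedAddCommGroup E] [NormedSpace ℂ E]
  {X : Type u} [TopologicalSpace X] [ChartedSpace E X]

namespace HolModule

variable (A : HolModule E X)

theorem res_eq_self {U : Opens X} (h : U ≤ U) (s : A.Γ U) : A.res h s = s := A.res_self s

theorem eq_of_local {U : Opens X} {s t : A.Γ U}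
    (h : ∀ x ∈ U, ∃ (W : Opens X) (_ : x ∈ W) (hW : W ≤ U), A.res hW s = A.res hW t) : s = t := by
  choose W hx hW he using fun x : U => h x.1 x.2
  have hU : U = iSup W := le_antisymm
    (fun x hx' => Opens.mem_iSup.2 ⟨⟨x, hx'⟩, hx ⟨x, hx'⟩⟩) (iSup_le hW)
  have key : ∀ (V : Opens X) (hV : U = V) (hVU : V ≤ U), A.res hVU s = A.res hVU t → s = t := by
    rintro _ rfl _ h
    simpa only [A.res_eq_self] using h
  refine key _ hU hU.ge ?_
  obtain ⟨r, -, hr⟩ := A.glue W (fun x => A.res (hW x) s) (fun i j => by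
    rw [A.res_res, A.res_res])
  exact (hr _ fun i => A.res_res _ _ _).trans (hr _ fun i => by rw [A.res_res, he]).symm

/-- Sections which are locally characterized by a property `P` exist if they exist locally. -/
theorem exists_of_local {U : Opens X} (P : ∀ W : Opens X, W ≤ U → A.Γ W → Prop)
    (hres : ∀ (W W' : Opens X) (hW : W ≤ U) (h : W' ≤ W) (s : A.Γ W), P W hW s →
      P W' (h.trans hW) (A.res h s))
    (huniq : ∀ (W : Opens X) (hW : W ≤ U) (s t : A.Γ W), P W hW s → P W hW t → s = t)
    (hex : ∀ x ∈ U, ∃ (W : Opens X) (_ : x ∈ W) (hW : W ≤ U) (s : A.Γ W), P W hW s) :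
    ∃ t : A.Γ U, (∀ (W : Opens X) (hW : W ≤ U) (s : A.Γ W), P W hW s → A.res hW t = s) ∧
      ∀ x ∈ U, ∃ (W : Opens X) (_ : x ∈ W) (hW : W ≤ U), P W hW (A.res hW t) := by
  choose W hx hW s hs using fun x : U => hex x.1 x.2
  have hU : U = iSup W := le_antisymm
    (fun x hx' => Opens.mem_iSup.2 ⟨⟨x, hx'⟩, hx ⟨x, hx'⟩⟩) (iSup_le hW)
  obtain ⟨r, hr, -⟩ := A.glue W s (fun i j =>
    huniq _ (inf_le_left.trans (hW i)) _ _ (hres _ _ _ _ _ (hs i)) (hres _ _ _ _ _ (hs j)))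
  have hr' : ∀ i, A.res (hW i) (A.res hU.le r) = s i := fun i => by rw [A.res_res]; exact hr i
  refine ⟨A.res hU.le r, fun W' hW' s' hs' => A.eq_of_local fun x hx' => ?_, fun x hx' =>
    ⟨W ⟨x, hx'⟩, hx _, hW _, by rw [hr']; exact hs _⟩⟩
  refine ⟨W' ⊓ W ⟨x, hW' hx'⟩, ⟨hx', hx _⟩, inf_le_left, ?_⟩
  rw [A.res_res, ← A.res_res (hW ⟨x, hW' hx'⟩) inf_le_right, hr']
  exact huniq _ (inf_le_left.trans hW') _ _ (hres _ _ _ _ _ (hs _)) (hres _ _ _ _ _ hs')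

end HolModule

variable (E X) in
/-- The structure sheaf `𝒪_X`. -/
noncomputable def holSheaf : HolModule E X where
  Γ U := Hol E U
  res h := (holRes E h).toAddMonoidHom
  res_smul h f g := map_mul (holRes E h) f g
  res_self _ := rfl
  res_res _ _ _ := rfl
  glue U s hs := by
    choose c hc using fun x : (iSup U : Opens X) => Opens.mem_iSup.1 x.2
    have hval : ∀ i j (x : X) (hi : x ∈ U i) (hj : x ∈ U j), s i ⟨x, hi⟩ = s j ⟨x, hj⟩ :=
      fun i j x hi hj => congrArg (fun k : Hol E (U i ⊓ U j) => k ⟨x, ⟨hi, hj⟩⟩) (hs i j)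
    refine ⟨⟨fun x => s (c x) ⟨x.1, hc x⟩, contMDiff_of_local _ fun x =>
      ⟨U (c x), hc x, le_iSup U _, s (c x), fun y => hval _ _ _ _ _⟩⟩,
      fun i => Hol.ext E fun x => hval _ _ _ _ _, fun t ht => Hol.ext E fun x => ?_⟩
    exact congrArg (fun k : Hol E (U (c x)) => k ⟨x.1, hc x⟩) (ht (c x))

theorem Hol.eq_of_local {U : Opens X} {s t : Hol E U}
    (h : ∀ x ∈ U, ∃ (W : Opens X) (_ : x ∈ W) (hW : W ≤ U), holRes E hW s = holRes E hW t) :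
    s = t := (holSheaf E X).eq_of_local h

theorem VField.eq_of_local {U : Opens X} {Y Z : VField E U}
    (h : ∀ x ∈ U, ∃ (W : Opens X) (_ : x ∈ W) (hW : W ≤ U), Y.res hW = Z.res hW) : Y = Z := by
  ext1 W hW f
  refine Hol.eq_of_local fun x hx => ?_
  obtain ⟨W', hx', hW', he⟩ := h x (hW hx)
  refine ⟨W' ⊓ W, ⟨hx', hx⟩, inf_le_right, ?_⟩
  rw [Y.res_der, Z.res_der]
  exact congrArg (fun Y : VField E W' => Y.der (inf_le_left : W' ⊓ W ≤ W')
    (holRes E inf_le_right f)) he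

variable (E X) in
/-- The tangent sheaf `T_X`. -/
noncomputable def tangentSheaf : HolModule E X where
  Γ U := VField E U
  res h := VField.res h
  res_smul h f Y := VField.res_smul h f Y
  res_self _ := rfl
  res_res _ _ _ := rfl
  glue {ι} U Y hY := by
    have hex : ∀ (W : {W : Opens X // W ≤ iSup U}) (f : Hol E W.1), ∃ g : Hol E W.1,
        ∀ (i : ι) (W' : Opens X) (hi : W' ≤ U i) (h : W' ≤ W.1),
          holRes E h g = (Y i).der hi (holRes E h f) := by
      intro W f
      obtain ⟨g, hg, -⟩ := (holSheaf E X).exists_of_local (U := W.1)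
        (fun W' h g => ∃ (i : ι) (hi : W' ≤ U i), g = (Y i).der hi (holRes E h f))
        (by
          rintro W' W'' h h' _ ⟨i, hi, rfl⟩
          exact ⟨i, h'.trans hi, (Y i).res_der hi h' _⟩)
        (by
          rintro W' h _ _ ⟨i, hi, rfl⟩ ⟨j, hj, rfl⟩
          exact congrArg (fun Y : VField E (U i ⊓ U j) => Y.der (le_inf hi hj) (holRes E h f))
            (hY i j))
        (by
          intro x hx
          obtain ⟨i, hi⟩ := Opens.mem_iSup.1 (W.2 hx)
          exact ⟨W.1 ⊓ U i, ⟨hx, hi⟩, inf_le_left, _, i, inf_le_right, rfl⟩)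
      exact ⟨g, fun i W' hi h => hg W' h _ ⟨i, hi, rfl⟩⟩
    choose g hg using hex
    have hu : ∀ (W : {W : Opens X // W ≤ iSup U}) (a b : Hol E W.1),
        (∀ (i : ι) (W' : Opens X) (_ : W' ≤ U i) (h : W' ≤ W.1), holRes E h a = holRes E h b) →
          a = b := by
      refine fun W a b h => Hol.eq_of_local fun x hx => ?_
      obtain ⟨i, hi⟩ := Opens.mem_iSup.1 (W.2 hx)
      exact ⟨W.1 ⊓ U i, ⟨hx, hi⟩, inf_le_left, h i _ inf_le_right _⟩
    let D : ∀ W : {W : Opens X // W ≤ iSup U}, Derivation ℂ (Hol E W.1) (Hol E W.1) := fun W =>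
      Derivation.mk'
        { toFun := g W
          map_add' := fun a b => hu W _ _ fun i W' hi h => by
            rw [map_add, hg W _ i W' hi, hg W _ i W' hi, hg W _ i W' hi, map_add, map_add]
          map_smul' := fun a b => hu W _ _ fun i W' hi h => by
            have e : ∀ k : Hol E W.1, holRes E h (a • k) = a • holRes E h k := fun _ => rfl
            rw [RingHom.id_apply, e, hg W _ i W' hi, hg W _ i W' hi, e, Derivation.map_smul] }
        (fun a b => hu W _ _ fun i W' hi h => by
          change holRes E h (g W (a * b)) = holRes E h (a * g W b + b * g W a)
          rw [map_add, map_mul, map_mul, hg W _ i W' hi, hg W _ i W' hi, hg W _ i W' hi, map_mul,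
            Derivation.leibniz, smul_eq_mul, smul_eq_mul])
    have hD : ∀ (W W' : Opens X) (hW : W ≤ iSup U) (h : W' ≤ W) (f : Hol E W),
        holRes E h (D ⟨W, hW⟩ f) = D ⟨W', h.trans hW⟩ (holRes E h f) := fun W W' hW h f =>
      hu ⟨W', h.trans hW⟩ _ _ fun i W'' hi h' => by
        change holRes E h' (holRes E h (g ⟨W, hW⟩ f)) =
          holRes E h' (g ⟨W', h.trans hW⟩ (holRes E h f))
        rw [hg ⟨W', h.trans hW⟩ _ i W'' hi]
        exact hg ⟨W, hW⟩ f i W'' hi (h'.trans h)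
    refine ⟨⟨D, hD⟩, fun i => ?_, fun Z hZ => ?_⟩
    · ext1 W hW f
      exact hg ⟨W, hW.trans (le_iSup U i)⟩ f i W hW le_rfl
    · refine VField.eq_of_local fun x hx => ?_
      obtain ⟨i, hi⟩ := Opens.mem_iSup.1 hx
      refine ⟨U i, hi, le_iSup U i, (hZ i).trans ?_⟩
      ext1 W hW f
      exact (hg ⟨W, hW.trans (le_iSup U i)⟩ f i W hW le_rfl).symm

end Gluing

/-! ### Lie algebroids with torsion-free stalks -/

section Algebroid

variable {E : Type v} [NormedAddCommGroup E] [NormedSpace ℂ E]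
  {X : Type u} [TopologicalSpace X] [ChartedSpace E X]

namespace LieAlgebroid

variable (L : LieAlgebroid E X)

theorem bracket_smul_right {V : Opens X} (f : Hol E V) (s t : L.Γ V) :
    L.bracket s (f • t) = f • L.bracket s t + (L.anchor s).der le_rfl f • t := by
  rw [L.skew (f • t) s, L.leibniz, L.skew s t]
  simp [sub_eq_add_neg, add_comm]

/-- The Jacobi identity: `{s, ·}` is a derivation. -/
theorem bracket_bracket {V : Opens X} (s t r : L.Γ V) :
    L.bracket s (L.bracket t r) =
      L.bracket (L.bracket s t) r + L.bracket t (L.bracket s r) := by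
  have := L.jacobi s t r
  rw [L.skew s r, L.skew (L.bracket s t) r] at this
  simp only [map_neg] at this
  rw [← sub_eq_zero, ← this]
  abel

/-- The failure of the anchor to preserve brackets annihilates all sections: compare the Jacobi
identity for `s, t, f r` with the one for `s, t, r`. -/
theorem defect_smul_eq_zero {V : Opens X} (s t : L.Γ V) (f : Hol E V) (r : L.Γ V) :
    (⁅L.anchor s, L.anchor t⁆ - L.anchor (L.bracket s t)).der le_rfl f • r = 0 := by
  have h := L.bracket_bracket s t (f • r)
  simp only [L.bracket_smul_right, map_add] at h
  rw [L.bracket_bracket s t r] at h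
  rw [sub_eq_add_neg, VField.add_der, VField.neg_der, VField.lie_der, add_smul, sub_smul, neg_smul]
  rw [smul_add, ← sub_eq_zero] at h
  rw [← h]
  abel

end LieAlgebroid

variable [IsManifold 𝓘(ℂ, E) ω X]

/-- A function which kills all sections of a sheaf with torsion-free stalks vanishes near each
point where the sheaf is not zero. -/
theorem HolModule.eq_zero_of_smul {A : HolModule E X} (hA : A.IsReflexive) {W : Opens X}
    (f : Hol E W) (hf : ∀ (W' : Opens X) (h : W' ≤ W) (t : A.Γ W'), holRes E h f • t = 0) {x : X}
    (hx : x ∈ W) :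
    (∃ (W' : Opens X) (_ : x ∈ W') (h : W' ≤ W), holRes E h f = 0) ∨
      ∀ (V : Opens X) (_ : x ∈ V) (s : A.Γ V), ∃ (W' : Opens X) (_ : x ∈ W') (h : W' ≤ V),
        A.res h s = 0 := by
  by_cases hsub : Subsingleton (A.Stalk x)
  · right
    intro V hV s
    have h0 : (⟦⟨⟨V, hV⟩, s⟩⟧ : A.Stalk x) = 0 := Subsingleton.elim _ _
    rw [DirectLimit.exists_eq_zero] at h0
    obtain ⟨W', hW', h0⟩ := h0
    exact ⟨W'.1, W'.2, hW', h0⟩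
  · left
    rw [not_subsingleton_iff_nontrivial] at hsub
    obtain ⟨m, hm⟩ := exists_ne (0 : A.Stalk x)
    obtain ⟨W₀, t, rfl⟩ := DirectLimit.exists_eq_mk _ m
    let W₁ : Nhd x := ⟨W₀.1 ⊓ W, W₀.2, hx⟩
    have hW₁ : W₀ ≤ W₁ := (inf_le_left : W₀.1 ⊓ W ≤ W₀.1)
    rw [A.mk_res W₀ W₁ hW₁] at hm
    have h2 : (⟦⟨W₁, holRes E (inf_le_right : W₁.1 ≤ W) f⟩⟧ : HolStalk E x) •
        (⟦⟨W₁, A.res hW₁ t⟩⟧ : A.Stalk x) = 0 := by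
      rw [HolModule.smul_def, hf, ← DirectLimit.zero_def]
    have := hA.2 x
    have h3 := (smul_eq_zero.1 h2).resolve_right hm
    rw [DirectLimit.exists_eq_zero] at h3
    obtain ⟨W', hW', h0⟩ := h3
    have hle : W'.1 ≤ W₁.1 := hW'
    exact ⟨W'.1, W'.2, hle.trans inf_le_right, h0⟩

/-- The anchor of a Lie algebroid preserves brackets. -/
theorem LieAlgebroid.anchor_bracket (L : LieAlgebroid E X) (hL : L.IsReflexive) {V : Opens X}
    (s t : L.Γ V) : L.anchor (L.bracket s t) = ⁅L.anchor s, L.anchor t⁆ := by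
  symm
  rw [← sub_eq_zero]
  ext1 W hW f
  refine Hol.eq_of_local fun x hx => ?_
  rcases L.eq_zero_of_smul hL
    ((⁅L.anchor s, L.anchor t⁆ - L.anchor (L.bracket s t)).der hW f) (fun W' h r => by
      rw [VField.res_der]
      have := L.defect_smul_eq_zero (L.res (h.trans hW) s) (L.res (h.trans hW) t)
        (holRes E h f) r
      rwa [← L.bracket_res, L.anchor_res, L.anchor_res, L.anchor_res, ← VField.res_lie,
        ← map_sub] at this) hx with h | h
  · obtain ⟨W', hx', h, h0⟩ := h
    exact ⟨W', hx', h, h0.trans (map_zero _).symm⟩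
  · obtain ⟨W', hx', h, h0⟩ := h V (hW hx) s
    refine ⟨W' ⊓ W, ⟨hx', hx⟩, inf_le_right, ?_⟩
    rw [VField.res_der, VField.zero_der, map_zero]
    have h2 : VField.res h (⁅L.anchor s, L.anchor t⁆ - L.anchor (L.bracket s t)) = 0 := by
      rw [map_sub, VField.res_lie, ← L.anchor_res, ← L.anchor_res, ← L.anchor_res,
        L.bracket_res, h0, map_zero,
        map_zero, AddMonoidHom.zero_apply, map_zero, sub_zero]
      ext1 W'' hW'' f
      simp
    exact congrArg (fun Y : VField E W' => Y.der inf_le_left (holRes E inf_le_right f)) h2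

end Algebroid

/-! ### Vertical and projectable vector fields -/

section Projectable

variable {E : Type v} [NormedAddCommGroup E] [NormedSpace ℂ E]
  {F : Type w} [NormedAddCommGroup F] [NormedSpace ℂ F]
  {X : Type u} [TopologicalSpace X] [ChartedSpace E X]
  {S : Type u} [TopologicalSpace S] [ChartedSpace F S]
  {π : C^ω⟮𝓘(ℂ, E), X; 𝓘(ℂ, F), S⟯}

theorem Related.projectable {W : Opens X} {U : Opens S} (hWU : W ≤ pre π U) {Y : VField E W}
    {v : VField F U} (h : Related π Y v) : IsProjectable π Y :=
  fun _ hx => ⟨W, le_rfl, U, v, hx, hWU, h⟩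

theorem Related.sub {W : Opens X} {U : Opens S} {Y Z : VField E W} {v v' : VField F U}
    (h : Related π Y v) (h' : Related π Z v') : Related π (Y - Z) (v - v') := by
  rw [sub_eq_add_neg, sub_eq_add_neg]
  exact h.add h'.neg

theorem Related.zero {W : Opens X} {U : Opens S} :
    Related π (0 : VField E W) (0 : VField F U) := fun _ _ _ _ _ _ => (map_zero _).symm

theorem Related.sum {ι : Type*} (s : Finset ι) {W : Opens X} {U : Opens S} {Y : ι → VField E W}
    {v : ι → VField F U} (h : ∀ i ∈ s, Related π (Y i) (v i)) :
    Related π (∑ i ∈ s, Y i) (∑ i ∈ s, v i) := by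
  classical
  induction s using Finset.induction_on with
  | empty => exact Related.zero
  | insert i s hi ih =>
    rw [Finset.sum_insert hi, Finset.sum_insert hi]
    exact (h i (Finset.mem_insert_self i s)).add
      (ih fun j hj => h j (Finset.mem_insert_of_mem hj))

theorem Related.of_res {W : Opens X} {U U' : Opens S} (hU : U' ≤ U) (hW : W ≤ pre π U')
    {Y : VField E W} {v : VField F U} (h : Related π Y (v.res hU)) : Related π Y v := by
  intro U'' hU'' W'' hW'' h'' g
  have := h (U'' ⊓ U') inf_le_right W'' hW'' (fun x hx => ⟨h'' hx, hW (hW'' hx)⟩)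
    (holRes F inf_le_left g)
  rw [VField.der_res, ← v.res_der hU''] at this
  exact this

theorem Related.isVertical {W : Opens X} {U : Opens S} (hW : W ≤ pre π U) {Y : VField E W}
    (h : Related π Y (0 : VField F U)) : IsVertical π Y := by
  intro U'' W'' hW'' h'' g
  have := h (U'' ⊓ U) inf_le_right W'' hW'' (fun x hx => ⟨h'' hx, hW (hW'' hx)⟩)
    (holRes F inf_le_left g)
  rw [VField.zero_der, map_zero] at this
  exact this

theorem IsVertical.of_local {W : Opens X} {Y : VField E W}
    (h : ∀ x ∈ W, ∃ (W' : Opens X) (_ : x ∈ W') (hW : W' ≤ W), IsVertical π (Y.res hW)) :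
    IsVertical π Y := by
  intro U' W' hW' h' g
  refine Hol.eq_of_local fun x hx => ?_
  obtain ⟨W'', hx', hW'', hv⟩ := h x (hW' hx)
  refine ⟨W'' ⊓ W', ⟨hx', hx⟩, inf_le_right, ?_⟩
  rw [Y.res_der, map_zero]
  exact hv U' (W'' ⊓ W') inf_le_left (inf_le_right.trans h') g

theorem IsVertical.lie {W : Opens X} {Y Z : VField E W} (hY : IsProjectable π Y)
    (hZ : IsVertical π Z) : IsVertical π ⁅Y, Z⁆ := by
  refine IsVertical.of_local fun x hx => ?_
  obtain ⟨W', hW', U, v, hx', hWU, hr⟩ := hY x hx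
  refine ⟨W', hx', hW', Related.isVertical hWU ?_⟩
  have h1 := hr.lie ((hZ.related U).res hW' le_rfl)
  rw [VField.res_lie]
  convert h1 using 1
  ext1 W'' hW'' f
  simp

end Projectable

/-! ### The flat connection of a transversal unfolding -/

section Acts

variable {E : Type v} [NormedAddCommGroup E] [NormedSpace ℂ E]
  {F : Type w} [NormedAddCommGroup F] [NormedSpace ℂ F]
  {X : Type u} [TopologicalSpace X] [ChartedSpace E X]
  {S : Type u} [TopologicalSpace S] [ChartedSpace F S]
  {π : C^ω⟮𝓘(ℂ, E), X; 𝓘(ℂ, F), S⟯} {A : Family π}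

namespace Unfolding

variable {L : Unfolding A}

/-- In a transversal unfolding the sections with vertical anchor are the sections of `𝒜_S`. -/
theorem exists_incl_of_vertical (hL : L.IsTransversal) {V : Opens X} {u : L.L.Γ V}
    (hu : IsVertical π (L.L.anchor u)) : ∃ s : A.Γ V, L.incl s = u :=
  L.preimage u fun x hx => by
    obtain ⟨W, hxW, h, t, ht⟩ := hL.1 V _ hu ⟨u, rfl⟩ x hx
    exact ⟨W, hxW, h, t, ht.symm⟩

variable (L) in
/-- The operator `p` on `𝒜_S` is `{u, ·}`, with symbol the anchor of `u`. -/
structure Acts {V : Opens X} (u : L.L.Γ V) (p : LieOp A V) : Prop where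
  symbol : p.symbol = L.L.anchor u
  op : ∀ (W : Opens X) (h : W ≤ V) (s : A.Γ W),
    L.incl (p.op h s) = L.L.bracket (L.L.res h u) (L.incl s)

namespace Acts

variable {V : Opens X} {u u' : L.L.Γ V} {p p' : LieOp A V}

theorem unique (h : L.Acts u p) (h' : L.Acts u p') : p = p' :=
  LieOp.ext (fun W hW s => L.incl_injective ((h.op W hW s).trans (h'.op W hW s).symm))
    (h.symbol.trans h'.symbol.symm)

theorem add (h : L.Acts u p) (h' : L.Acts u' p') : L.Acts (u + u') (p + p') where
  symbol := by rw [LieOp.add_symbol, h.symbol, h'.symbol, map_add]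
  op W hW s := by
    rw [LieOp.add_op, map_add, h.op, h'.op, map_add, map_add, AddMonoidHom.add_apply]

theorem neg (h : L.Acts u p) : L.Acts (-u) (-p) where
  symbol := by rw [LieOp.neg_symbol, h.symbol, map_neg]
  op W hW s := by
    rw [LieOp.neg_op, map_neg, h.op, map_neg, map_neg, AddMonoidHom.neg_apply]

theorem sub (h : L.Acts u p) (h' : L.Acts u' p') : L.Acts (u - u') (p - p') := by
  rw [sub_eq_add_neg, sub_eq_add_neg]
  exact h.add h'.neg

theorem res (h : L.Acts u p) {V' : Opens X} (hV : V' ≤ V) :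
    L.Acts (L.L.res hV u) (LieOp.res hV p) where
  symbol := by rw [LieOp.res_symbol, h.symbol, L.L.anchor_res]
  op W hW s := by rw [LieOp.res_op_apply, h.op, L.L.res_res]

theorem incl (s : A.Γ V) : L.Acts (L.incl s) (ad A s) where
  symbol := by rw [ad_symbol, L.anchor_incl]
  op W hW t := by rw [ad_op, L.incl_bracket, L.incl_res]

theorem baseSmul (h : L.Acts u p) {U : Opens S} (hV : V ≤ pre π U) (g : Hol F U) :
    L.Acts (pull π hV g • u) (LieOp.baseSmul hV g p) where
  symbol := by rw [LieOp.baseSmul_symbol, h.symbol, map_smul]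
  op W hW s := by
    rw [LieOp.baseSmul_op, map_smul, h.op, L.L.res_smul, L.L.leibniz, res_pull, L.anchor_incl,
      A.vertical s _ _ le_rfl _ g, zero_smul, sub_zero]

variable [IsManifold 𝓘(ℂ, E) ω X]

theorem comm (h : L.Acts u p) (h' : L.Acts u' p') :
    L.Acts (L.L.bracket u u') (LieOp.comm p p') where
  symbol := by
    rw [LieOp.comm_symbol, h.symbol, h'.symbol, L.L.anchor_bracket L.reflexive]
  op W hW s := by
    rw [LieOp.comm_op, map_sub, h.op, h'.op, h'.op, h.op, L.L.bracket_res,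
      L.L.bracket_bracket (L.L.res hW u), add_sub_cancel_right]

/-- A section with projectable anchor normalizes `𝒜_S`. -/
theorem exists_of_projectable (hL : L.IsTransversal) {V : Opens X} (u : L.L.Γ V)
    (hu : IsProjectable π (L.L.anchor u)) : ∃ p : LieOp A V, L.Acts u p := by
  have hex : ∀ (W : {W : Opens X // W ≤ V}) (s : A.Γ W.1), ∃ t : A.Γ W.1,
      L.incl t = L.L.bracket (L.L.res W.2 u) (L.incl s) := fun W s => by
    refine exists_incl_of_vertical hL ?_
    rw [L.L.anchor_bracket L.reflexive, L.anchor_incl, L.L.anchor_res]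
    exact IsVertical.lie (hu.res W.2) (A.vertical s)
  choose φ hφ using hex
  let ψ : ∀ W : {W : Opens X // W ≤ V}, A.Γ W.1 →+ A.Γ W.1 := fun W =>
    AddMonoidHom.mk' (φ W) fun s t => L.incl_injective <| by
      rw [hφ, map_add, map_add, map_add, hφ, hφ]
  have hψ : ∀ (W : Opens X) (hW : W ≤ V) (s : A.Γ W),
      L.incl (ψ ⟨W, hW⟩ s) = L.L.bracket (L.L.res hW u) (L.incl s) := fun W hW s => hφ ⟨W, hW⟩ s
  refine ⟨⟨⟨ψ, L.L.anchor u⟩, fun W W' hW h s => ?_, fun W hW f s => ?_, fun W hW s t => ?_, hu⟩,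
    rfl, hψ⟩
  · apply L.incl_injective
    rw [L.incl_res, hψ, hψ, L.L.bracket_res, L.L.res_res, L.incl_res]
  · apply L.incl_injective
    change L.incl (ψ ⟨W, hW⟩ (f • s) - f • ψ ⟨W, hW⟩ s) = _
    rw [map_sub, hψ, LinearMap.map_smul, LinearMap.map_smul, hψ, LinearMap.map_smul,
      L.L.bracket_smul_right, add_sub_cancel_left, L.L.anchor_res]
    rfl
  · apply L.incl_injective
    rw [map_add, L.incl_bracket, L.incl_bracket, hψ, hψ, hψ, L.incl_bracket, L.L.bracket_bracket]

/-- The class in `𝔲(𝒜_S)` of the action of a section depends only on the vector field on `S` to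
which it projects, because two sections projecting to the same vector field differ by a section
of `𝒜_S`. -/
theorem uGerm_eq (hL : L.IsTransversal) {V V' : Opens X} {u : L.L.Γ V} {u' : L.L.Γ V'}
    {p : LieOp A V} {p' : LieOp A V'} (h : L.Acts u p) (h' : L.Acts u' p') {U : Opens S}
    {v : VField F U} (hV : V ≤ pre π U) (hv : Related π (L.L.anchor u) v)
    (hv' : Related π (L.L.anchor u') v)
    {x : X} (hx : x ∈ V) (hx' : x ∈ V') : uGerm hx p = uGerm hx' p' := by
  have h1 := (h.res (inf_le_left : V ⊓ V' ≤ V)).sub (h'.res (inf_le_right : V ⊓ V' ≤ V'))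
  obtain ⟨s, hs⟩ := exists_incl_of_vertical hL
    (u := L.L.res (inf_le_left : V ⊓ V' ≤ V) u - L.L.res (inf_le_right : V ⊓ V' ≤ V') u') (by
      refine Related.isVertical (inf_le_left.trans hV) ?_
      rw [map_sub, L.L.anchor_res, L.L.anchor_res, ← sub_self v]
      exact Related.sub (hv.res inf_le_left le_rfl) (hv'.res inf_le_right le_rfl))
  rw [← hs] at h1
  refine uGerm_eq_iff.2 ⟨V ⊓ V', ⟨hx, hx'⟩, inf_le_left, inf_le_right, s, ?_⟩
  rw [← h1.unique (Acts.incl s), add_sub_cancel]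

end Acts

end Unfolding

end Acts

section Connection

variable {E : Type v} [NormedAddCommGroup E] [NormedSpace ℂ E]
  {F : Type w} [NormedAddCommGroup F] [NormedSpace ℂ F]
  {X : Type u} [TopologicalSpace X] [ChartedSpace E X]
  {S : Type u} [TopologicalSpace S] [ChartedSpace F S]
  {π : C^ω⟮𝓘(ℂ, E), X; 𝓘(ℂ, F), S⟯} {A : Family π}
  (hπ : Manifold.IsSubmersion 𝓘(ℂ, E) 𝓘(ℂ, F) ω π) (hfib : ∀ s, IsConnected (π ⁻¹' {s}))

section Lift

variable [FiniteDimensional ℂ F]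

include hπ in
/-- Vector fields on `S` lift to `X` locally. -/
theorem exists_related {U : Opens S} (v : VField F U) {x : X} (hx : x ∈ pre π U) :
    ∃ (W : Opens X) (_ : x ∈ W) (_ : W ≤ pre π U) (Y : VField E W), Related π Y v := by
  obtain ⟨U₀, W, hxW, hW, C, Ξ, hΞ⟩ := exists_coords_lift hπ x
  let U₁ : Opens S := U ⊓ U₀
  let W₁ : Opens X := W ⊓ pre π U
  have hW₁ : W₁ ≤ pre π U₁ := fun y hy => ⟨hy.2, hW hy.1⟩
  refine ⟨W₁, ⟨hxW, hx⟩, inf_le_right, ∑ i, pull π hW₁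
    ((v.res inf_le_left).der le_rfl (holRes F (inf_le_right : U₁ ≤ U₀) (C.t i))) •
      (Ξ i).res inf_le_left, ?_⟩
  refine Related.of_res (inf_le_left : U₁ ≤ U) hW₁ ?_
  rw [C.expand (inf_le_right : U₁ ≤ U₀) (v.res inf_le_left)]
  refine Related.sum _ fun i _ => ?_
  have h := ((hΞ i).res (inf_le_left : W₁ ≤ W) (inf_le_right : U₁ ≤ U₀)).smul le_rfl hW₁
    ((v.res (inf_le_left : U₁ ≤ U)).der le_rfl (holRes F (inf_le_right : U₁ ≤ U₀) (C.t i)))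
  rw [← C.expand (inf_le_right : U₁ ≤ U₀) (v.res inf_le_left)]
  exact h

include hπ in
/-- By transversality, vector fields on `S` lift locally to sections of the unfolding. -/
theorem Unfolding.exists_lift {L : Unfolding A} (hL : L.IsTransversal) {U : Opens S}
    (v : VField F U) {x : X} (hx : x ∈ pre π U) :
    ∃ (W : Opens X) (_ : x ∈ W) (_ : W ≤ pre π U) (u : L.L.Γ W), Related π (L.L.anchor u) v := by
  obtain ⟨W, hxW, hW, Y, hY⟩ := exists_related hπ v hx
  obtain ⟨W', hx', hW', Z, s, hZ, he⟩ := hL.2 W Y x hxW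
  refine ⟨W', hx', hW'.trans hW, s, ?_⟩
  have h := (hY.res hW' le_rfl).sub (hZ.related U)
  rw [he, add_sub_cancel_left, sub_zero] at h
  exact h

variable [IsManifold 𝓘(ℂ, E) ω X]

include hπ in
theorem Unfolding.exists_acts {L : Unfolding A} (hL : L.IsTransversal) {U : Opens S}
    (v : VField F U) {x : X} (hx : x ∈ pre π U) :
    ∃ (W : Opens X) (_ : x ∈ W) (_ : W ≤ pre π U) (u : L.L.Γ W) (p : LieOp A W),
      Related π (L.L.anchor u) v ∧ L.Acts u p := by
  obtain ⟨W, hxW, hW, u, hu⟩ := L.exists_lift hπ hL v hx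
  obtain ⟨p, hp⟩ := Unfolding.Acts.exists_of_projectable hL u (hu.projectable hW)
  exact ⟨W, hxW, hW, u, p, hu, hp⟩

/-- The section `t` of `𝔲(𝒜_S)` over `π⁻¹(U)` consists of the classes of the operators `{u, ·}`,
where `u` is a local section of the unfolding which projects to `v`. -/
def Unfolding.IsConn (L : Unfolding A) {U : Opens S} (v : VField F U) (t : USec A (pre π U)) :
    Prop :=
  ∀ (W : Opens X) (h : W ≤ pre π U) (u : L.L.Γ W) (p : LieOp A W),
    Related π (L.L.anchor u) v → L.Acts u p → t.Rep h p

include hπ in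
/-- The classes of the actions of local lifts of `v` agree, so they define a section. -/
theorem Unfolding.exists_isConn {L : Unfolding A} (hL : L.IsTransversal) {U : Opens S}
    (v : VField F U) : ∃ t : USec A (pre π U), L.IsConn v t := by
  choose W hx hW u p hu hp using fun x : pre π U => L.exists_acts hπ hL v x.2
  refine ⟨⟨fun x => uGerm (hx x) (p x), fun x => ⟨W x, hx x, hW x, p x, fun y hy => ?_⟩⟩,
    fun W' h u' p' hu' hp' y hy => ?_⟩
  · exact (hp _).uGerm_eq hL (hp x) (hW _) (hu _) (hu x) _ hy
  · exact (hp ⟨y, h hy⟩).uGerm_eq hL hp' (hW _) (hu _) hu' _ hy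

theorem Unfolding.IsConn.unique {L : Unfolding A} {U : Opens S}
    {v : VField F U} {t t' : USec A (pre π U)} (h : L.IsConn v t)
    (h' : ∀ x ∈ pre π U, ∃ (W : Opens X) (_ : x ∈ W) (hW : W ≤ pre π U) (u : L.L.Γ W)
      (p : LieOp A W), Related π (L.L.anchor u) v ∧ L.Acts u p ∧ t'.Rep hW p) : t' = t :=
  USec.ext fun x hx => by
    obtain ⟨W, hxW, hW, u, p, hu, hp, hr⟩ := h' x hx
    exact (hr x hxW).trans (h W hW u p hu hp x hxW).symm

/-- The flat connection of a transversal unfolding. -/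
noncomputable def Unfolding.connection (L : Unfolding A) (hL : L.IsTransversal) :
    FlatConnection (pushforward A hπ hfib) where
  map {U} :=
    { toFun := fun v => (L.exists_isConn hπ hL v).choose
      map_add' := fun v v' => by
        symm
        refine Unfolding.IsConn.unique (L.exists_isConn hπ hL (v + v')).choose_spec
          fun x hx => ?_
        obtain ⟨W, hxW, hW, u, p, hu, hp⟩ := L.exists_acts hπ hL v hx
        obtain ⟨W', hxW', hW', u', p', hu', hp'⟩ := L.exists_acts hπ hL v' hx
        refine ⟨W ⊓ W', ⟨hxW, hxW'⟩, inf_le_left.trans hW,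
          L.L.res inf_le_left u + L.L.res inf_le_right u',
          LieOp.res inf_le_left p + LieOp.res inf_le_right p', ?_, (hp.res _).add (hp'.res _),
          USec.Rep.add (((L.exists_isConn hπ hL v).choose_spec W hW u p hu hp).res _)
            (((L.exists_isConn hπ hL v').choose_spec W' hW' u' p' hu' hp').res _)⟩
        rw [map_add, L.L.anchor_res, L.L.anchor_res]
        exact (hu.res inf_le_left le_rfl).add (hu'.res inf_le_right le_rfl)
      map_smul' := fun g v => by
        symm
        refine Unfolding.IsConn.unique (L.exists_isConn hπ hL (g • v)).choose_spec
          fun x hx => ?_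
        obtain ⟨W, hxW, hW, u, p, hu, hp⟩ := L.exists_acts hπ hL v hx
        refine ⟨W, hxW, hW, pull π hW g • u, LieOp.baseSmul hW g p, ?_, hp.baseSmul hW g,
          ((L.exists_isConn hπ hL v).choose_spec W hW u p hu hp).smul g⟩
        rw [map_smul]
        exact hu.smul le_rfl hW g }
  map_res {U V} h v := by
    symm
    refine Unfolding.IsConn.unique (L.exists_isConn hπ hL (v.res h)).choose_spec
      fun x hx => ?_
    obtain ⟨W, hxW, hW, u, p, hu, hp⟩ := L.exists_acts hπ hL v (pre_mono π h hx)
    refine ⟨W ⊓ pre π V, ⟨hxW, hx⟩, inf_le_right, L.L.res inf_le_left u, LieOp.res inf_le_left p,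
      ?_, hp.res _, ((L.exists_isConn hπ hL v).choose_spec W hW u p hu hp).res inf_le_left⟩
    rw [L.L.anchor_res]
    exact hu.res _ h
  map_lie {U} v v' := by
    symm
    refine Unfolding.IsConn.unique (L.exists_isConn hπ hL ⁅v, v'⁆).choose_spec
      fun x hx => ?_
    obtain ⟨W, hxW, hW, u, p, hu, hp⟩ := L.exists_acts hπ hL v hx
    obtain ⟨W', hxW', hW', u', p', hu', hp'⟩ := L.exists_acts hπ hL v' hx
    refine ⟨W ⊓ W', ⟨hxW, hxW'⟩, inf_le_left.trans hW,
      L.L.bracket (L.L.res inf_le_left u) (L.L.res inf_le_right u'),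
      LieOp.comm (LieOp.res inf_le_left p) (LieOp.res inf_le_right p'), ?_,
      (hp.res _).comm (hp'.res _),
      USec.Rep.bracket (((L.exists_isConn hπ hL v).choose_spec W hW u p hu hp).res _)
        (((L.exists_isConn hπ hL v').choose_spec W' hW' u' p' hu' hp').res _)⟩
    rw [L.L.anchor_bracket L.reflexive, L.L.anchor_res, L.L.anchor_res]
    exact (hu.res inf_le_left le_rfl).lie (hu'.res inf_le_right le_rfl)
  anchor_map {U} v := by
    refine uAnchor_eq A hπ hfib _ _ fun x hx => ?_
    obtain ⟨W, hxW, hW, u, p, hu, hp⟩ := L.exists_acts hπ hL v hx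
    refine ⟨W, hxW, hW, p, (L.exists_isConn hπ hL v).choose_spec W hW u p hu hp, ?_⟩
    rw [hp.symbol]
    exact hu

theorem Unfolding.connection_isConn (L : Unfolding A) (hL : L.IsTransversal) {U : Opens S}
    (v : VField F U) : L.IsConn v ((L.connection hπ hfib hL).map v) :=
  (L.exists_isConn hπ hL v).choose_spec

theorem FlatConnection.ext' {P : LieAlgebroid F S} {N N' : FlatConnection P}
    (h : ∀ (U : Opens S) (v : VField F U), N.map v = N'.map v) : N = N' := by
  obtain ⟨f, _, _, _⟩ := N
  obtain ⟨g, _, _, _⟩ := N'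
  have : @f = @g := by
    funext U
    exact LinearMap.ext (h U)
  subst this
  rfl

theorem Unfolding.connection_eq_of_isConn (L : Unfolding A) (hL : L.IsTransversal)
    {N : FlatConnection (pushforward A hπ hfib)}
    (h : ∀ (U : Opens S) (v : VField F U), L.IsConn v (N.map v)) :
    L.connection hπ hfib hL = N :=
  FlatConnection.ext' fun U v => Unfolding.IsConn.unique (h U v) fun x hx => by
    obtain ⟨W, hxW, hW, u, p, hu, hp⟩ := L.exists_acts hπ hL v hx
    exact ⟨W, hxW, hW, u, p, hu, hp, L.connection_isConn hπ hfib hL v W hW u p hu hp⟩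

/-- Isomorphic unfoldings define the same connection. -/
theorem Unfolding.connection_congr {L M : Unfolding A} (hL : L.IsTransversal)
    (hM : M.IsTransversal) (e : Unfolding.Iso L M) :
    L.connection hπ hfib hL = M.connection hπ hfib hM := by
  refine L.connection_eq_of_isConn hπ hfib hL fun U v W h u p hu hp => ?_
  refine M.connection_isConn hπ hfib hM v W h (e.equiv u) p ?_ ⟨?_, fun W' h' s => ?_⟩
  · rw [e.anchor_equiv]; exact hu
  · rw [e.anchor_equiv]; exact hp.symbol
  · rw [← e.equiv_incl, hp.op, e.equiv_bracket, e.equiv_res, e.equiv_incl]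

end Lift

end Connection

/-! ### Operators along a flat connection -/

section Ops

variable {E : Type v} [NormedAddCommGroup E] [NormedSpace ℂ E]
  {F : Type w} [NormedAddCommGroup F] [NormedSpace ℂ F]
  {X : Type u} [TopologicalSpace X] [ChartedSpace E X] [IsManifold 𝓘(ℂ, E) ω X]
  {S : Type u} [TopologicalSpace S] [ChartedSpace F S]
  {π : C^ω⟮𝓘(ℂ, E), X; 𝓘(ℂ, F), S⟯} {A : Family π}
  {hπ : Manifold.IsSubmersion 𝓘(ℂ, E) 𝓘(ℂ, F) ω π} {hfib : ∀ s, IsConnected (π ⁻¹' {s})}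

/-- A pair of open sets `W ⊆ X` and `U ⊆ S` with `π(W) ⊆ U`. -/
structure Patch (π : C^ω⟮𝓘(ℂ, E), X; 𝓘(ℂ, F), S⟯) : Type u where
  W : Opens X
  U : Opens S
  le : W ≤ pre π U

instance : Preorder (Patch π) where
  le i j := i.W ≤ j.W ∧ i.U ≤ j.U
  le_refl _ := ⟨le_rfl, le_rfl⟩
  le_trans _ _ _ h h' := ⟨h.1.trans h'.1, h.2.trans h'.2⟩

variable (N : FlatConnection (pushforward A hπ hfib))

/-- The operators over `W` which represent `∇(v)` for a vector field `v` on `U`, together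
with `v`. -/
noncomputable def opsSubgroup (j : Patch π) : AddSubgroup (LieOp A j.W × VField F j.U) where
  carrier := {q | USec.Rep (V := pre π j.U) (N.map q.2) j.le q.1}
  zero_mem' := fun y hy => by
    change USec.germ (N.map (0 : VField F j.U)) _ = uGerm hy (0 : LieOp A j.W)
    rw [map_zero, uGerm_zero]
    rfl
  add_mem' := by
    intro q q' hq hq'
    change USec.Rep (N.map (q.2 + q'.2)) _ _
    rw [map_add]
    exact USec.Rep.add hq hq'
  neg_mem' := by
    intro q hq y hy
    change USec.germ (N.map (-q.2)) _ = uGerm hy (-q.1)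
    rw [map_neg, uGerm_neg]
    exact congrArg (- ·) (hq y hy)

/-- The group of pairs of a vector field `v` on `U` and an operator over `W` representing
`∇(v)`. -/
def Ops (j : Patch π) : Type u := opsSubgroup N j

noncomputable instance (j : Patch π) : AddCommGroup (Ops N j) :=
  inferInstanceAs (AddCommGroup (opsSubgroup N j))

namespace Ops

variable {N} {j : Patch π}

/-- The operator. -/
def op (q : Ops N j) : LieOp A j.W := q.1.1

/-- The vector field on `S`. -/
def vec (q : Ops N j) : VField F j.U := q.1.2

theorem rep (q : Ops N j) : USec.Rep (V := pre π j.U) (N.map q.vec) j.le q.op := q.2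

theorem ext {p q : Ops N j} (h : p.op = q.op) (h' : p.vec = q.vec) : p = q :=
  Subtype.ext (Prod.ext h h')

@[simp] theorem add_op (p q : Ops N j) : (p + q).op = p.op + q.op := rfl
@[simp] theorem add_vec (p q : Ops N j) : (p + q).vec = p.vec + q.vec := rfl
@[simp] theorem neg_vec (p : Ops N j) : (-p).vec = -p.vec := rfl
@[simp] theorem zero_op : (0 : Ops N j).op = 0 := rfl
@[simp] theorem zero_vec : (0 : Ops N j).vec = 0 := rfl
@[simp] theorem sub_vec (p q : Ops N j) : (p - q).vec = p.vec - q.vec := rfl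

theorem related (q : Ops N j) : Related π q.op.symbol q.vec := by
  have h := uAnchor_spec A hπ hfib (N.map q.vec) j.W j.le q.op q.rep
  have e : uAnchor A hπ hfib (N.map q.vec) = q.vec := N.anchor_map q.vec
  rwa [e] at h

theorem der_pull (q : Ops N j) (g : Hol F j.U) :
    q.op.symbol.der le_rfl (pull π j.le g) = pull π j.le (q.vec.der le_rfl g) :=
  q.related _ le_rfl _ le_rfl _ g

/-- Multiplication by a function on `S`. -/
noncomputable instance : SMul (Hol F j.U) (Ops N j) where
  smul g q := ⟨(LieOp.baseSmul j.le g q.op, g • q.vec), by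
    change USec.Rep (N.map (g • q.vec)) _ _
    rw [map_smul]
    exact USec.Rep.smul q.rep g⟩

@[simp] theorem smul_op (g : Hol F j.U) (q : Ops N j) :
    (g • q).op = LieOp.baseSmul j.le g q.op := rfl
@[simp] theorem smul_vec (g : Hol F j.U) (q : Ops N j) : (g • q).vec = g • q.vec := rfl

theorem one_smul' (q : Ops N j) : (1 : Hol F j.U) • q = q :=
  ext (LieOp.one_baseSmul _ _) (one_smul _ _)

/-- The commutator. -/
noncomputable def comm (p q : Ops N j) : Ops N j :=
  ⟨(LieOp.comm p.op q.op, ⁅p.vec, q.vec⁆), by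
    change USec.Rep (N.map ⁅p.vec, q.vec⁆) _ _
    rw [N.map_lie]
    exact USec.Rep.bracket p.rep q.rep⟩

@[simp] theorem comm_op (p q : Ops N j) : (comm p q).op = LieOp.comm p.op q.op := rfl
@[simp] theorem comm_vec (p q : Ops N j) : (comm p q).vec = ⁅p.vec, q.vec⁆ := rfl

theorem comm_skew (p q : Ops N j) : comm q p = -comm p q :=
  ext (LieOp.comm_skew _ _) (by ext1 W hW f; simp)

theorem comm_jacobi (p q r : Ops N j) :
    comm p (comm q r) + comm q (comm r p) + comm r (comm p q) = 0 :=
  ext (LieOp.comm_jacobi _ _ _) (by ext1 W hW f; simp; abel)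

/-- The commutator satisfies the Leibniz rule over functions on the base. -/
theorem comm_add_smul (p q r : Ops N j) (g : Hol F j.U) :
    comm p (q + g • r) = comm p q + g • comm p r + p.vec.der le_rfl g • r := by
  refine ext ?_ ?_
  · simp only [comm_op, add_op, smul_op, LieOp.comm_add]
    rw [LieOp.comm_baseSmul j.le g p.op r.op p.vec p.related, add_assoc]
  · ext1 W hW f
    simp only [comm_vec, add_vec, smul_vec, VField.lie_der, VField.add_der, VField.smul_der,
      map_add, Derivation.leibniz, smul_eq_mul, VField.res_der]
    ring

variable (N) in
/-- The operators `{s, ·}`, with the vector field `0`. -/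
noncomputable def inner (j : Patch π) : A.Γ j.W →+ Ops N j where
  toFun s := ⟨(ad A s, 0), fun y hy => by
    change USec.germ (N.map (0 : VField F j.U)) _ = uGerm hy (ad A s)
    rw [map_zero, uGerm_ad]
    rfl⟩
  map_zero' := ext (map_zero _) rfl
  map_add' s t := ext (map_add _ s t) (add_zero _).symm

@[simp] theorem inner_op (s : A.Γ j.W) : (inner N j s).op = ad A s := rfl
@[simp] theorem inner_vec (s : A.Γ j.W) : (inner N j s).vec = 0 := rfl

theorem comm_inner (p : Ops N j) (s : A.Γ j.W) :
    comm p (inner N j s) = inner N j (p.op.op le_rfl s) :=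
  ext (comm_ad A p.op s) (by ext1 W hW f; simp)

theorem smul_inner (g : Hol F j.U) (s : A.Γ j.W) :
    g • inner N j s = inner N j (pull π j.le g • s) :=
  ext (LieOp.baseSmul_ad _ _ _) (smul_zero _)

/-- Restriction to a smaller patch. -/
noncomputable def res {i j : Patch π} (h : i ≤ j) : Ops N j →+ Ops N i where
  toFun q := ⟨(LieOp.res h.1 q.op, q.vec.res h.2), by
    change USec.Rep (N.map (q.vec.res h.2)) _ _
    rw [N.map_res]
    exact fun y hy => q.rep.res h.1 y hy⟩
  map_zero' := ext (map_zero _) (map_zero _)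
  map_add' _ _ := ext (map_add _ _ _) (map_add _ _ _)

variable {i : Patch π} (h : i ≤ j)

theorem res_smul (g : Hol F j.U) (q : Ops N j) : res h (g • q) = holRes F h.2 g • res h q :=
  ext (LieOp.res_baseSmul j.le g q.op h.1) (VField.res_smul h.2 g q.vec)

theorem res_comm (p q : Ops N j) : res h (comm p q) = comm (res h p) (res h q) :=
  ext (LieOp.res_comm _ _ _) (VField.res_lie _ _ _)

theorem res_inner (s : A.Γ j.W) : res h (inner N j s) = inner N i (A.res h.1 s) :=
  ext (res_ad A h.1 s) (map_zero _)

end Ops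

/-! ### The prolongation of the family along a flat connection -/

/-- The relations which define the prolongation. -/
def prolRel (j : Patch π) : Set (Ops N j →₀ Hol E j.W) :=
  {x | ∃ (p q : Ops N j) (g : Hol F j.U), x = Finsupp.single (p + g • q) 1 -
    Finsupp.single p 1 - Finsupp.single q (pull π j.le g)} ∪
  {x | ∃ (f : Hol E j.W) (s : A.Γ j.W), x = Finsupp.single (Ops.inner N j (f • s)) 1 -
    Finsupp.single (Ops.inner N j s) f}

/-- The prolongation over a patch: the tensor product of `𝒪_X(W)` with the operators along the
connection, modulo the relations `1 ⊗ ad(f s) = f ⊗ ad(s)`. -/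
def Prol (j : Patch π) : Type u := (Ops N j →₀ Hol E j.W) ⧸ Submodule.span (Hol E j.W) (prolRel N j)

noncomputable instance (j : Patch π) : AddCommGroup (Prol N j) :=
  inferInstanceAs (AddCommGroup (_ ⧸ Submodule.span (Hol E j.W) (prolRel N j)))

noncomputable instance (j : Patch π) : Module (Hol E j.W) (Prol N j) :=
  inferInstanceAs (Module (Hol E j.W) (_ ⧸ Submodule.span (Hol E j.W) (prolRel N j)))

namespace Prol

variable {j : Patch π}

/-- The projection from the free module. -/
noncomputable def proj (j : Patch π) : (Ops N j →₀ Hol E j.W) →ₗ[Hol E j.W] Prol N j :=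
  Submodule.mkQ _

theorem proj_surjective : Function.Surjective (proj N j) := Submodule.mkQ_surjective _

theorem proj_eq_zero {x : Ops N j →₀ Hol E j.W} :
    proj N j x = 0 ↔ x ∈ Submodule.span (Hol E j.W) (prolRel N j) :=
  Submodule.Quotient.mk_eq_zero _

variable {N}

/-- The class of an operator. -/
noncomputable def of (p : Ops N j) : Prol N j := proj N j (Finsupp.single p 1)

theorem proj_single (p : Ops N j) (f : Hol E j.W) :
    proj N j (Finsupp.single p f) = f • of p := by
  rw [of, ← map_smul, Finsupp.smul_single, smul_eq_mul, mul_one]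

theorem of_add_smul (p q : Ops N j) (g : Hol F j.U) :
    of (p + g • q) = of p + pull π j.le g • of q := by
  rw [← proj_single, ← sub_eq_zero, of, of, ← sub_sub, ← map_sub, ← map_sub, proj_eq_zero]
  exact Submodule.subset_span (Or.inl ⟨p, q, g, rfl⟩)

theorem of_inner_smul (f : Hol E j.W) (s : A.Γ j.W) :
    of (Ops.inner N j (f • s)) = f • of (Ops.inner N j s) := by
  rw [← proj_single, ← sub_eq_zero, of, ← map_sub, proj_eq_zero]
  exact Submodule.subset_span (Or.inr ⟨f, s, rfl⟩)

variable (N) in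
/-- `of` as a homomorphism. -/
noncomputable def ofHom (j : Patch π) : Ops N j →+ Prol N j :=
  AddMonoidHom.mk' of fun p q => by
    have := of_add_smul p q 1
    rwa [Ops.one_smul', map_one, one_smul] at this

theorem of_add (p q : Ops N j) : of (p + q) = of p + of q := map_add (ofHom N j) p q

theorem of_neg (p : Ops N j) : of (-p) = -of p := map_neg (ofHom N j) p

theorem of_sub (p q : Ops N j) : of (p - q) = of p - of q := map_sub (ofHom N j) p q

theorem of_zero : of (0 : Ops N j) = 0 := map_zero (ofHom N j)

theorem of_smul (g : Hol F j.U) (q : Ops N j) : of (g • q) = pull π j.le g • of q := by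
  have := of_add_smul 0 q g
  rwa [of_zero, zero_add, zero_add] at this

theorem of_sum {ι : Type*} (s : Finset ι) (q : ι → Ops N j) :
    of (∑ i ∈ s, q i) = ∑ i ∈ s, of (q i) := map_sum (ofHom N j) q s

@[elab_as_elim]
theorem induction {P : Prol N j → Prop} (x : Prol N j) (add : ∀ x y, P x → P y → P (x + y))
    (smul : ∀ (f : Hol E j.W) (p : Ops N j), P (f • of p)) : P x := by
  obtain ⟨x, rfl⟩ := proj_surjective N x
  induction x using Finsupp.induction_linear with
  | zero =>
    have := smul 0 0
    rwa [zero_smul, ← map_zero (proj N j)] at this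
  | add x y hx hy => rw [map_add]; exact add _ _ hx hy
  | single p f => rw [proj_single]; exact smul f p

/-- Additive maps out of the prolongation. -/
noncomputable def liftAdd {M : Type*} [AddCommGroup M] (φ : (Ops N j →₀ Hol E j.W) →+ M)
    (hφ : ∀ x ∈ Submodule.span (Hol E j.W) (prolRel N j), φ x = 0) : Prol N j →+ M :=
  QuotientAddGroup.lift (Submodule.span (Hol E j.W) (prolRel N j)).toAddSubgroup φ hφ

theorem liftAdd_proj {M : Type*} [AddCommGroup M] (φ : (Ops N j →₀ Hol E j.W) →+ M)
    (hφ : ∀ x ∈ Submodule.span (Hol E j.W) (prolRel N j), φ x = 0) (x : Ops N j →₀ Hol E j.W) :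
    liftAdd φ hφ (proj N j x) = φ x := rfl

/-- Linear maps out of the prolongation. -/
noncomputable def lift {M : Type*} [AddCommGroup M] [Module (Hol E j.W) M] (φ : Ops N j → M)
    (h₁ : ∀ p q (g : Hol F j.U), φ (p + g • q) = φ p + pull π j.le g • φ q)
    (h₂ : ∀ (f : Hol E j.W) (s : A.Γ j.W), φ (Ops.inner N j (f • s)) = f • φ (Ops.inner N j s)) :
    Prol N j →ₗ[Hol E j.W] M :=
  Submodule.liftQ _ (Finsupp.linearCombination _ φ) (by
    rw [Submodule.span_le]
    rintro _ (⟨p, q, g, rfl⟩ | ⟨f, s, rfl⟩)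
    · simp [h₁]
    · simp [h₂])

@[simp] theorem lift_of {M : Type*} [AddCommGroup M] [Module (Hol E j.W) M] (φ : Ops N j → M)
    (h₁ : ∀ p q (g : Hol F j.U), φ (p + g • q) = φ p + pull π j.le g • φ q)
    (h₂ : ∀ (f : Hol E j.W) (s : A.Γ j.W), φ (Ops.inner N j (f • s)) = f • φ (Ops.inner N j s))
    (p : Ops N j) : lift φ h₁ h₂ (of p) = φ p := by
  refine (Finsupp.linearCombination_single _ _ _).trans (one_smul _ _)

theorem linearMap_ext {M : Type*} [AddCommGroup M] [Module (Hol E j.W) M]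
    {φ ψ : Prol N j →ₗ[Hol E j.W] M} (h : ∀ p, φ (of p) = ψ (of p)) : φ = ψ := by
  ext x
  induction x using Prol.induction with
  | add x y hx hy => rw [map_add, map_add, hx, hy]
  | smul f p => rw [map_smul, map_smul, h]

/-- The anchor of the prolongation. -/
noncomputable def anchor : Prol N j →ₗ[Hol E j.W] VField E j.W :=
  lift (fun p => p.op.symbol) (fun _ _ _ => rfl) (fun f s => map_smul A.anchor f s)

@[simp] theorem anchor_of (p : Ops N j) : anchor (of p) = p.op.symbol := lift_of _ _ _ p

/-- The bracket on the free module, with values in the prolongation: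
`[f p, g q] = f g [p, q] + f σ(p)(g) q - g σ(q)(f) p`. -/
noncomputable def preBracket :
    (Ops N j →₀ Hol E j.W) →+ (Ops N j →₀ Hol E j.W) →+ Prol N j :=
  Finsupp.liftAddHom fun p => AddMonoidHom.mk' (fun f => Finsupp.liftAddHom fun q =>
    AddMonoidHom.mk' (fun g => (f * g) • of (Ops.comm p q) +
      (f * p.op.symbol.der le_rfl g) • of q - (g * q.op.symbol.der le_rfl f) • of p)
      (fun g g' => by
        simp only [mul_add, add_mul, map_add, add_smul]
        abel)) (fun f f' => by
        ext q g
        simp only [mul_add, add_mul, map_add, add_smul, Finsupp.liftAddHom_comp_single,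
          AddMonoidHom.add_comp, AddMonoidHom.add_apply, AddMonoidHom.mk'_apply]
        abel)

theorem preBracket_single (p q : Ops N j) (f g : Hol E j.W) :
    preBracket (Finsupp.single p f) (Finsupp.single q g) = (f * g) • of (Ops.comm p q) +
      (f * p.op.symbol.der le_rfl g) • of q - (g * q.op.symbol.der le_rfl f) • of p := by
  simp only [preBracket, Finsupp.liftAddHom_apply_single, AddMonoidHom.mk'_apply]

theorem preBracket_skew (x y : Ops N j →₀ Hol E j.W) : preBracket y x = -preBracket x y := by
  induction x using Finsupp.induction_linear with
  | zero => simp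
  | add x x' hx hx' => rw [map_add, hx, hx', map_add, AddMonoidHom.add_apply, neg_add]
  | single p f =>
    induction y using Finsupp.induction_linear with
    | zero => simp
    | add x x' hx hx' => rw [map_add, map_add, AddMonoidHom.add_apply, hx, hx', neg_add]
    | single q g =>
      rw [preBracket_single, preBracket_single, Ops.comm_skew, of_neg, mul_comm g f, smul_neg]
      abel

theorem preBracket_smul (h : Hol E j.W) (x y : Ops N j →₀ Hol E j.W) :
    preBracket x (h • y) = h • preBracket x y +
      (anchor (proj N j x)).der le_rfl h • proj N j y := by
  induction x using Finsupp.induction_linear with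
  | zero => simp
  | add x x' hx hx' =>
    simp only [map_add, AddMonoidHom.add_apply, hx, hx', VField.add_der, smul_add, add_smul]
    abel
  | single p f =>
    induction y using Finsupp.induction_linear with
    | zero => simp
    | add x x' hx hx' =>
      simp only [map_add, hx, hx', smul_add]
      abel
    | single q g =>
      rw [Finsupp.smul_single, preBracket_single, preBracket_single, proj_single, proj_single,
        LinearMap.map_smul, anchor_of, VField.smul_der, smul_eq_mul, Derivation.leibniz]
      simp only [smul_smul, smul_eq_mul, smul_sub, smul_add]
      have e : holRes E (le_refl j.W) f = f := rfl
      rw [e]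
      module

/-- The bracket respects the relations: the first kind because commutators of operators satisfy the
Leibniz rule over functions on the base, the second kind because `[q, ad(s)] = ad(q(s))`. -/
theorem preBracket_eq_zero (x y : Ops N j →₀ Hol E j.W)
    (hy : y ∈ Submodule.span (Hol E j.W) (prolRel N j)) : preBracket x y = 0 := by
  induction hy using Submodule.span_induction with
  | zero => exact map_zero _
  | add y y' _ _ hy hy' => rw [map_add, hy, hy', add_zero]
  | smul h y hy' hy =>
    rw [preBracket_smul, hy, (proj_eq_zero N).2 hy', smul_zero, smul_zero, add_zero]
  | mem y hy =>
    induction x using Finsupp.induction_linear with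
    | zero => simp
    | add x x' hx hx' => rw [map_add, AddMonoidHom.add_apply, hx, hx', add_zero]
    | single p f =>
      rcases hy with ⟨q, r, g, rfl⟩ | ⟨g, s, rfl⟩
      · rw [map_sub, map_sub, preBracket_single, preBracket_single, preBracket_single,
          Ops.comm_add_smul, of_add, of_add_smul, of_smul, of_add_smul, Ops.der_pull,
          Ops.add_op, LieOp.add_symbol, VField.add_der, Ops.smul_op, LieOp.baseSmul_symbol,
          VField.smul_der, Derivation.map_one_eq_zero, res_pull]
        module
      · rw [map_sub, preBracket_single, preBracket_single, Ops.comm_inner, Ops.comm_inner,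
          LieOp.op_smul, map_add, of_add, of_inner_smul, of_inner_smul, of_inner_smul,
          Ops.inner_op, Ops.inner_op, ad_symbol, ad_symbol, map_smul, VField.smul_der,
          Derivation.map_one_eq_zero]
        have e : holRes E (le_refl j.W) g = g := rfl
        rw [e]
        module

/-- The bracket of the prolongation. -/
noncomputable def bracket : Prol N j →+ Prol N j →+ Prol N j :=
  liftAdd (AddMonoidHom.mk' (fun x => liftAdd (preBracket x) (preBracket_eq_zero x)) (by
      intro x x'
      ext y
      obtain ⟨y, rfl⟩ := proj_surjective N y
      rw [AddMonoidHom.add_apply, liftAdd_proj, liftAdd_proj, liftAdd_proj, map_add,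
        AddMonoidHom.add_apply])) (by
    intro x hx
    ext y
    obtain ⟨y, rfl⟩ := proj_surjective N y
    change preBracket x y = 0
    rw [preBracket_skew, preBracket_eq_zero y x hx, neg_zero])

theorem bracket_proj (x y : Ops N j →₀ Hol E j.W) :
    bracket (proj N j x) (proj N j y) = preBracket x y := rfl

theorem bracket_smul_of (p q : Ops N j) (f g : Hol E j.W) :
    bracket (f • of p) (g • of q) = (f * g) • of (Ops.comm p q) +
      (f * p.op.symbol.der le_rfl g) • of q - (g * q.op.symbol.der le_rfl f) • of p := by
  rw [← proj_single, ← proj_single, bracket_proj, preBracket_single]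

theorem bracket_of (p q : Ops N j) : bracket (of p) (of q) = of (Ops.comm p q) := by
  have := bracket_smul_of p q 1 1
  simpa using this

theorem bracket_skew (x y : Prol N j) : bracket y x = -bracket x y := by
  obtain ⟨x, rfl⟩ := proj_surjective N x
  obtain ⟨y, rfl⟩ := proj_surjective N y
  exact preBracket_skew x y

theorem bracket_smul (h : Hol E j.W) (x y : Prol N j) :
    bracket x (h • y) = h • bracket x y + (anchor x).der le_rfl h • y := by
  obtain ⟨x, rfl⟩ := proj_surjective N x
  obtain ⟨y, rfl⟩ := proj_surjective N y
  rw [← map_smul]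
  exact preBracket_smul h x y

theorem smul_bracket (h : Hol E j.W) (x y : Prol N j) :
    bracket (h • x) y = h • bracket x y - (anchor y).der le_rfl h • x := by
  rw [bracket_skew, bracket_smul, bracket_skew x y, smul_neg]
  abel

theorem anchor_bracket (x y : Prol N j) : anchor (bracket x y) = ⁅anchor x, anchor y⁆ := by
  induction x using Prol.induction with
  | add x x' hx hx' =>
    rw [map_add, AddMonoidHom.add_apply, map_add, map_add, hx, hx']
    ext1 W hW f
    simp only [VField.lie_der, VField.add_der, map_add]
    abel
  | smul f p =>
    induction y using Prol.induction with
    | add x x' hx hx' =>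
      rw [map_add, map_add, map_add, hx, hx']
      ext1 W hW f
      simp only [VField.lie_der, VField.add_der, map_add]
      abel
    | smul g q =>
      rw [bracket_smul_of]
      simp only [map_add, map_sub, map_smul, anchor_of, Ops.comm_op, LieOp.comm_symbol]
      ext1 W hW k
      have e : ∀ (Y Z : VField E j.W), (Y - Z).der hW k = Y.der hW k - Z.der hW k :=
        fun _ _ => rfl
      simp only [e, VField.lie_der, VField.smul_der, VField.add_der, Derivation.leibniz,
        smul_eq_mul, map_mul, VField.res_der]
      ring

/-- The Jacobiator is linear over functions, as the anchor preserves brackets. -/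
theorem jacobi_smul {x y z : Prol N j}
    (H : bracket x (bracket y z) + bracket y (bracket z x) + bracket z (bracket x y) = 0)
    (f : Hol E j.W) :
    bracket x (bracket y (f • z)) + bracket y (bracket (f • z) x) +
      bracket (f • z) (bracket x y) = 0 := by
  simp only [bracket_smul, smul_bracket, map_add, map_sub, anchor_bracket, VField.lie_der]
  rw [← smul_zero f, ← H, bracket_skew x z]
  module

/-- The Jacobi identity: it suffices to check it on operators, where it holds for commutators. -/
theorem jacobi (x y z : Prol N j) :
    bracket x (bracket y z) + bracket y (bracket z x) + bracket z (bracket x y) = 0 := by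
  have rot : ∀ x y z : Prol N j,
      bracket x (bracket y z) + bracket y (bracket z x) + bracket z (bracket x y) =
        bracket y (bracket z x) + bracket z (bracket x y) + bracket x (bracket y z) :=
    fun _ _ _ => by abel
  have lin : ∀ x y : Prol N j, (∀ r : Ops N j, bracket x (bracket y (of r)) +
      bracket y (bracket (of r) x) + bracket (of r) (bracket x y) = 0) → ∀ z,
      bracket x (bracket y z) + bracket y (bracket z x) + bracket z (bracket x y) = 0 := by
    intro x y h z
    induction z using Prol.induction with
    | add z z' hz hz' =>
      simp only [map_add, AddMonoidHom.add_apply]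
      refine Eq.trans ?_ ((congrArg₂ (· + ·) hz hz').trans (add_zero 0))
      abel
    | smul f r => exact jacobi_smul (h r) f
  refine lin x y (fun r => ?_) z
  rw [rot, rot]
  refine (lin (of r) x (fun q => ?_) y)
  rw [rot, rot]
  refine lin (of q) (of r) (fun p => ?_) x
  rw [bracket_of, bracket_of, bracket_of, bracket_of, bracket_of, bracket_of, ← of_add, ← of_add,
    Ops.comm_jacobi, of_zero]

end Prol

end Ops

section Restriction

variable {E : Type v} [NormedAddCommGroup E] [NormedSpace ℂ E]
  {F : Type w} [NormedAddCommGroup F] [NormedSpace ℂ F]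
  {X : Type u} [TopologicalSpace X] [ChartedSpace E X] [IsManifold 𝓘(ℂ, E) ω X]
  {S : Type u} [TopologicalSpace S] [ChartedSpace F S]
  {π : C^ω⟮𝓘(ℂ, E), X; 𝓘(ℂ, F), S⟯} {A : Family π}
  {hπ : Manifold.IsSubmersion 𝓘(ℂ, E) 𝓘(ℂ, F) ω π} {hfib : ∀ s, IsConnected (π ⁻¹' {s})}
  {N : FlatConnection (pushforward A hπ hfib)}

namespace Prol

variable {i j k : Patch π}

/-- Restriction to a smaller patch, on the free module. -/
noncomputable def preRes (h : i ≤ j) : (Ops N j →₀ Hol E j.W) →+ Prol N i :=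
  Finsupp.liftAddHom fun p => AddMonoidHom.mk' (fun f => holRes E h.1 f • of (Ops.res h p))
    fun f g => by rw [map_add, add_smul]

theorem preRes_single (h : i ≤ j) (p : Ops N j) (f : Hol E j.W) :
    preRes h (Finsupp.single p f) = holRes E h.1 f • of (Ops.res h p) := by
  simp only [preRes, Finsupp.liftAddHom_apply_single, AddMonoidHom.mk'_apply]

theorem preRes_smul (h : i ≤ j) (f : Hol E j.W) (x : Ops N j →₀ Hol E j.W) :
    preRes h (f • x) = holRes E h.1 f • preRes h x := by
  induction x using Finsupp.induction_linear with
  | zero => simp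
  | add x y hx hy => rw [smul_add, map_add, map_add, smul_add, hx, hy]
  | single p g =>
    rw [Finsupp.smul_single, preRes_single, preRes_single, smul_eq_mul, map_mul, mul_smul]

/-- Restriction to a smaller patch. -/
noncomputable def res (h : i ≤ j) : Prol N j →+ Prol N i :=
  liftAdd (preRes h) (by
    intro x hx
    induction hx using Submodule.span_induction with
    | zero => exact map_zero _
    | add x y _ _ hx hy => rw [map_add, hx, hy, add_zero]
    | smul f x _ hx => rw [preRes_smul, hx, smul_zero]
    | mem x hx =>
      rcases hx with ⟨p, q, g, rfl⟩ | ⟨f, s, rfl⟩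
      · rw [map_sub, map_sub, preRes_single, preRes_single, preRes_single, map_add,
          Ops.res_smul, of_add_smul, map_one, one_smul, one_smul, add_sub_cancel_left, res_pull,
          pull_res, sub_self]
      · rw [map_sub, preRes_single, preRes_single, Ops.res_inner, Ops.res_inner, A.res_smul,
          of_inner_smul, map_one, one_smul, sub_self])

theorem res_smul (h : i ≤ j) (f : Hol E j.W) (x : Prol N j) :
    res h (f • x) = holRes E h.1 f • res h x := by
  obtain ⟨x, rfl⟩ := proj_surjective N x
  rw [← map_smul]
  exact preRes_smul h f x

theorem res_of (h : i ≤ j) (p : Ops N j) : res h (of p) = of (Ops.res h p) :=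
  (preRes_single h p 1).trans (by rw [map_one, one_smul])

theorem res_self (h : j ≤ j) (x : Prol N j) : res h x = x := by
  induction x using Prol.induction with
  | add x y hx hy => rw [map_add, hx, hy]
  | smul f p => rw [res_smul, res_of]; rfl

theorem res_res (h : i ≤ j) (h' : k ≤ i) (x : Prol N j) :
    res h' (res h x) = res (h'.trans h) x := by
  induction x using Prol.induction with
  | add x y hx hy => rw [map_add, map_add, hx, hy, map_add]
  | smul f p => rw [res_smul, res_of, res_smul, res_of, res_smul, res_of]; rfl

theorem anchor_res (h : i ≤ j) (x : Prol N j) : anchor (res h x) = (anchor x).res h.1 := by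
  induction x using Prol.induction with
  | add x y hx hy => rw [map_add, map_add, hx, hy, map_add, map_add]
  | smul f p =>
    rw [res_smul, res_of, map_smul, map_smul, anchor_of, anchor_of, VField.res_smul]
    rfl

theorem res_bracket (h : i ≤ j) (x y : Prol N j) :
    res h (bracket x y) = bracket (res h x) (res h y) := by
  induction x using Prol.induction with
  | add x x' hx hx' =>
    simp only [map_add, AddMonoidHom.add_apply, hx, hx']
  | smul f p =>
    induction y using Prol.induction with
    | add x x' hx hx' => simp only [map_add, hx, hx']
    | smul g q =>
      rw [bracket_smul_of, map_sub, map_add, res_smul, res_smul, res_smul, res_smul, res_smul,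
        res_of, res_of, res_of, bracket_smul_of, Ops.res_comm, map_mul, map_mul, map_mul,
        VField.res_der, VField.res_der]
      rfl

end Prol

end Restriction

/-! ### Frames -/

section LocalOps

variable {E : Type v} [NormedAddCommGroup E] [NormedSpace ℂ E]
  {F : Type w} [NormedAddCommGroup F] [NormedSpace ℂ F]
  {X : Type u} [TopologicalSpace X] [ChartedSpace E X]
  {S : Type u} [TopologicalSpace S] [ChartedSpace F S]
  {π : C^ω⟮𝓘(ℂ, E), X; 𝓘(ℂ, F), S⟯} {A : Family π}

theorem LieOp.eq_of_local {V : Opens X} {p q : LieOp A V}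
    (h : ∀ x ∈ V, ∃ (W : Opens X) (_ : x ∈ W) (hW : W ≤ V), LieOp.res hW p = LieOp.res hW q) :
    p = q := by
  refine LieOp.ext (fun W hW s => A.eq_of_local fun x hx => ?_) (VField.eq_of_local fun x hx => ?_)
  · obtain ⟨W', hx', hW', he⟩ := h x (hW hx)
    refine ⟨W' ⊓ W, ⟨hx', hx⟩, inf_le_right, ?_⟩
    rw [p.res_op, q.res_op]
    exact congrArg (fun p : LieOp A W' => p.op inf_le_left (A.res inf_le_right s)) he
  · obtain ⟨W', hx', hW', he⟩ := h x hx
    exact ⟨W', hx', hW', congrArg LieOp.symbol he⟩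

theorem Family.AdInjective.ad_injective (hA : A.AdInjective) {V : Opens X} :
    Function.Injective (ad A (V := V)) := by
  refine (injective_iff_map_eq_zero _).2 fun s hs => hA V s fun W h t => ?_
  exact congrArg (fun p : LieOp A V => p.op h t) hs

/-- If the adjoint map is injective, then an operator whose class in `𝔲(𝒜_S)` vanishes is of the
form `{s, ·}`. -/
theorem Family.AdInjective.exists_ad (hA : A.AdInjective) {V : Opens X} (p : LieOp A V)
    (hp : ∀ (x : X) (hx : x ∈ V), uGerm hx p = 0) : ∃ s : A.Γ V, p = ad A s := by
  obtain ⟨s, -, hs⟩ := A.exists_of_local (U := V) (fun W h s => LieOp.res h p = ad A s)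
    (fun W W' hW h s hs => by rw [← res_ad, ← hs, LieOp.res_res])
    (fun W hW s t hs ht => hA.ad_injective (hs.symm.trans ht))
    (fun x hx => by
      have h := hp x hx
      rw [← uGerm_zero hx] at h
      obtain ⟨W, hxW, h, h', s, hs⟩ := uGerm_eq_iff.1 h
      exact ⟨W, hxW, h, s, by rw [hs, map_zero, zero_add]⟩)
  refine ⟨s, LieOp.eq_of_local fun x hx => ?_⟩
  obtain ⟨W, hxW, hW, he⟩ := hs x hx
  exact ⟨W, hxW, hW, he.trans (res_ad A hW s).symm⟩

/-- Restriction of coordinates. -/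
noncomputable def Coords.res {m : ℕ} {U U' : Opens S} (h : U' ≤ U) (C : Coords F m U) :
    Coords F m U' where
  t i := holRes F h (C.t i)
  ξ i := (C.ξ i).res h
  ξ_t i j := by
    have := congrArg (holRes F h) (C.ξ_t i j)
    rw [VField.res_der] at this
    refine this.trans ?_
    split_ifs
    · exact map_one _
    · exact map_zero _
  expand h' v := C.expand (h'.trans h) v
  hadamard h' f x := C.hadamard (h'.trans h) f x

end LocalOps

section Frames

variable {E : Type v} [NormedAddCommGroup E] [NormedSpace ℂ E]
  {F : Type w} [NormedAddCommGroup F] [NormedSpace ℂ F]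
  {X : Type u} [TopologicalSpace X] [ChartedSpace E X] [IsManifold 𝓘(ℂ, E) ω X]
  {S : Type u} [TopologicalSpace S] [ChartedSpace F S]
  {π : C^ω⟮𝓘(ℂ, E), X; 𝓘(ℂ, F), S⟯} {A : Family π}
  {hπ : Manifold.IsSubmersion 𝓘(ℂ, E) 𝓘(ℂ, F) ω π} {hfib : ∀ s, IsConnected (π ⁻¹' {s})}
  (N : FlatConnection (pushforward A hπ hfib))

/-- Coordinates on `U` and operators over `W` which represent the images of the coordinate fields
under the connection. -/
structure Frame (j : Patch π) where
  coords : Coords F (Module.finrank ℂ F) j.U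
  q : Fin (Module.finrank ℂ F) → Ops N j
  q_vec : ∀ i, (q i).vec = coords.ξ i

variable {N}

/-- Restriction of frames. -/
noncomputable def Frame.res {i j : Patch π} (h : i ≤ j) (Φ : Frame N j) : Frame N i where
  coords := Φ.coords.res h.2
  q k := Ops.res h (Φ.q k)
  q_vec k := congrArg (VField.res h.2) (Φ.q_vec k)

variable (N) in
/-- There is a frame near each point. -/
theorem exists_frame [FiniteDimensional ℂ F] (x : X) :
    ∃ j : Patch π, x ∈ j.W ∧ Nonempty (Frame N j) := by
  obtain ⟨U, W₀, hx, hW₀, C, -⟩ := exists_coords_lift hπ x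
  choose W hxW hW p hp using fun i =>
    USec.exists_rep (V := pre π U) (N.map (C.ξ i)) (hW₀ hx)
  let W' : Opens X := ⟨W₀ ∩ ⋂ i, W i, W₀.2.inter (isOpen_iInter_of_finite fun i => (W i).2)⟩
  have hW' : ∀ i, W' ≤ W i := fun i y hy => Set.mem_iInter.1 hy.2 i
  let j : Patch π := ⟨W', U, fun y hy => hW₀ hy.1⟩
  exact ⟨j, ⟨hx, Set.mem_iInter.2 hxW⟩, ⟨⟨C, fun i => ⟨(LieOp.res (hW' i) (p i), C.ξ i),
    (hp i).res (hW' i)⟩, fun i => rfl⟩⟩⟩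

namespace Ops

variable {j : Patch π}

noncomputable instance : Module (Hol F j.U) (Ops N j) where
  one_smul := one_smul'
  mul_smul g g' q := ext (LieOp.mul_baseSmul _ _ _ _) (mul_smul _ _ _)
  smul_zero g := ext (LieOp.ext (fun W hW s => by simp) (by simp)) (smul_zero _)
  smul_add g p q := ext (LieOp.baseSmul_add _ _ _ _) (smul_add _ _ _)
  add_smul g g' q := ext (LieOp.add_baseSmul _ _ _ _) (add_smul _ _ _)
  zero_smul q := ext (LieOp.zero_baseSmul _ _) (zero_smul _ _)

variable (N) in
/-- The vector field on the base, as a linear map. -/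
noncomputable def vecHom (j : Patch π) : Ops N j →ₗ[Hol F j.U] VField F j.U where
  toFun := vec
  map_add' _ _ := rfl
  map_smul' _ _ := rfl

theorem sum_vec {ι : Type*} (s : Finset ι) (q : ι → Ops N j) :
    (∑ i ∈ s, q i).vec = ∑ i ∈ s, (q i).vec := map_sum (vecHom N j) q s

theorem inner_injective (hA : A.AdInjective) : Function.Injective (inner N j) :=
  fun _ _ h => hA.ad_injective (congrArg op h)

theorem exists_inner (hA : A.AdInjective) (q : Ops N j) (hq : q.vec = 0) :
    ∃ s : A.Γ j.W, q = inner N j s := by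
  obtain ⟨s, hs⟩ := hA.exists_ad q.op fun x hx => by
    have h := q.rep x hx
    rw [hq, map_zero] at h
    exact h.symm
  exact ⟨s, ext hs hq⟩

end Ops

namespace Frame

variable {j : Patch π} (Φ : Frame N j)

/-- The horizontal part of an operator. -/
noncomputable def horiz (p : Ops N j) : Ops N j :=
  ∑ i, p.vec.der le_rfl (Φ.coords.t i) • Φ.q i

theorem horiz_vec (p : Ops N j) : (Φ.horiz p).vec = p.vec := by
  rw [horiz, Ops.sum_vec]
  conv_rhs => rw [Φ.coords.expand le_rfl p.vec]
  refine Finset.sum_congr rfl fun i _ => ?_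
  rw [Ops.smul_vec, Φ.q_vec]
  rfl

theorem horiz_add_smul (p q : Ops N j) (g : Hol F j.U) :
    Φ.horiz (p + g • q) = Φ.horiz p + g • Φ.horiz q := by
  rw [horiz, horiz, horiz, Finset.smul_sum, ← Finset.sum_add_distrib]
  refine Finset.sum_congr rfl fun i _ => ?_
  rw [Ops.add_vec, Ops.smul_vec, VField.add_der, VField.smul_der, smul_smul, ← add_smul]
  rfl

theorem horiz_inner (s : A.Γ j.W) : Φ.horiz (Ops.inner N j s) = 0 :=
  Finset.sum_eq_zero fun _ _ => zero_smul _ _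

theorem horiz_q (i) : Φ.horiz (Φ.q i) = Φ.q i := by
  rw [horiz, Finset.sum_eq_single i]
  · rw [Φ.q_vec, Φ.coords.ξ_t, if_pos rfl, one_smul]
  · intro k _ hk
    rw [Φ.q_vec, Φ.coords.ξ_t, if_neg (Ne.symm hk), zero_smul]
  · simp

variable (hA : A.AdInjective)

/-- The vertical part of an operator. -/
noncomputable def vert (p : Ops N j) : A.Γ j.W :=
  (Ops.exists_inner hA (p - Φ.horiz p) (by
    rw [Ops.sub_vec, Φ.horiz_vec, sub_self])).choose

theorem inner_vert (p : Ops N j) : Ops.inner N j (Φ.vert hA p) = p - Φ.horiz p :=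
  (Ops.exists_inner hA (p - Φ.horiz p) (by
    rw [Ops.sub_vec, Φ.horiz_vec, sub_self])).choose_spec.symm

theorem vert_eq {p : Ops N j} {s : A.Γ j.W} (h : Ops.inner N j s = p - Φ.horiz p) :
    Φ.vert hA p = s :=
  Ops.inner_injective hA ((Φ.inner_vert hA p).trans h.symm)

theorem vert_inner (s : A.Γ j.W) : Φ.vert hA (Ops.inner N j s) = s :=
  Φ.vert_eq hA (by rw [horiz_inner, sub_zero])

theorem vert_q (i) : Φ.vert hA (Φ.q i) = 0 :=
  Φ.vert_eq hA (by rw [horiz_q, sub_self, map_zero])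

/-- The components of an element of the prolongation. -/
noncomputable def toProd : Prol N j →ₗ[Hol E j.W]
    A.Γ j.W × (Fin (Module.finrank ℂ F) → Hol E j.W) :=
  Prol.lift (fun p => (Φ.vert hA p, fun i => pull π j.le (p.vec.der le_rfl (Φ.coords.t i))))
    (fun p q g => by
      refine Prod.ext ?_ (funext fun i => ?_)
      · refine Φ.vert_eq hA ?_
        change Ops.inner N j (Φ.vert hA p + pull π j.le g • Φ.vert hA q) = _
        rw [map_add, ← Ops.smul_inner, inner_vert, inner_vert, horiz_add_smul, smul_sub]
        abel
      · change pull π j.le ((p.vec + g • q.vec).der le_rfl _) = _ + pull π j.le g * _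
        rw [VField.add_der, map_add, VField.smul_der, map_mul]
        rfl)
    (fun f s => by
      refine Prod.ext ?_ (funext fun i => ?_)
      · change Φ.vert hA _ = f • Φ.vert hA _
        rw [vert_inner, vert_inner]
      · change pull π j.le 0 = f * pull π j.le 0
        rw [map_zero, mul_zero])

theorem toProd_of (p : Ops N j) : Φ.toProd hA (Prol.of p) =
    (Φ.vert hA p, fun i => pull π j.le (p.vec.der le_rfl (Φ.coords.t i))) :=
  Prol.lift_of _ _ _ p

/-- The second component is determined by the anchor. -/
theorem toProd_snd (x : Prol N j) (i) :
    (Φ.toProd hA x).2 i = (Prol.anchor x).der le_rfl (pull π j.le (Φ.coords.t i)) := by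
  induction x using Prol.induction with
  | add x y hx hy => rw [map_add, map_add, Prod.snd_add, Pi.add_apply, hx, hy, VField.add_der]
  | smul f p =>
    rw [map_smul, toProd_of, map_smul, VField.smul_der, Prol.anchor_of, Ops.der_pull]
    rfl

variable (N) in
/-- `s ↦ ad s`, as a linear map to the prolongation. -/
noncomputable def _root_.LieUnf.Prol.innerHom (j : Patch π) : A.Γ j.W →ₗ[Hol E j.W] Prol N j where
  toFun s := Prol.of (Ops.inner N j s)
  map_add' s t := by rw [map_add, Prol.of_add]
  map_smul' f s := Prol.of_inner_smul f s

theorem _root_.LieUnf.Prol.innerHom_apply (s : A.Γ j.W) :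
    Prol.innerHom N j s = Prol.of (Ops.inner N j s) := rfl

/-- The element of the prolongation with given components. -/
noncomputable def ofProd : A.Γ j.W × (Fin (Module.finrank ℂ F) → Hol E j.W) →ₗ[Hol E j.W]
    Prol N j :=
  (Prol.innerHom N j).coprod (Fintype.linearCombination (Hol E j.W) fun i => Prol.of (Φ.q i))

theorem ofProd_apply (s : A.Γ j.W) (f : Fin (Module.finrank ℂ F) → Hol E j.W) :
    Φ.ofProd (s, f) = Prol.of (Ops.inner N j s) + ∑ i, f i • Prol.of (Φ.q i) := by
  rw [ofProd, LinearMap.coprod_apply, Fintype.linearCombination_apply]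
  rfl

/-- Over a framed patch the prolongation is the direct sum of `𝒜_S` and a free module. -/
noncomputable def equiv : Prol N j ≃ₗ[Hol E j.W]
    A.Γ j.W × (Fin (Module.finrank ℂ F) → Hol E j.W) :=
  LinearEquiv.ofLinearMap (Φ.toProd hA) Φ.ofProd (by
      refine LinearMap.ext fun ⟨s, f⟩ => ?_
      rw [LinearMap.comp_apply, ofProd_apply, map_add, toProd_of, map_sum, vert_inner]
      refine Prod.ext ?_ (funext fun i => ?_)
      · simp only [map_smul, toProd_of, vert_q, Prod.fst_add, Prod.fst_sum, Prod.smul_fst,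
          smul_zero, Finset.sum_const_zero, add_zero, LinearMap.id_apply]
      · simp only [map_smul, toProd_of, Prod.snd_add, Prod.snd_sum, Prod.smul_snd, Pi.add_apply,
          Finset.sum_apply, Pi.smul_apply, LinearMap.id_apply, Ops.inner_vec, VField.zero_der,
          map_zero, zero_add, smul_eq_mul, q_vec, Coords.ξ_t]
        rw [Finset.sum_eq_single i]
        · rw [if_pos rfl, map_one, mul_one]
        · intro k _ hk
          rw [if_neg hk, map_zero, mul_zero]
        · simp)
    (Prol.linearMap_ext fun p => by
      rw [LinearMap.comp_apply, toProd_of, ofProd_apply, LinearMap.id_apply, inner_vert,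
        Prol.of_sub, horiz, Prol.of_sum]
      simp only [Prol.of_smul]
      rw [sub_add_cancel])

theorem ofProd_toProd (x : Prol N j) : Φ.ofProd (Φ.toProd hA x) = x :=
  (Φ.equiv hA).symm_apply_apply x

theorem toProd_ofProd (x) : Φ.toProd hA (Φ.ofProd x) = x :=
  (Φ.equiv hA).apply_symm_apply x

theorem res_ofProd {i : Patch π} (h : i ≤ j) (s : A.Γ j.W)
    (f : Fin (Module.finrank ℂ F) → Hol E j.W) :
    Prol.res h (Φ.ofProd (s, f)) =
      (Φ.res h).ofProd (A.res h.1 s, fun k => holRes E h.1 (f k)) := by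
  rw [ofProd_apply, ofProd_apply, map_add, map_sum, Prol.res_of, Ops.res_inner]
  congr 1
  refine Finset.sum_congr rfl fun k _ => ?_
  rw [Prol.res_smul, Prol.res_of]
  rfl

theorem toProd_res {i : Patch π} (h : i ≤ j) (x : Prol N j) :
    (Φ.res h).toProd hA (Prol.res h x) =
      (A.res h.1 (Φ.toProd hA x).1, fun k => holRes E h.1 ((Φ.toProd hA x).2 k)) := by
  conv_lhs => rw [← Φ.ofProd_toProd hA x]
  exact (congrArg _ (Φ.res_ofProd h _ _)).trans ((Φ.res h).toProd_ofProd hA _)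

/-- An element of the prolongation with vertical anchor belongs to `𝒜_S`. -/
theorem eq_inner_of_vertical (x : Prol N j) (hx : IsVertical π (Prol.anchor x)) :
    x = Prol.innerHom N j (Φ.toProd hA x).1 := by
  conv_lhs => rw [← Φ.ofProd_toProd hA x]
  rw [ofProd, LinearMap.coprod_apply]
  have h0 : (Φ.toProd hA x).2 = 0 := funext fun i => by
    rw [toProd_snd]
    exact hx _ _ _ _ _
  rw [h0, map_zero, add_zero]

include Φ hA in
theorem innerHom_injective : Function.Injective (Prol.innerHom N j) := fun s t h => by
  have := congrArg (fun x => (Φ.toProd hA x).1) h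
  simp only [Prol.innerHom_apply, toProd_of, vert_inner] at this
  exact this

end Frame

end Frames

/-! ### The sheaf of sections of the prolongation -/

section ProlSheaf

variable {E : Type v} [NormedAddCommGroup E] [NormedSpace ℂ E]
  {F : Type w} [NormedAddCommGroup F] [NormedSpace ℂ F]
  {X : Type u} [TopologicalSpace X] [ChartedSpace E X] [IsManifold 𝓘(ℂ, E) ω X]
  {S : Type u} [TopologicalSpace S] [ChartedSpace F S]
  {π : C^ω⟮𝓘(ℂ, E), X; 𝓘(ℂ, F), S⟯} {A : Family π}
  {hπ : Manifold.IsSubmersion 𝓘(ℂ, E) 𝓘(ℂ, F) ω π} {hfib : ∀ s, IsConnected (π ⁻¹' {s})}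

/-- The patch with the same `U` and a smaller `W`. -/
def Patch.shrink (j : Patch π) {W : Opens X} (h : W ≤ j.W) : Patch π := ⟨W, j.U, h.trans j.le⟩

theorem Patch.shrink_le (j : Patch π) {W : Opens X} (h : W ≤ j.W) : j.shrink h ≤ j :=
  ⟨h, le_rfl⟩

theorem Patch.shrink_le_shrink (j : Patch π) {W W' : Opens X} (h : W ≤ j.W) (h' : W' ≤ W) :
    j.shrink (h'.trans h) ≤ j.shrink h :=
  ⟨h', le_rfl⟩

variable {N : FlatConnection (pushforward A hπ hfib)}

namespace Prol

variable {j : Patch π}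

/-- By means of a frame, elements of the prolongation are determined locally. -/
theorem eq_of_local (Φ : Frame N j) (hA : A.AdInjective) {x y : Prol N j}
    (h : ∀ z ∈ j.W, ∃ (W : Opens X) (_ : z ∈ W) (hW : W ≤ j.W),
      res (j.shrink_le hW) x = res (j.shrink_le hW) y) : x = y := by
  apply (Φ.equiv hA).injective
  change Φ.toProd hA x = Φ.toProd hA y
  have key : ∀ z ∈ j.W, ∃ (W : Opens X) (_ : z ∈ W) (hW : W ≤ j.W),
      A.res hW (Φ.toProd hA x).1 = A.res hW (Φ.toProd hA y).1 ∧
      ∀ k, holRes E hW ((Φ.toProd hA x).2 k) = holRes E hW ((Φ.toProd hA y).2 k) := by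
    intro z hz
    obtain ⟨W, hzW, hW, he⟩ := h z hz
    have h1 := congrArg ((Φ.res (j.shrink_le hW)).toProd hA) he
    rw [Φ.toProd_res, Φ.toProd_res] at h1
    exact ⟨W, hzW, hW, congrArg Prod.fst h1, fun k => congrFun (congrArg Prod.snd h1) k⟩
  refine Prod.ext (A.eq_of_local fun z hz => ?_) (funext fun k => Hol.eq_of_local fun z hz => ?_)
  · obtain ⟨W, hzW, hW, he, -⟩ := key z hz
    exact ⟨W, hzW, hW, he⟩
  · obtain ⟨W, hzW, hW, -, he⟩ := key z hz
    exact ⟨W, hzW, hW, he k⟩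

/-- By means of a frame, elements of the prolongation which are locally characterized by a property
`P` exist if they exist locally. -/
theorem exists_of_local (Φ : Frame N j) (hA : A.AdInjective)
    (P : ∀ (W : Opens X) (h : W ≤ j.W), Prol N (j.shrink h) → Prop)
    (hres : ∀ (W W' : Opens X) (hW : W ≤ j.W) (h : W' ≤ W) (x : Prol N (j.shrink hW)), P W hW x →
      P W' (h.trans hW) (res (j.shrink_le_shrink hW h) x))
    (huniq : ∀ (W : Opens X) (hW : W ≤ j.W) (x y : Prol N (j.shrink hW)), P W hW x → P W hW y →
      x = y)
    (hex : ∀ z ∈ j.W, ∃ (W : Opens X) (_ : z ∈ W) (hW : W ≤ j.W) (x : Prol N (j.shrink hW)),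
      P W hW x) :
    ∃ x : Prol N j, ∀ (W : Opens X) (hW : W ≤ j.W) (y : Prol N (j.shrink hW)), P W hW y →
      res (j.shrink_le hW) x = y := by
  have hc : ∀ (W W' : Opens X) (hW : W ≤ j.W) (h : W' ≤ W) (x : Prol N (j.shrink hW)),
      (Φ.res (j.shrink_le (h.trans hW))).toProd hA (res (j.shrink_le_shrink hW h) x) =
      (A.res h ((Φ.res (j.shrink_le hW)).toProd hA x).1,
        fun k => holRes E h (((Φ.res (j.shrink_le hW)).toProd hA x).2 k)) := fun W W' hW h x =>
    (Φ.res (j.shrink_le hW)).toProd_res hA (j.shrink_le_shrink hW h) x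
  obtain ⟨s, hs, -⟩ := A.exists_of_local (U := j.W)
    (fun W hW s => ∃ y, P W hW y ∧ ((Φ.res (j.shrink_le hW)).toProd hA y).1 = s)
    (by
      rintro W W' hW h _ ⟨y, hy, rfl⟩
      exact ⟨_, hres W W' hW h y hy, congrArg Prod.fst (hc W W' hW h y)⟩)
    (by
      rintro W hW _ _ ⟨y, hy, rfl⟩ ⟨y', hy', rfl⟩
      rw [huniq W hW y y' hy hy'])
    (by
      intro z hz
      obtain ⟨W, hzW, hW, y, hy⟩ := hex z hz
      exact ⟨W, hzW, hW, _, y, hy, rfl⟩)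
  have hf : ∀ k, ∃ f : Hol E j.W, ∀ (W : Opens X) (hW : W ≤ j.W) (y : Prol N (j.shrink hW)),
      P W hW y → holRes E hW f = ((Φ.res (j.shrink_le hW)).toProd hA y).2 k := by
    intro k
    obtain ⟨f, hf, -⟩ := (holSheaf E X).exists_of_local (U := j.W)
      (fun W hW f => ∃ y, P W hW y ∧ ((Φ.res (j.shrink_le hW)).toProd hA y).2 k = f)
      (by
        rintro W W' hW h _ ⟨y, hy, rfl⟩
        exact ⟨_, hres W W' hW h y hy, congrFun (congrArg Prod.snd (hc W W' hW h y)) k⟩)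
      (by
        rintro W hW _ _ ⟨y, hy, rfl⟩ ⟨y', hy', rfl⟩
        rw [huniq W hW y y' hy hy'])
      (by
        intro z hz
        obtain ⟨W, hzW, hW, y, hy⟩ := hex z hz
        exact ⟨W, hzW, hW, _, y, hy, rfl⟩)
    exact ⟨f, fun W hW y hy => hf W hW _ ⟨y, hy, rfl⟩⟩
  choose f hf using hf
  refine ⟨Φ.ofProd (s, f), fun W hW y hy => ?_⟩
  refine (Φ.res_ofProd (j.shrink_le hW) s f).trans ?_
  rw [← (Φ.res (j.shrink_le hW)).ofProd_toProd hA y]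
  exact congrArg _ (Prod.ext (hs W hW _ ⟨y, hy, rfl⟩) (funext fun k => hf k W hW y hy))

/-- The prolongation over a patch does not depend on the open subset of `S`. -/
theorem res_bijective (Φ : Frame N j) (hA : A.AdInjective) {i : Patch π} (h : i ≤ j)
    (hW : j.W = i.W) : Function.Bijective (res (N := N) h) := by
  obtain ⟨W, U, hU⟩ := i
  obtain ⟨W', U', hU'⟩ := j
  obtain rfl : W' = W := hW
  have key : ∀ x, (Φ.res h).toProd hA (res h x) = Φ.toProd hA x := fun x => by
    rw [Φ.toProd_res]
    exact Prod.ext (A.res_self _) rfl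
  refine ⟨fun x y hxy => (Φ.equiv hA).injective ?_, fun y =>
    ⟨Φ.ofProd ((Φ.res h).toProd hA y), ((Φ.res h).equiv hA).injective ?_⟩⟩
  · change Φ.toProd hA x = Φ.toProd hA y
    rw [← key, ← key, hxy]
  · change (Φ.res h).toProd hA _ = (Φ.res h).toProd hA _
    rw [key, Φ.toProd_ofProd]

end Prol

end ProlSheaf

section ProlSheaf

variable {E : Type v} [NormedAddCommGroup E] [NormedSpace ℂ E]
  {F : Type w} [NormedAddCommGroup F] [NormedSpace ℂ F]
  {X : Type u} [TopologicalSpace X] [ChartedSpace E X] [IsManifold 𝓘(ℂ, E) ω X]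
  {S : Type u} [TopologicalSpace S] [ChartedSpace F S]
  {π : C^ω⟮𝓘(ℂ, E), X; 𝓘(ℂ, F), S⟯} {A : Family π}
  {hπ : Manifold.IsSubmersion 𝓘(ℂ, E) 𝓘(ℂ, F) ω π} {hfib : ∀ s, IsConnected (π ⁻¹' {s})}
  (N : FlatConnection (pushforward A hπ hfib))

/-- Compatible families of elements of the prolongations over the framed patches in `V`,
together with their common anchor. -/
noncomputable def prolSections (V : Opens X) : AddSubgroup (VField E V ×
    ∀ j : {j : Patch π // Nonempty (Frame N j) ∧ j.W ≤ V}, Prol N j.1) where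
  carrier := {t | (∀ j, Prol.anchor (t.2 j) = t.1.res j.2.2) ∧
    ∀ i j (h : i.1 ≤ j.1), Prol.res h (t.2 j) = t.2 i}
  zero_mem' := ⟨fun _ => map_zero _, fun _ _ _ => map_zero _⟩
  add_mem' := by
    rintro t t' ⟨h1, h2⟩ ⟨h1', h2'⟩
    refine ⟨fun j => ?_, fun i j h => ?_⟩
    · change Prol.anchor (t.2 j + t'.2 j) = VField.res _ (t.1 + t'.1)
      rw [map_add, map_add, h1, h1']
    · change Prol.res h (t.2 j + t'.2 j) = t.2 i + t'.2 i
      rw [map_add, h2, h2']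
  neg_mem' := by
    rintro t ⟨h1, h2⟩
    refine ⟨fun j => ?_, fun i j h => ?_⟩
    · change Prol.anchor (-t.2 j) = VField.res _ (-t.1)
      rw [map_neg, map_neg, h1]
    · change Prol.res h (-t.2 j) = -t.2 i
      rw [map_neg, h2]

/-- Sections of the prolongation over `V`. -/
def ProlSec (V : Opens X) : Type u := prolSections N V

noncomputable instance (V : Opens X) : AddCommGroup (ProlSec N V) :=
  inferInstanceAs (AddCommGroup (prolSections N V))

namespace ProlSec

variable {N} {V : Opens X}

/-- The component over a framed patch. -/
def comp (t : ProlSec N V) (j : Patch π) (hj : Nonempty (Frame N j)) (h : j.W ≤ V) : Prol N j :=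
  t.1.2 ⟨j, hj, h⟩

/-- The anchor of a section. -/
def anchor (t : ProlSec N V) : VField E V := t.1.1

variable (t t' : ProlSec N V) {i j : Patch π} (hj : Nonempty (Frame N j)) (h : j.W ≤ V)

theorem anchor_comp : Prol.anchor (t.comp j hj h) = t.anchor.res h := t.2.1 ⟨j, hj, h⟩

theorem res_comp (hi : Nonempty (Frame N i)) (hij : i ≤ j) :
    Prol.res hij (t.comp j hj h) = t.comp i hi (hij.1.trans h) := t.2.2 ⟨i, hi, hij.1.trans h⟩
      ⟨j, hj, h⟩ hij

variable {t t'} in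
theorem ext (h : t.anchor = t'.anchor) (h' : ∀ j hj h, t.comp j hj h = t'.comp j hj h) : t = t' :=
  Subtype.ext (Prod.ext h (funext fun j => h' j.1 j.2.1 j.2.2))

/-- A section from its anchor and its components. -/
def mk (Y : VField E V) (x : ∀ (j : Patch π), Nonempty (Frame N j) → j.W ≤ V → Prol N j)
    (hY : ∀ j hj h, Prol.anchor (x j hj h) = Y.res h)
    (hx : ∀ i j hi hj (h : j.W ≤ V) (hij : i ≤ j),
      Prol.res hij (x j hj h) = x i hi (hij.1.trans h)) : ProlSec N V :=
  ⟨(Y, fun j => x j.1 j.2.1 j.2.2), fun j => hY j.1 j.2.1 j.2.2,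
    fun i j h => hx i.1 j.1 i.2.1 j.2.1 j.2.2 h⟩

noncomputable instance : Module (Hol E V) (ProlSec N V) where
  smul f t := mk (f • t.anchor) (fun j hj h => holRes E h f • t.comp j hj h)
    (fun j hj h => by rw [map_smul, anchor_comp, VField.res_smul])
    (fun i j hi hj h hij => by rw [Prol.res_smul, res_comp _ hj h hi]; rfl)
  one_smul t := ext (one_smul _ _) fun j hj h => by
    change holRes E h 1 • t.comp j hj h = _
    rw [map_one, one_smul]
  mul_smul f g t := ext (mul_smul _ _ _) fun j hj h => by
    change holRes E h (f * g) • t.comp j hj h = holRes E h f • holRes E h g • t.comp j hj h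
    rw [map_mul, mul_smul]
  smul_zero f := ext (smul_zero _) fun j hj h => smul_zero (holRes E h f)
  smul_add f t t' := ext (smul_add _ _ _) fun j hj h => smul_add (holRes E h f) _ _
  add_smul f g t := ext (add_smul _ _ _) fun j hj h => by
    change holRes E h (f + g) • t.comp j hj h = holRes E h f • t.comp j hj h +
      holRes E h g • t.comp j hj h
    rw [map_add, add_smul]
  zero_smul t := ext (zero_smul _ _) fun j hj h => by
    change holRes E h 0 • t.comp j hj h = 0
    rw [map_zero, zero_smul]

/-- Restriction of sections. -/
noncomputable def res {V' : Opens X} (hV : V' ≤ V) : ProlSec N V →+ ProlSec N V' where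
  toFun t := mk (t.anchor.res hV) (fun j hj h => t.comp j hj (h.trans hV))
    (fun _ hj h => t.anchor_comp hj (h.trans hV))
    (fun _ _ hi hj h hij => t.res_comp hj (h.trans hV) hi hij)
  map_zero' := rfl
  map_add' _ _ := rfl

@[simp] theorem comp_res {V' : Opens X} (hV : V' ≤ V) (h : j.W ≤ V') :
    (res hV t).comp j hj h = t.comp j hj (h.trans hV) := rfl

/-- The bracket of sections. -/
noncomputable def bracket : ProlSec N V →+ ProlSec N V →+ ProlSec N V :=
  AddMonoidHom.mk' (fun t => AddMonoidHom.mk' (fun t' => mk ⁅t.anchor, t'.anchor⁆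
      (fun j hj h => Prol.bracket (t.comp j hj h) (t'.comp j hj h))
      (fun j hj h => by rw [Prol.anchor_bracket, anchor_comp, anchor_comp, VField.res_lie])
      (fun i j hi hj h hij => by
        rw [Prol.res_bracket, res_comp _ hj h hi, res_comp _ hj h hi]))
      (fun t' t'' => ext (by
          change ⁅t.anchor, t'.anchor + t''.anchor⁆ = ⁅t.anchor, t'.anchor⁆ + ⁅t.anchor, t''.anchor⁆
          ext1 W hW f
          simp only [VField.lie_der, VField.add_der, map_add]
          abel)
        fun j hj h => map_add (Prol.bracket (t.comp j hj h)) _ _))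
    (fun t t' => AddMonoidHom.ext fun t'' => ext (by
          change ⁅t.anchor + t'.anchor, t''.anchor⁆ =
            ⁅t.anchor, t''.anchor⁆ + ⁅t'.anchor, t''.anchor⁆
          ext1 W hW f
          simp only [VField.lie_der, VField.add_der, map_add]
          abel)
        fun j hj h => by
          change Prol.bracket (t.comp j hj h + t'.comp j hj h) (t''.comp j hj h) =
            Prol.bracket (t.comp j hj h) (t''.comp j hj h) +
            Prol.bracket (t'.comp j hj h) (t''.comp j hj h)
          rw [map_add, AddMonoidHom.add_apply])

@[simp] theorem bracket_comp :
    (bracket t t').comp j hj h = Prol.bracket (t.comp j hj h) (t'.comp j hj h) := rfl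

/-- Gluing of sections. -/
theorem glue (hA : A.AdInjective) {ι : Type u} (U : ι → Opens X) (s : ∀ i, ProlSec N (U i))
    (hs : ∀ i j, res (inf_le_left : U i ⊓ U j ≤ U i) (s i) =
      res (inf_le_right : U i ⊓ U j ≤ U j) (s j)) :
    ∃! t : ProlSec N (iSup U), ∀ i, res (le_iSup U i) t = s i := by
  have hs' : ∀ (i i' : ι) (j : Patch π) (hj : Nonempty (Frame N j)) (h : j.W ≤ U i)
      (h' : j.W ≤ U i'), (s i).comp j hj h = (s i').comp j hj h' := fun i i' j hj h h' =>
    congrArg (fun t : ProlSec N (U i ⊓ U i') => t.comp j hj (le_inf h h')) (hs i i')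
  have sh : ∀ (j : Patch π) {W : Opens X} (h : W ≤ j.W), Nonempty (Frame N j) →
      Nonempty (Frame N (j.shrink h)) := fun j W h hj => hj.map fun Φ => Φ.res (j.shrink_le h)
  obtain ⟨Y, hY, hYu⟩ := (tangentSheaf E X).glue U (fun i => (s i).anchor)
    (fun i j => congrArg anchor (hs i j))
  have hex : ∀ (j : Patch π) (hj : Nonempty (Frame N j)), j.W ≤ iSup U → ∃ x : Prol N j,
      ∀ (W : Opens X) (hW : W ≤ j.W) (i : ι) (hi : W ≤ U i),
        Prol.res (j.shrink_le hW) x = (s i).comp (j.shrink hW) (sh j hW hj) hi := by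
    intro j hj hjU
    obtain ⟨x, hx⟩ := Prol.exists_of_local hj.some hA
      (fun W hW x => ∃ (i : ι) (hi : W ≤ U i), x = (s i).comp (j.shrink hW) (sh j hW hj) hi)
      (by
        rintro W W' hW h _ ⟨i, hi, rfl⟩
        exact ⟨i, h.trans hi, (s i).res_comp _ _ _ _⟩)
      (by
        rintro W hW _ _ ⟨i, hi, rfl⟩ ⟨i', hi', rfl⟩
        exact hs' _ _ _ _ _ _)
      (by
        intro z hz
        obtain ⟨i, hi⟩ := Opens.mem_iSup.1 (hjU hz)
        exact ⟨j.W ⊓ U i, ⟨hz, hi⟩, inf_le_left, _, i, inf_le_right, rfl⟩)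
    exact ⟨x, fun W hW i hi => hx W hW _ ⟨i, hi, rfl⟩⟩
  choose x hx using hex
  refine ⟨mk Y x (fun j hj h => VField.eq_of_local fun z hz => ?_)
    (fun i j hi hj h hij => Prol.eq_of_local hi.some hA fun z hz => ?_), fun i => ext (hY i)
      fun j hj h => ?_, fun t ht => ext (hYu _ fun i => congrArg anchor (ht i)) fun j hj h =>
        Prol.eq_of_local hj.some hA fun z hz => ?_⟩
  · obtain ⟨i, hi⟩ := Opens.mem_iSup.1 (h hz)
    refine ⟨j.W ⊓ U i, ⟨hz, hi⟩, inf_le_left, ?_⟩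
    have e := congrArg Prol.anchor (hx j hj h (j.W ⊓ U i) inf_le_left i inf_le_right)
    exact (Prol.anchor_res (j.shrink_le inf_le_left) _).symm.trans (e.trans
      (((s i).anchor_comp _ _).trans (congrArg (VField.res inf_le_right) (hY i)).symm))
  · obtain ⟨k, hk⟩ := Opens.mem_iSup.1 (h (hij.1 hz))
    refine ⟨i.W ⊓ U k, ⟨hz, hk⟩, inf_le_left, ?_⟩
    have hle : i.shrink (inf_le_left : i.W ⊓ U k ≤ i.W) ≤
      j.shrink (inf_le_left.trans hij.1 : i.W ⊓ U k ≤ j.W) := ⟨le_rfl, hij.2⟩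
    rw [hx i hi _ _ inf_le_left k inf_le_right, Prol.res_res,
      ← (s k).res_comp (sh j (inf_le_left.trans hij.1) hj) inf_le_right _ hle,
      ← hx j hj h _ (inf_le_left.trans hij.1) k inf_le_right, Prol.res_res]
  · exact (Prol.res_self le_rfl _).symm.trans (hx j hj (h.trans (le_iSup U i)) j.W le_rfl i h)
  · obtain ⟨k, hk⟩ := Opens.mem_iSup.1 (h hz)
    refine ⟨j.W ⊓ U k, ⟨hz, hk⟩, inf_le_left, ?_⟩
    refine (t.res_comp hj h (sh j inf_le_left hj) _).trans
      (Eq.trans ?_ (hx j hj h _ inf_le_left k inf_le_right).symm)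
    rw [← ht k]
    rfl

/-- Over a framed patch the sections are the elements of the prolongation. -/
theorem exists_comp_eq (hA : A.AdInjective) (hj : Nonempty (Frame N j)) (x : Prol N j) :
    ∃ t : ProlSec N j.W, t.comp j hj le_rfl = x := by
  -- The component over `(W', U')` is determined by its restriction to `(W', U' ∩ U)`.
  let m : Patch π → Patch π := fun k => ⟨k.W ⊓ j.W, k.U ⊓ j.U, fun y hy => ⟨k.le hy.1, j.le hy.2⟩⟩
  have hmk : ∀ k, m k ≤ k := fun k => ⟨inf_le_left, inf_le_left⟩
  have hmj : ∀ k, m k ≤ j := fun k => ⟨inf_le_right, inf_le_right⟩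
  have hm : ∀ {i k}, i ≤ k → m i ≤ m k := fun h =>
    ⟨inf_le_inf_right _ h.1, inf_le_inf_right _ h.2⟩
  have hW : ∀ k, k.W ≤ j.W → k.W = (m k).W := fun k h => (inf_eq_left.2 h).symm
  have hb : ∀ k, Nonempty (Frame N k) → k.W ≤ j.W →
      Function.Bijective (Prol.res (N := N) (hmk k)) := fun k hk h =>
    Prol.res_bijective hk.some hA (hmk k) (hW k h)
  choose y hy using fun (k : Patch π) (hk : Nonempty (Frame N k)) (h : k.W ≤ j.W) =>
    (hb k hk h).2 (Prol.res (hmj k) x)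
  refine ⟨mk (Prol.anchor x) y (fun k hk h => ?_) (fun i k hi hk h hik => ?_), ?_⟩
  · refine VField.eq_of_local fun z hz => ⟨(m k).W, ⟨hz, h hz⟩, (hmk k).1, ?_⟩
    rw [← Prol.anchor_res (hmk k), hy, Prol.anchor_res]
    rfl
  · apply (hb i hi (hik.1.trans h)).1
    rw [hy, Prol.res_res, ← Prol.res_res (hmk k) (hm hik), hy, Prol.res_res]
  · exact (hb j hj le_rfl).1 (hy j hj le_rfl)

end ProlSec

/-- The Lie algebroid of sections of the prolongation. -/
noncomputable def prolAlgebroid (hA : A.AdInjective) : LieAlgebroid E X where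
  Γ V := ProlSec N V
  res h := ProlSec.res h
  res_smul h f t := ProlSec.ext (VField.res_smul h f t.anchor) fun _ _ _ => rfl
  res_self _ := rfl
  res_res _ _ _ := rfl
  glue U s hs := ProlSec.glue hA U s hs
  anchor := { toFun := ProlSec.anchor, map_add' := fun _ _ => rfl, map_smul' := fun _ _ => rfl }
  anchor_res _ _ := rfl
  bracket := ProlSec.bracket
  bracket_res h t t' := ProlSec.ext (VField.res_lie h _ _) fun _ _ _ => rfl
  skew t t' := ProlSec.ext (by
      change ⁅t'.anchor, t.anchor⁆ = -⁅t.anchor, t'.anchor⁆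
      ext1 W hW f
      simp) fun j hj h => Prol.bracket_skew (t.comp j hj h) (t'.comp j hj h)
  jacobi t t' t'' := ProlSec.ext (by
      change ⁅t.anchor, ⁅t'.anchor, t''.anchor⁆⁆ + ⁅t'.anchor, ⁅t''.anchor, t.anchor⁆⁆ +
        ⁅t''.anchor, ⁅t.anchor, t'.anchor⁆⁆ = 0
      ext1 W hW f
      simp
      abel) fun j hj h => Prol.jacobi (t.comp j hj h) (t'.comp j hj h) (t''.comp j hj h)
  leibniz f t t' := ProlSec.ext (by
      change ⁅f • t.anchor, t'.anchor⁆ =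
        f • ⁅t.anchor, t'.anchor⁆ - t'.anchor.der le_rfl f • t.anchor
      ext1 W hW k
      have e : ∀ Y Z : VField E _, (Y - Z).der hW k = Y.der hW k - Z.der hW k := fun _ _ => rfl
      rw [e]
      simp only [VField.lie_der, VField.smul_der, Derivation.leibniz, smul_eq_mul, VField.res_der]
      ring) fun j hj h => by
      change Prol.bracket (holRes E h f • t.comp j hj h) (t'.comp j hj h) =
        holRes E h f • Prol.bracket (t.comp j hj h) (t'.comp j hj h) -
          holRes E h (t'.anchor.der le_rfl f) • t.comp j hj h
      rw [Prol.smul_bracket, ProlSec.anchor_comp, VField.res_der]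
      rfl

end ProlSheaf

/-! ### Presentations of direct sums with free modules -/

section Presentation

variable {R M N : Type*} [CommRing R] [AddCommGroup M] [Module R M] [AddCommGroup N] [Module R N]
  {p n m : ℕ}

theorem linearCombination_append (a : Fin p → N) (b : Fin n → N) (c : Fin (p + n) → R) :
    Fintype.linearCombination R (Fin.append a b) c =
      Fintype.linearCombination R a (fun i => c (Fin.castAdd n i)) +
      Fintype.linearCombination R b (fun i => c (Fin.natAdd p i)) := by
  simp only [Fintype.linearCombination_apply, Fin.sum_univ_add, Fin.append_left, Fin.append_right]

variable {ι : M →ₗ[R] N} {e : Fin n → N}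
  (h : Function.Bijective (ι.coprod (Fintype.linearCombination R e))) {a : Fin p → M}

include h

theorem span_append_eq_top (ha : Submodule.span R (Set.range a) = ⊤) :
    Submodule.span R (Set.range (Fin.append (fun i => ι (a i)) e)) = ⊤ := by
  rw [← Fintype.range_linearCombination, LinearMap.range_eq_top] at ha ⊢
  intro y
  obtain ⟨⟨x, c⟩, rfl⟩ := h.2 y
  obtain ⟨b, rfl⟩ := ha x
  refine ⟨Fin.append b c, ?_⟩
  rw [linearCombination_append]
  simp only [Fin.append_left, Fin.append_right, Fintype.linearCombination_apply, map_sum,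
    LinearMap.coprod_apply, map_smul]

theorem ker_append {r : Fin m → Fin p → R}
    (hr : LinearMap.ker (Fintype.linearCombination R a) = Submodule.span R (Set.range r)) :
    LinearMap.ker (Fintype.linearCombination R (Fin.append (fun i => ι (a i)) e)) =
      Submodule.span R (Set.range fun k => Fin.append (r k) (0 : Fin n → R)) := by
  let J : (Fin p → R) →ₗ[R] (Fin (p + n) → R) :=
    { toFun := fun c => Fin.append c 0
      map_add' := fun c c' => funext fun i => by
        refine Fin.addCases (fun i => ?_) (fun i => ?_) i <;> simp
      map_smul' := fun f c => funext fun i => by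
        refine Fin.addCases (fun i => ?_) (fun i => ?_) i <;> simp }
  have hJ : (Set.range fun k => Fin.append (r k) (0 : Fin n → R)) = J '' Set.range r := by
    rw [← Set.range_comp]
    rfl
  rw [hJ, ← Submodule.map_span, ← hr]
  ext c
  rw [LinearMap.mem_ker, linearCombination_append, Submodule.mem_map]
  have e1 : ∀ b : Fin p → R, Fintype.linearCombination R (fun i => ι (a i)) b =
      ι (Fintype.linearCombination R a b) := fun b => by
    simp only [Fintype.linearCombination_apply, map_sum, map_smul]
  rw [e1]
  constructor
  · intro hc
    have h0 := (injective_iff_map_eq_zero _).1 h.1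
      (Fintype.linearCombination R a fun i => c (Fin.castAdd n i), fun i => c (Fin.natAdd p i)) hc
    refine ⟨_, congrArg Prod.fst h0, ?_⟩
    have h2 : (0 : Fin n → R) = fun i => c (Fin.natAdd p i) := (congrArg Prod.snd h0).symm
    change Fin.append (fun i => c (Fin.castAdd n i)) (0 : Fin n → R) = c
    rw [h2]
    exact Fin.append_castAdd_natAdd
  · rintro ⟨b, hb, rfl⟩
    change ι (Fintype.linearCombination R a fun i => Fin.append b (0 : Fin n → R) _) +
      Fintype.linearCombination R e (fun i => Fin.append b (0 : Fin n → R) _) = 0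
    simp only [Fin.append_left, Fin.append_right]
    rw [LinearMap.mem_ker.1 hb, map_zero, zero_add]
    exact map_zero _

theorem finrank_of_bijective [IsDomain R] [Module.Finite R M] :
    Module.finrank R N = Module.finrank R M + n := by
  have e := (LinearMap.snd R M (Fin n → R)).quotKerEquivOfSurjective LinearMap.snd_surjective
  rw [← (LinearEquiv.ofBijective _ h).finrank_eq,
    ← Submodule.finrank_quotient_add_finrank (LinearMap.ker (LinearMap.snd R M (Fin n → R))),
    e.finrank_eq, Module.finrank_fin_fun, LinearMap.ker_snd,
    LinearMap.finrank_range_of_inj LinearMap.inl_injective, add_comm]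

end Presentation

/-! ### Extensions of sheaves by free sheaves -/

section Stalks

variable {E : Type v} [NormedAddCommGroup E] [NormedSpace ℂ E]
  {X : Type u} [TopologicalSpace X] [ChartedSpace E X]

theorem holGerm_res {x : X} {U V : Opens X} (hx : x ∈ U) (hx' : x ∈ V) (h : V ≤ U)
    (f : Hol E U) : holGerm E hx' (holRes E h f) = holGerm E hx f :=
  (hol_mk_res ⟨U, hx⟩ ⟨V, hx'⟩ h f).symm

theorem exists_holGerm {x : X} {n : ℕ} (f : Fin n → HolStalk E x) {U : Opens X} (hx : x ∈ U) :
    ∃ (V : Opens X) (hV : x ∈ V) (_ : V ≤ U) (g : Fin n → Hol E V),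
      ∀ k, f k = holGerm E hV (g k) := by
  choose W g hg using fun k => DirectLimit.exists_eq_mk _ (f k)
  let V : Opens X := ⟨U ∩ ⋂ k, (W k).1, U.2.inter (isOpen_iInter_of_finite fun k => (W k).1.2)⟩
  have hV : ∀ k, V ≤ (W k).1 := fun k y hy => Set.mem_iInter.1 hy.2 k
  refine ⟨V, ⟨hx, Set.mem_iInter.2 fun k => (W k).2⟩, fun y hy => hy.1,
    fun k => holRes E (hV k) (g k), fun k => ?_⟩
  rw [hg]
  exact (holGerm_res (W k).2 _ (hV k) (g k)).symm

namespace HolModule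

variable (A B : HolModule E X)

theorem germ_res {x : X} {U V : Opens X} (hx : x ∈ U) (hx' : x ∈ V) (h : V ≤ U) (s : A.Γ U) :
    A.germ hx' (A.res h s) = A.germ hx s :=
  (A.mk_res ⟨U, hx⟩ ⟨V, hx'⟩ h s).symm

theorem germ_smul {x : X} {U : Opens X} (hx : x ∈ U) (f : Hol E U) (s : A.Γ U) :
    A.germ hx (f • s) = holGerm E hx f • A.germ hx s :=
  (A.smul_def ⟨U, hx⟩ f s).symm

/-- The germ as a homomorphism. -/
noncomputable def germHom {x : X} {U : Opens X} (hx : x ∈ U) : A.Γ U →+ A.Stalk x :=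
  AddMonoidHom.mk' (A.germ hx) fun s t =>
    (DirectLimit.add_def (G := fun U : Nhd x => A.Γ U.1) ⟨U, hx⟩ s t).symm

theorem germ_add {x : X} {U : Opens X} (hx : x ∈ U) (s t : A.Γ U) :
    A.germ hx (s + t) = A.germ hx s + A.germ hx t := map_add (A.germHom hx) s t

theorem germ_sum {x : X} {U : Opens X} (hx : x ∈ U) {n : ℕ} (s : Fin n → A.Γ U) :
    A.germ hx (∑ i, s i) = ∑ i, A.germ hx (s i) := map_sum (A.germHom hx) s _

theorem germ_eq_zero {x : X} {U : Opens X} (hx : x ∈ U) {s : A.Γ U} (h : A.germ hx s = 0) :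
    ∃ (V : Opens X) (_ : x ∈ V) (hV : V ≤ U), A.res hV s = 0 := by
  obtain ⟨V, hV, h0⟩ := (DirectLimit.exists_eq_zero _).1 h
  exact ⟨V.1, V.2, hV, h0⟩

theorem exists_germ {x : X} (a : A.Stalk x) {U : Opens X} (hx : x ∈ U) :
    ∃ (V : Opens X) (hV : x ∈ V) (_ : V ≤ U) (s : A.Γ V), a = A.germ hV s := by
  obtain ⟨W, s, rfl⟩ := DirectLimit.exists_eq_mk _ a
  exact ⟨W.1 ⊓ U, ⟨W.2, hx⟩, inf_le_right, A.res inf_le_left s, (A.germ_res W.2 _ _ s).symm⟩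

variable {A B} (ι : ∀ U, A.Γ U →ₗ[Hol E U] B.Γ U)
  (hι : ∀ (U V : Opens X) (h : V ≤ U) (s : A.Γ U), ι V (A.res h s) = B.res h (ι U s))

/-- The map of stalks defined by a morphism of sheaves of modules. -/
noncomputable def stalkMap (x : X) : A.Stalk x →ₗ[HolStalk E x] B.Stalk x where
  toFun := DirectLimit.map _ _ (fun U => ι U.1) fun U V h s => (hι U.1 V.1 h s).symm
  map_add' := DirectLimit.induction₂ _ fun U s t => by
    rw [DirectLimit.add_def, DirectLimit.map_def, DirectLimit.map_def, DirectLimit.map_def,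
      DirectLimit.add_def, map_add]
  map_smul' f a := by
    obtain ⟨W, s, rfl⟩ := DirectLimit.exists_eq_mk _ a
    obtain ⟨U, f, rfl⟩ := DirectLimit.exists_eq_mk _ f
    obtain ⟨V, hU, hW⟩ := exists_ge_ge U W
    rw [hol_mk_res U V hU, A.mk_res W V hW, smul_def, DirectLimit.map_def, DirectLimit.map_def,
      RingHom.id_apply, smul_def, map_smul]

theorem stalkMap_germ {x : X} {U : Opens X} (hx : x ∈ U) (s : A.Γ U) :
    stalkMap ι hι x (A.germ hx s) = B.germ hx (ι U s) := rfl

variable {n : ℕ} {W : Opens X} {e : Fin n → B.Γ W}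

/-- A direct sum decomposition of the sections over small open sets gives one of the stalks. -/
theorem stalk_bijective
    (h : ∀ (V : Opens X) (hV : V ≤ W), Function.Bijective
      ((ι V).coprod (Fintype.linearCombination (Hol E V) fun k => B.res hV (e k))))
    {y : X} (hy : y ∈ W) : Function.Bijective ((stalkMap ι hι y).coprod
      (Fintype.linearCombination (HolStalk E y) fun k => B.germ hy (e k))) := by
  have key : ∀ (V : Opens X) (hV : V ≤ W) (hyV : y ∈ V) (s : A.Γ V) (f : Fin n → Hol E V),
      (stalkMap ι hι y).coprod (Fintype.linearCombination (HolStalk E y) fun k => B.germ hy (e k))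
        (A.germ hyV s, fun k => holGerm E hyV (f k)) =
      B.germ hyV ((ι V).coprod (Fintype.linearCombination (Hol E V) fun k => B.res hV (e k))
        (s, f)) := by
    intro V hV hyV s f
    rw [LinearMap.coprod_apply, LinearMap.coprod_apply, germ_add, stalkMap_germ,
      Fintype.linearCombination_apply, Fintype.linearCombination_apply, germ_sum]
    simp only [germ_smul, B.germ_res hy]
  refine ⟨(injective_iff_map_eq_zero _).2 fun ⟨a, φ⟩ h0 => ?_, fun b => ?_⟩
  · obtain ⟨V₁, hy₁, hV₁, s, rfl⟩ := A.exists_germ a hy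
    obtain ⟨V, hyV, hV, f, hf⟩ := exists_holGerm φ hy₁
    obtain rfl : φ = fun k => holGerm E hyV (f k) := funext hf
    rw [← A.germ_res hy₁ hyV hV, key V (hV.trans hV₁)] at h0
    obtain ⟨V', hyV', hV', h0⟩ := B.germ_eq_zero hyV h0
    have h1 := (injective_iff_map_eq_zero _).1 (h V' (hV'.trans (hV.trans hV₁))).1
      (A.res hV' (A.res hV s), fun k => holRes E hV' (f k)) (by
        rw [← h0, LinearMap.coprod_apply, LinearMap.coprod_apply, map_add, hι,
          Fintype.linearCombination_apply, Fintype.linearCombination_apply, map_sum]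
        simp only [B.res_smul, B.res_res])
    refine Prod.ext ?_ (funext fun k => ?_)
    · change A.germ hy₁ s = 0
      rw [← A.germ_res hy₁ hyV hV, ← A.germ_res hyV hyV' hV']
      refine (congrArg (A.germ hyV') (congrArg Prod.fst h1)).trans ?_
      exact map_zero (A.germHom hyV')
    · change holGerm E hyV (f k) = 0
      rw [← holGerm_res hyV hyV' hV']
      refine (congrArg (holGerm E hyV') (congrFun (congrArg Prod.snd h1) k)).trans ?_
      exact (DirectLimit.zero_def (⟨V', hyV'⟩ : Nhd y)).symm
  · obtain ⟨V, hyV, hV, t, rfl⟩ := B.exists_germ b hy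
    obtain ⟨⟨s, f⟩, rfl⟩ := (h V hV).2 t
    exact ⟨_, key V hV hyV s f⟩

end HolModule

end Stalks

section Extension

variable {E : Type v} [NormedAddCommGroup E] [NormedSpace ℂ E]
  {X : Type u} [TopologicalSpace X] [ChartedSpace E X] [IsManifold 𝓘(ℂ, E) ω X]

namespace HolModule

variable {A B : HolModule E X} (ι : ∀ U, A.Γ U →ₗ[Hol E U] B.Γ U)
  (hι : ∀ (U V : Opens X) (h : V ≤ U) (s : A.Γ U), ι V (A.res h s) = B.res h (ι U s)) {n : ℕ}

include hι in
/-- A sheaf which is locally the direct sum of the reflexive sheaf `A` and a free sheaf is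
reflexive. -/
theorem isReflexive_of_local (hA : A.IsReflexive)
    (h : ∀ x : X, ∃ (W : Opens X) (_ : x ∈ W) (e : Fin n → B.Γ W), ∀ (V : Opens X) (hV : V ≤ W),
      Function.Bijective ((ι V).coprod
        (Fintype.linearCombination (Hol E V) fun k => B.res hV (e k)))) : B.IsReflexive := by
  refine ⟨fun x => ?_, fun x => ?_⟩
  · obtain ⟨W, hxW, e, he⟩ := h x
    obtain ⟨U, hxU, p, m, a, r, har⟩ := hA.1 x
    refine ⟨U ⊓ W, ⟨hxU, hxW⟩, p + n, m,
      Fin.append (fun i => B.res inf_le_left (ι U (a i))) (fun k => B.res inf_le_right (e k)),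
      fun k => Fin.append (fun i => holRes E inf_le_left (r k i)) 0, fun y hy => ?_⟩
    have hb := stalk_bijective ι hι he hy.2
    obtain ⟨h1, h2⟩ := har y hy.1
    have e1 : (fun i => B.germ hy (Fin.append (fun i => B.res inf_le_left (ι U (a i)))
        (fun k => B.res inf_le_right (e k)) i)) =
        Fin.append (fun i => stalkMap ι hι y (A.germ hy.1 (a i))) fun k => B.germ hy.2 (e k) := by
      funext i
      refine Fin.addCases (fun i => ?_) (fun i => ?_) i
      · rw [Fin.append_left, Fin.append_left, B.germ_res hy.1, stalkMap_germ]
      · rw [Fin.append_right, Fin.append_right, B.germ_res hy.2]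
    have e2 : (fun (k : Fin m) (i : Fin (p + n)) => holGerm E hy
        (Fin.append (fun i => holRes E (inf_le_left : U ⊓ W ≤ U) (r k i)) 0 i)) =
        fun k => Fin.append (fun i => holGerm E hy.1 (r k i)) 0 := by
      funext k i
      refine Fin.addCases (fun i => ?_) (fun i => ?_) i
      · rw [Fin.append_left, Fin.append_left, holGerm_res hy.1]
      · rw [Fin.append_right, Fin.append_right]
        exact (DirectLimit.zero_def (⟨U ⊓ W, hy⟩ : Nhd y)).symm
    rw [e1, e2]
    exact ⟨span_append_eq_top hb h1, ker_append hb h2⟩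
  · obtain ⟨W, hxW, e, he⟩ := h x
    have := hA.2 x
    exact Module.equiv (LinearEquiv.ofBijective _ (stalk_bijective ι hι he hxW))

include hι in
theorem rank_of_local (hA : A.IsReflexive) {x : X}
    (h : ∃ (W : Opens X) (_ : x ∈ W) (e : Fin n → B.Γ W), ∀ (V : Opens X) (hV : V ≤ W),
      Function.Bijective ((ι V).coprod
        (Fintype.linearCombination (Hol E V) fun k => B.res hV (e k)))) :
    B.rank x = A.rank x + n := by
  obtain ⟨W, hxW, e, he⟩ := h
  obtain ⟨U, hxU, p, m, a, r, har⟩ := hA.1 x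
  have : Module.Finite (HolStalk E x) (A.Stalk x) :=
    ⟨⟨(Set.finite_range _).toFinset, by rw [Set.Finite.coe_toFinset]; exact (har x hxU).1⟩⟩
  exact finrank_of_bijective (stalk_bijective ι hι he hxW)

end HolModule

end Extension

/-! ### The unfolding defined by a flat connection -/

section Vertical

variable {E : Type v} [NormedAddCommGroup E] [NormedSpace ℂ E]
  {F : Type w} [NormedAddCommGroup F] [NormedSpace ℂ F]
  {X : Type u} [TopologicalSpace X] [ChartedSpace E X]
  {S : Type u} [TopologicalSpace S] [ChartedSpace F S]
  {π : C^ω⟮𝓘(ℂ, E), X; 𝓘(ℂ, F), S⟯}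

/-- A vector field on `X` is vertical if it kills coordinates on `S`: by Hadamard's lemma, a
function on `S` is, near a point, a constant plus a combination of functions `tᵢ - tᵢ(x)`. -/
theorem Coords.isVertical {m : ℕ} {U : Opens S} (C : Coords F m U) {W : Opens X}
    (hW : W ≤ pre π U) {Y : VField E W} (hY : ∀ i, Y.der le_rfl (pull π hW (C.t i)) = 0) :
    IsVertical π Y := by
  intro U' W' hW' h' g
  apply Hol.ext E
  intro y
  let U₁ : Opens S := U' ⊓ U
  have hy : π y.1 ∈ U₁ := ⟨h' y.2, hW (hW' y.2)⟩
  obtain ⟨U₂, hy₂, hU₂, k, hk⟩ := C.hadamard (inf_le_right : U₁ ≤ U)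
    (holRes F (inf_le_left : U₁ ≤ U') g) ⟨π y.1, hy⟩
  have hU₂' : U₂ ≤ U := hU₂.trans inf_le_right
  let W₂ : Opens X := W' ⊓ pre π U₂
  have hW₂ : W₂ ≤ pre π U₂ := inf_le_right
  have hW₂' : W₂ ≤ W := inf_le_left.trans hW'
  have hy' : y.1 ∈ W₂ := ⟨y.2, hy₂⟩
  have e1 := congrArg (fun f : Hol E W₂ => f ⟨y.1, hy'⟩)
    (Y.res_der hW' (inf_le_left : W₂ ≤ W') (pull π h' g))
  refine e1.trans ?_
  have e2 : holRes E (inf_le_left : W₂ ≤ W') (pull π h' g) =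
      pull π hW₂ (holRes F hU₂ (holRes F (inf_le_left : U₁ ≤ U') g)) := rfl
  have e3 : ∀ i, Y.der hW₂' (pull π hW₂ (holRes F hU₂' (C.t i))) = 0 := fun i => by
    have := Y.res_der le_rfl hW₂' (pull π hW (C.t i))
    rw [hY, map_zero] at this
    exact this.symm
  have e4 : ∀ z : ℂ, pull π hW₂ (algebraMap ℂ (Hol F U₂) z) = algebraMap ℂ (Hol E W₂) z :=
    fun _ => rfl
  have e5 : ∀ z : ℂ, Y.der hW₂' (algebraMap ℂ (Hol E W₂) z) = 0 := fun z =>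
    Derivation.map_algebraMap _ z
  rw [e2, hk]
  simp only [map_add, map_sum, map_mul, map_sub, e4, Derivation.leibniz, e5,
    e3, sub_self, mul_zero, add_zero, zero_add, Hol.sum_apply, smul_eq_mul, Hol.mul_apply]
  refine Finset.sum_eq_zero fun i _ => ?_
  refine mul_eq_zero_of_left ?_ _
  exact sub_self (C.t i ⟨π y.1, hW (hW' y.2)⟩)

end Vertical

section ProlUnfolding

variable {E : Type v} [NormedAddCommGroup E] [NormedSpace ℂ E]
  {F : Type w} [NormedAddCommGroup F] [NormedSpace ℂ F]
  {X : Type u} [TopologicalSpace X] [ChartedSpace E X] [IsManifold 𝓘(ℂ, E) ω X]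
  {S : Type u} [TopologicalSpace S] [ChartedSpace F S]
  {π : C^ω⟮𝓘(ℂ, E), X; 𝓘(ℂ, F), S⟯} {A : Family π}
  {hπ : Manifold.IsSubmersion 𝓘(ℂ, E) 𝓘(ℂ, F) ω π} {hfib : ∀ s, IsConnected (π ⁻¹' {s})}
  {N : FlatConnection (pushforward A hπ hfib)}

/-- Restriction of frames to smaller open subsets of `X`. -/
noncomputable def Frame.shrink {j : Patch π} (Φ : Frame N j) {W : Opens X} (h : W ≤ j.W) :
    Frame N (j.shrink h) := Φ.res (j.shrink_le h)

variable (N) in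
theorem exists_frame_le [FiniteDimensional ℂ F] {V : Opens X} {x : X} (hx : x ∈ V) :
    ∃ j : Patch π, x ∈ j.W ∧ j.W ≤ V ∧ Nonempty (Frame N j) := by
  obtain ⟨j, hj, ⟨Φ⟩⟩ := exists_frame N x
  exact ⟨j.shrink (inf_le_left : j.W ⊓ V ≤ j.W), ⟨hj, hx⟩, inf_le_right, ⟨Φ.shrink _⟩⟩

namespace ProlSec

variable {V : Opens X}

/-- A section over a framed patch is determined by its component. -/
theorem ext_of_comp (hA : A.AdInjective) {j : Patch π} (hj : Nonempty (Frame N j))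
    {t t' : ProlSec N j.W} (h : t.comp j hj le_rfl = t'.comp j hj le_rfl) : t = t' := by
  refine ext ?_ fun k hk hkj => ?_
  · have h1 := congrArg Prol.anchor h
    rwa [anchor_comp, anchor_comp] at h1
  · let m : Patch π := ⟨k.W, k.U ⊓ j.U, fun y hy => ⟨k.le hy, j.le (hkj hy)⟩⟩
    have hmk : m ≤ k := ⟨le_rfl, inf_le_left⟩
    have hmj : m ≤ j := ⟨hkj, inf_le_right⟩
    have hm : Nonempty (Frame N m) := hj.map fun Φ => Φ.res hmj
    apply (Prol.res_bijective hk.some hA hmk rfl).1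
    rw [t.res_comp hk hkj hm hmk, t'.res_comp hk hkj hm hmk,
      ← t.res_comp hj le_rfl hm hmj, ← t'.res_comp hj le_rfl hm hmj, h]

/-- Over a framed patch the sections are the elements of the prolongation. -/
theorem comp_bijective (hA : A.AdInjective) {j : Patch π} (hj : Nonempty (Frame N j)) :
    Function.Bijective fun t : ProlSec N j.W => t.comp j hj le_rfl :=
  ⟨fun _ _ h => ext_of_comp hA hj h, exists_comp_eq hA hj⟩

theorem eq_of_local (hA : A.AdInjective) {t t' : ProlSec N V}
    (h : ∀ x ∈ V, ∃ (W : Opens X) (_ : x ∈ W) (hW : W ≤ V), res hW t = res hW t') : t = t' :=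
  (prolAlgebroid N hA).eq_of_local h

variable (N V) in
/-- The inclusion of `𝒜_S`. -/
noncomputable def incl : A.Γ V →ₗ[Hol E V] ProlSec N V where
  toFun s := mk (A.anchor s) (fun j _ h => Prol.innerHom N j (A.res h s))
    (fun j _ h => by
      rw [Prol.innerHom_apply, Prol.anchor_of, Ops.inner_op, ad_symbol, A.anchor_res])
    (fun i j _ _ h hij => by
      rw [Prol.innerHom_apply, Prol.res_of, Ops.res_inner, A.res_res, Prol.innerHom_apply])
  map_add' s t := ext (map_add A.anchor s t) fun j hj h => by
    change Prol.innerHom N j (A.res h (s + t)) =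
      Prol.innerHom N j (A.res h s) + Prol.innerHom N j (A.res h t)
    rw [map_add, map_add]
  map_smul' f s := ext (map_smul A.anchor f s) fun j hj h => by
    change Prol.innerHom N j (A.res h (f • s)) = holRes E h f • Prol.innerHom N j (A.res h s)
    rw [A.res_smul, map_smul]

@[simp] theorem incl_comp (s : A.Γ V) {j : Patch π} (hj : Nonempty (Frame N j)) (h : j.W ≤ V) :
    (incl N V s).comp j hj h = Prol.innerHom N j (A.res h s) := rfl

theorem incl_res {V' : Opens X} (h : V' ≤ V) (s : A.Γ V) :
    incl N V' (A.res h s) = res h (incl N V s) :=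
  ext (A.anchor_res h s) fun j hj h' => by
    rw [incl_comp, comp_res, incl_comp, A.res_res]

theorem incl_bracket (s t : A.Γ V) :
    incl N V (A.bracket s t) = bracket (incl N V s) (incl N V t) :=
  ext (A.anchor_bracket A.reflexive s t) fun j hj h => by
    rw [bracket_comp, incl_comp, incl_comp, incl_comp, Prol.innerHom_apply, Prol.innerHom_apply,
      Prol.innerHom_apply, Prol.bracket_of, Ops.comm_inner, Ops.inner_op, ad_op, A.res_self,
      A.bracket_res]

variable [FiniteDimensional ℂ F]

theorem incl_injective (hA : A.AdInjective) : Function.Injective (incl N V) := fun s t h =>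
  A.eq_of_local fun x hx => by
    obtain ⟨j, hxj, hjV, hj⟩ := exists_frame_le N hx
    refine ⟨j.W, hxj, hjV, hj.some.innerHom_injective hA ?_⟩
    exact congrArg (fun t => t.comp j hj hjV) h

/-- The sections with vertical anchor are the sections of `𝒜_S`. -/
theorem exists_incl_of_vertical (hA : A.AdInjective) {t : ProlSec N V}
    (ht : IsVertical π t.anchor) : ∃ s : A.Γ V, incl N V s = t := by
  obtain ⟨s, -, hs⟩ := A.exists_of_local (U := V) (fun W hW s => incl N W s = res hW t)
    (by
      intro W W' hW h s hs
      rw [incl_res, hs]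
      rfl)
    (fun W hW s s' hs hs' => incl_injective hA (hs.trans hs'.symm))
    (by
      intro x hx
      obtain ⟨j, hxj, hjV, ⟨Φ⟩⟩ := exists_frame_le N hx
      refine ⟨j.W, hxj, hjV, (Φ.toProd hA (t.comp j ⟨Φ⟩ hjV)).1, ext_of_comp hA ⟨Φ⟩ ?_⟩
      rw [incl_comp, A.res_self, comp_res]
      refine (Φ.eq_inner_of_vertical hA _ ?_).symm
      rw [anchor_comp]
      exact fun U' W' hW' => ht U' W' (hW'.trans hjV))
  refine ⟨s, eq_of_local hA fun x hx => ?_⟩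
  obtain ⟨W, hxW, hW, he⟩ := hs x hx
  exact ⟨W, hxW, hW, by rw [← incl_res, he]⟩

end ProlSec

namespace ProlSec

variable (N) in
/-- The component over a framed patch, as a linear map. -/
def compHom (j : Patch π) (hj : Nonempty (Frame N j)) : ProlSec N j.W →ₗ[Hol E j.W] Prol N j where
  toFun t := t.comp j hj le_rfl
  map_add' _ _ := rfl
  map_smul' _ _ := rfl

/-- Over a framed patch the sheaf of sections of the prolongation is the direct sum of `𝒜_S` and
a free sheaf. -/
theorem coprod_bijective (hA : A.AdInjective) {j : Patch π} (Φ : Frame N j)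
    {e : Fin (Module.finrank ℂ F) → ProlSec N j.W}
    (he : ∀ k, (e k).comp j ⟨Φ⟩ le_rfl = Prol.of (Φ.q k)) {i : Patch π} (h : i ≤ j) :
    Function.Bijective ((incl N i.W).coprod
      (Fintype.linearCombination (Hol E i.W) fun k => res h.1 (e k))) := by
  have hi : Nonempty (Frame N i) := ⟨Φ.res h⟩
  have hb : Function.Bijective (compHom N i hi) := comp_bijective hA hi
  refine (hb.of_comp_iff' _).1 ?_
  have key : compHom N i hi ∘ ((incl N i.W).coprod
      (Fintype.linearCombination (Hol E i.W) fun k => res h.1 (e k))) = (Φ.res h).ofProd := by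
    funext ⟨s, f⟩
    rw [Function.comp_apply, LinearMap.coprod_apply, map_add, Fintype.linearCombination_apply,
      map_sum, Frame.ofProd_apply]
    refine congrArg₂ (· + ·) ?_ (Finset.sum_congr rfl fun k _ => ?_)
    · change Prol.innerHom N _ (A.res le_rfl s) = _
      rw [A.res_self]
      rfl
    · rw [map_smul]
      congr 1
      refine ((e k).res_comp ⟨Φ⟩ le_rfl hi h).symm.trans ?_
      rw [he, Prol.res_of]
      rfl
  rw [key]
  exact ((Φ.res h).equiv hA).symm.bijective

/-- The sheaf of sections of the prolongation is locally the direct sum of `𝒜_S` and a free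
sheaf. -/
theorem exists_bijective [FiniteDimensional ℂ F] (hA : A.AdInjective) (x : X) :
    ∃ (W : Opens X) (_ : x ∈ W) (e : Fin (Module.finrank ℂ F) → ProlSec N W),
      ∀ (V : Opens X) (hV : V ≤ W), Function.Bijective ((incl N V).coprod
        (Fintype.linearCombination (Hol E V) fun k => res hV (e k))) := by
  obtain ⟨j, hxj, ⟨Φ⟩⟩ := exists_frame N x
  choose e he using fun k => exists_comp_eq hA ⟨Φ⟩ (Prol.of (Φ.q k))
  exact ⟨j.W, hxj, e, fun V hV => coprod_bijective hA Φ he (j.shrink_le hV)⟩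

end ProlSec

variable [FiniteDimensional ℂ F]

variable (N) in
/-- The unfolding defined by a flat connection. -/
noncomputable def prolUnfolding (hA : A.AdInjective) : Unfolding A where
  L := prolAlgebroid N hA
  reflexive := HolModule.isReflexive_of_local (B := (prolAlgebroid N hA).toHolModule)
    (ProlSec.incl N) (fun _ _ h s => ProlSec.incl_res h s) A.reflexive (ProlSec.exists_bijective hA)
  incl {V} := ProlSec.incl N V
  incl_injective {_} := ProlSec.incl_injective hA
  incl_res h s := ProlSec.incl_res h s
  incl_bracket s t := ProlSec.incl_bracket s t
  anchor_incl _ := rfl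
  preimage {V} t ht := ProlSec.exists_incl_of_vertical hA (IsVertical.of_local fun x hx => by
    obtain ⟨W, hxW, hW, s, hs⟩ := ht x hx
    refine ⟨W, hxW, hW, ?_⟩
    have h1 := A.vertical s
    rw [← hs] at h1
    exact h1)
  rank_eq x := HolModule.rank_of_local (B := (prolAlgebroid N hA).toHolModule)
    (ProlSec.incl N) (fun _ _ h s => ProlSec.incl_res h s) A.reflexive
    (ProlSec.exists_bijective hA x)

/-- The unfolding defined by a flat connection is transversal: in coordinates `tᵢ` on `S`, a vector
field `Y` differs from the anchor of `∑ Y(tᵢ) qᵢ` by a vertical vector field. -/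
theorem prolUnfolding_isTransversal (hA : A.AdInjective) :
    (prolUnfolding N hA).IsTransversal := by
  refine ⟨?_, fun V Y x hx => ?_⟩
  · rintro V _ hY ⟨t, rfl⟩ x hx
    obtain ⟨s, rfl⟩ := ProlSec.exists_incl_of_vertical hA (t := t) hY
    exact ⟨V, hx, le_rfl, s, rfl⟩
  · obtain ⟨j, hxj, hjV, ⟨Φ⟩⟩ := exists_frame_le N hx
    obtain ⟨t, ht⟩ := ProlSec.exists_comp_eq hA ⟨Φ⟩ (Φ.ofProd
      (0, fun i => Y.der hjV (pull π j.le (Φ.coords.t i))))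
    refine ⟨j.W, hxj, hjV, Y.res hjV - t.anchor, t, ?_, (sub_add_cancel _ _).symm⟩
    refine Φ.coords.isVertical j.le fun i => ?_
    have e : ∀ Z Z' : VField E j.W, ∀ k : Hol E j.W, (Z - Z').der le_rfl k =
        Z.der le_rfl k - Z'.der le_rfl k := fun _ _ _ => rfl
    have h1 : t.anchor = Prol.anchor (t.comp j ⟨Φ⟩ le_rfl) := (t.anchor_comp ⟨Φ⟩ le_rfl).symm
    rw [e, h1, ht, ← Φ.toProd_snd hA, Φ.toProd_ofProd, VField.der_res, sub_self]

end ProlUnfolding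

/-! ### Recovering the connection from its unfolding -/

section Surjective

variable {E : Type v} [NormedAddCommGroup E] [NormedSpace ℂ E]
  {F : Type w} [NormedAddCommGroup F] [NormedSpace ℂ F] [FiniteDimensional ℂ F]
  {X : Type u} [TopologicalSpace X] [ChartedSpace E X] [IsManifold 𝓘(ℂ, E) ω X]
  {S : Type u} [TopologicalSpace S] [ChartedSpace F S]
  {π : C^ω⟮𝓘(ℂ, E), X; 𝓘(ℂ, F), S⟯} {A : Family π}
  {hπ : Manifold.IsSubmersion 𝓘(ℂ, E) 𝓘(ℂ, F) ω π} {hfib : ∀ s, IsConnected (π ⁻¹' {s})}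
  {N : FlatConnection (pushforward A hπ hfib)}

/-- The section of the prolongation defined by an operator acts on `𝒜_S` as this operator. -/
theorem prolUnfolding_acts (hA : A.AdInjective) {j : Patch π} (Φ : Frame N j) (q : Ops N j)
    {t : ProlSec N j.W} (ht : t.comp j ⟨Φ⟩ le_rfl = Prol.of q) :
    (prolUnfolding N hA).Acts t q.op where
  symbol := by
    have h := t.anchor_comp ⟨Φ⟩ le_rfl
    rw [ht, Prol.anchor_of] at h
    exact h
  op W h s := by
    have hj : Nonempty (Frame N (j.shrink h)) := ⟨Φ.shrink h⟩
    refine ProlSec.ext_of_comp hA (j := j.shrink h) hj ?_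
    change Prol.innerHom N (j.shrink h) (A.res le_rfl (q.op.op h s)) =
      Prol.bracket (t.comp (j.shrink h) hj h) (Prol.innerHom N (j.shrink h) (A.res le_rfl s))
    rw [← t.res_comp ⟨Φ⟩ le_rfl hj (j.shrink_le h), ht, Prol.res_of, Prol.innerHom_apply,
      Prol.innerHom_apply, Prol.bracket_of, Ops.comm_inner]
    refine congrArg (fun r => Prol.of (Ops.inner N (j.shrink h) r)) ((A.res_self _).trans ?_)
    exact congrArg (fun r => q.op.op h r) (A.res_self s).symm

/-- The connection of the unfolding defined by `N` is `N`. -/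
theorem prolUnfolding_connection (hA : A.AdInjective) :
    (prolUnfolding N hA).connection hπ hfib (prolUnfolding_isTransversal hA) = N := by
  refine FlatConnection.ext' fun U v => Eq.symm ?_
  refine Unfolding.IsConn.unique
    ((prolUnfolding N hA).connection_isConn hπ hfib (prolUnfolding_isTransversal hA) v)
    fun x hx => ?_
  obtain ⟨k, hxk, ⟨Φ⟩⟩ := exists_frame N x
  obtain ⟨W, hxW, hW, p, hp⟩ := USec.exists_rep (V := pre π U) (N.map v) hx
  let j : Patch π := ⟨k.W ⊓ W, k.U ⊓ U, fun y hy => ⟨k.le hy.1, hW hy.2⟩⟩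
  have hjk : j ≤ k := ⟨inf_le_left, inf_le_left⟩
  have hjW : j.W ≤ W := inf_le_right
  let q : Ops N j := ⟨(LieOp.res hjW p, v.res inf_le_right), by
    change USec.Rep (N.map (v.res _)) _ _
    rw [N.map_res]
    exact hp.res hjW⟩
  obtain ⟨t, ht⟩ := ProlSec.exists_comp_eq hA ⟨Φ.res hjk⟩ (Prol.of q)
  have h := prolUnfolding_acts hA (Φ.res hjk) q ht
  refine ⟨j.W, ⟨hxk, hxW⟩, hjW.trans hW, t, q.op, ?_, h, hp.res hjW⟩
  rw [← h.symbol]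
  exact Related.of_res inf_le_right j.le q.related

end Surjective

/-! ### Recovering an unfolding from its connection -/

section Injective

variable {E : Type v} [NormedAddCommGroup E] [NormedSpace ℂ E]
  {F : Type w} [NormedAddCommGroup F] [NormedSpace ℂ F] [FiniteDimensional ℂ F]
  {X : Type u} [TopologicalSpace X] [ChartedSpace E X] [IsManifold 𝓘(ℂ, E) ω X]
  {S : Type u} [TopologicalSpace S] [ChartedSpace F S]
  {π : C^ω⟮𝓘(ℂ, E), X; 𝓘(ℂ, F), S⟯} {A : Family π}
  {hπ : Manifold.IsSubmersion 𝓘(ℂ, E) 𝓘(ℂ, F) ω π} {hfib : ∀ s, IsConnected (π ⁻¹' {s})}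
  {N : FlatConnection (pushforward A hπ hfib)} {L : Unfolding A}

namespace Unfolding

theorem Acts.of_local {V : Opens X} {u : L.L.Γ V} {p : LieOp A V}
    (h : ∀ x ∈ V, ∃ (W : Opens X) (_ : x ∈ W) (hW : W ≤ V),
      L.Acts (L.L.res hW u) (LieOp.res hW p)) : L.Acts u p where
  symbol := VField.eq_of_local fun x hx => by
    obtain ⟨W, hxW, hW, ha⟩ := h x hx
    refine ⟨W, hxW, hW, ?_⟩
    rw [← L.L.anchor_res, ← ha.symbol]
    rfl
  op W hWV s := L.L.eq_of_local fun x hx => by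
    obtain ⟨W', hxW', hW', ha⟩ := h x (hWV hx)
    refine ⟨W' ⊓ W, ⟨hxW', hx⟩, inf_le_right, ?_⟩
    have e := ha.op (W' ⊓ W) inf_le_left (A.res inf_le_right s)
    rw [L.L.bracket_res, ← L.incl_res, ← L.incl_res, p.res_op, L.L.res_res]
    rw [L.L.res_res] at e
    exact e

/-- If the adjoint map is injective, then a section of a transversal unfolding is determined by
its action on `𝒜_S`. -/
theorem Acts.injective (hA : A.AdInjective) (hL : L.IsTransversal) {V : Opens X} {u u' : L.L.Γ V}
    {p : LieOp A V} (h : L.Acts u p) (h' : L.Acts u' p) : u = u' := by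
  have h0 := h.sub h'
  rw [sub_self] at h0
  obtain ⟨s, hs⟩ := exists_incl_of_vertical hL (u := u - u') (by
    rw [← h0.symbol]
    exact fun _ _ _ _ _ => rfl)
  rw [← hs] at h0
  have h1 : ad A s = ad A 0 := by rw [map_zero, h0.unique (Acts.incl s)]
  rw [hA.ad_injective h1, map_zero] at hs
  exact sub_eq_zero.1 hs.symm

variable (hA : A.AdInjective) (hL : L.IsTransversal)
  (hN : ∀ (U : Opens S) (v : VField F U), L.IsConn v (N.map v))

include hA hL hN

/-- The operators which represent the connection of `L` come from sections of `L`. -/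
theorem exists_acts_of_ops {j : Patch π} (q : Ops N j) : ∃ u : L.L.Γ j.W, L.Acts u q.op := by
  obtain ⟨u, -, hu⟩ := L.L.exists_of_local (U := j.W) (fun W hW u => L.Acts u (LieOp.res hW q.op))
    (fun W W' hW h u hu => hu.res h) (fun W hW u u' hu hu' => hu.injective hA hL hu')
    (by
      intro x hx
      obtain ⟨W, hxW, hW, u, p, hu, hp⟩ := L.exists_acts hπ hL q.vec (j.le hx)
      have e : uGerm hxW p = uGerm hx q.op :=
        (hN _ _ W hW u p hu hp x hxW).symm.trans (q.rep x hx)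
      obtain ⟨W', hxW', h, h', s, hs⟩ := uGerm_eq_iff.1 e
      refine ⟨W', hxW', h', L.L.res h u - L.incl s, ?_⟩
      have h1 := (hp.res h).sub (Acts.incl s)
      rw [hs, add_sub_cancel_right] at h1
      exact h1)
  exact ⟨u, Acts.of_local hu⟩

/-- The map from the prolongation over a patch to `L`, which sends an operator to the section
acting as this operator. -/
noncomputable def prolHom (j : Patch π) : Prol N j →ₗ[Hol E j.W] L.L.Γ j.W :=
  Prol.lift (fun q => (L.exists_acts_of_ops hA hL hN q).choose)
    (fun p q g => (L.exists_acts_of_ops hA hL hN (p + g • q)).choose_spec.injective hA hL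
      ((L.exists_acts_of_ops hA hL hN p).choose_spec.add
        ((L.exists_acts_of_ops hA hL hN q).choose_spec.baseSmul j.le g)))
    (fun f s => by
      have h : ∀ s, (L.exists_acts_of_ops hA hL hN (Ops.inner N j s)).choose = L.incl s :=
        fun s => (L.exists_acts_of_ops hA hL hN (Ops.inner N j s)).choose_spec.injective hA hL
          (Acts.incl s)
      rw [h, h, map_smul])

variable {i j : Patch π}

theorem prolHom_of (q : Ops N j) {u : L.L.Γ j.W} (hu : L.Acts u q.op) :
    L.prolHom hA hL hN j (Prol.of q) = u :=
  (Prol.lift_of _ _ _ q).trans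
    ((L.exists_acts_of_ops hA hL hN q).choose_spec.injective hA hL hu)

theorem prolHom_acts (q : Ops N j) : L.Acts (L.prolHom hA hL hN j (Prol.of q)) q.op := by
  obtain ⟨u, hu⟩ := L.exists_acts_of_ops hA hL hN q
  rwa [L.prolHom_of hA hL hN q hu]

theorem prolHom_innerHom (s : A.Γ j.W) :
    L.prolHom hA hL hN j (Prol.innerHom N j s) = L.incl s :=
  L.prolHom_of hA hL hN _ (Acts.incl s)

theorem anchor_prolHom (x : Prol N j) :
    L.L.anchor (L.prolHom hA hL hN j x) = Prol.anchor x := by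
  induction x using Prol.induction with
  | add x y hx hy => rw [map_add, map_add, map_add, hx, hy]
  | smul f q =>
    rw [map_smul, map_smul, map_smul, Prol.anchor_of, (L.prolHom_acts hA hL hN q).symbol]

theorem prolHom_res (h : i ≤ j) (x : Prol N j) :
    L.prolHom hA hL hN i (Prol.res h x) = L.L.res h.1 (L.prolHom hA hL hN j x) := by
  induction x using Prol.induction with
  | add x y hx hy => rw [map_add, map_add, map_add, hx, hy, map_add]
  | smul f q =>
    rw [Prol.res_smul, map_smul, map_smul, L.L.res_smul, Prol.res_of,
      L.prolHom_of hA hL hN (Ops.res h q) ((L.prolHom_acts hA hL hN q).res h.1)]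

theorem prolHom_bracket (x y : Prol N j) : L.prolHom hA hL hN j (Prol.bracket x y) =
    L.L.bracket (L.prolHom hA hL hN j x) (L.prolHom hA hL hN j y) := by
  induction x using Prol.induction with
  | add x x' hx hx' => simp only [map_add, AddMonoidHom.add_apply, hx, hx']
  | smul f p =>
    induction y using Prol.induction with
    | add y y' hy hy' => simp only [map_add, hy, hy']
    | smul g q =>
      have hp := L.prolHom_acts hA hL hN p
      have hq := L.prolHom_acts hA hL hN q
      rw [Prol.bracket_smul_of, map_sub, map_add, LinearMap.map_smul, LinearMap.map_smul,
        LinearMap.map_smul, LinearMap.map_smul, LinearMap.map_smul,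
        L.prolHom_of hA hL hN (Ops.comm p q) (hp.comm hq), L.L.leibniz, L.L.bracket_smul_right,
        LinearMap.map_smul, VField.smul_der, ← hp.symbol, ← hq.symbol, smul_add, smul_smul,
        smul_smul]
      rfl

/-- Over a framed patch the sections of `L` are the elements of the prolongation. -/
theorem prolHom_bijective (Φ : Frame N j) : Function.Bijective (L.prolHom hA hL hN j) := by
  refine ⟨(injective_iff_map_eq_zero _).2 fun x hx => ?_, fun u => ?_⟩
  · have h0 := L.anchor_prolHom hA hL hN x
    rw [hx, map_zero] at h0
    have h1 := Φ.eq_inner_of_vertical hA x (by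
      rw [← h0]
      exact fun _ _ _ _ _ => rfl)
    rw [h1, prolHom_innerHom] at hx
    rw [h1, L.incl_injective (hx.trans (map_zero L.incl).symm), map_zero]
  · let x := Φ.ofProd (0, fun i => (L.L.anchor u).der le_rfl (pull π j.le (Φ.coords.t i)))
    obtain ⟨s, hs⟩ := exists_incl_of_vertical hL (u := u - L.prolHom hA hL hN j x) (by
      refine Φ.coords.isVertical j.le fun i => ?_
      have e : ∀ Z Z' : VField E j.W, ∀ k : Hol E j.W, (Z - Z').der le_rfl k =
          Z.der le_rfl k - Z'.der le_rfl k := fun _ _ _ => rfl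
      rw [map_sub, e, anchor_prolHom, ← Φ.toProd_snd hA, Φ.toProd_ofProd, sub_self])
    refine ⟨Prol.innerHom N j s + x, ?_⟩
    rw [map_add, prolHom_innerHom, hs, sub_add_cancel]

/-- The sections of `L` over a framed patch, as elements of the prolongation. -/
noncomputable def prolEquiv (Φ : Nonempty (Frame N j)) : Prol N j ≃ₗ[Hol E j.W] L.L.Γ j.W :=
  LinearEquiv.ofBijective _ (L.prolHom_bijective hA hL hN Φ.some)

theorem prolHom_prolEquiv_symm (Φ : Nonempty (Frame N j)) (u : L.L.Γ j.W) :
    L.prolHom hA hL hN j ((L.prolEquiv hA hL hN Φ).symm u) = u :=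
  (L.prolEquiv hA hL hN Φ).apply_symm_apply u

theorem prolHom_injective (Φ : Nonempty (Frame N j)) :
    Function.Injective (L.prolHom hA hL hN j) := (L.prolHom_bijective hA hL hN Φ.some).1

/-- The map from `L` to the sheaf of sections of the prolongation. -/
noncomputable def toProlSec (V : Opens X) : L.L.Γ V →ₗ[Hol E V] ProlSec N V where
  toFun u := ProlSec.mk (L.L.anchor u)
    (fun j hj h => (L.prolEquiv hA hL hN hj).symm (L.L.res h u))
    (fun j hj h => by
      rw [← L.anchor_prolHom hA hL hN, prolHom_prolEquiv_symm, L.L.anchor_res])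
    (fun i j hi hj h hij => by
      apply L.prolHom_injective hA hL hN hi
      rw [prolHom_res, prolHom_prolEquiv_symm, prolHom_prolEquiv_symm, L.L.res_res])
  map_add' u u' := ProlSec.ext (map_add _ _ _) fun j hj h => by
    change (L.prolEquiv hA hL hN hj).symm (L.L.res h (u + u')) =
      (L.prolEquiv hA hL hN hj).symm (L.L.res h u) + (L.prolEquiv hA hL hN hj).symm (L.L.res h u')
    rw [map_add, map_add]
  map_smul' f u := ProlSec.ext (map_smul _ _ _) fun j hj h => by
    change (L.prolEquiv hA hL hN hj).symm (L.L.res h (f • u)) =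
      holRes E h f • (L.prolEquiv hA hL hN hj).symm (L.L.res h u)
    rw [L.L.res_smul, map_smul]

variable {V : Opens X}

theorem prolHom_toProlSec (u : L.L.Γ V) (hj : Nonempty (Frame N j)) (h : j.W ≤ V) :
    L.prolHom hA hL hN j ((L.toProlSec hA hL hN V u).comp j hj h) = L.L.res h u :=
  L.prolHom_prolEquiv_symm hA hL hN hj _

theorem toProlSec_res {V' : Opens X} (h : V' ≤ V) (u : L.L.Γ V) :
    L.toProlSec hA hL hN V' (L.L.res h u) = ProlSec.res h (L.toProlSec hA hL hN V u) :=
  ProlSec.ext (L.L.anchor_res h u) fun j hj h' => L.prolHom_injective hA hL hN hj (by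
    rw [prolHom_toProlSec, ProlSec.comp_res, prolHom_toProlSec, L.L.res_res])

/-- Sections of the prolongation come from unique sections of `L`: over framed patches this is
`prolHom_bijective`, and sections of both sheaves glue. -/
theorem toProlSec_bijective : Function.Bijective (L.toProlSec hA hL hN V) := by
  have hinj : ∀ V, Function.Injective (L.toProlSec hA hL hN V) := fun V u u' h =>
    L.L.eq_of_local fun x hx => by
      obtain ⟨j, hxj, hjV, hj⟩ := exists_frame_le N hx
      refine ⟨j.W, hxj, hjV, ?_⟩
      rw [← L.prolHom_toProlSec hA hL hN u hj hjV, h, prolHom_toProlSec]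
  refine ⟨hinj V, fun t => ?_⟩
  obtain ⟨u, -, hu⟩ := L.L.exists_of_local (U := V)
    (fun W hW u => L.toProlSec hA hL hN W u = ProlSec.res hW t)
    (by
      intro W W' hW h u hu
      rw [toProlSec_res, hu]
      rfl)
    (fun W hW u u' hu hu' => hinj W (hu.trans hu'.symm))
    (by
      intro x hx
      obtain ⟨j, hxj, hjV, hj⟩ := exists_frame_le N hx
      refine ⟨j.W, hxj, hjV, L.prolHom hA hL hN j (t.comp j hj hjV),
        ProlSec.ext_of_comp hA hj (L.prolHom_injective hA hL hN hj ?_)⟩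
      rw [prolHom_toProlSec, ProlSec.comp_res, L.L.res_self])
  refine ⟨u, ProlSec.eq_of_local hA fun x hx => ?_⟩
  obtain ⟨W, hxW, hW, he⟩ := hu x hx
  exact ⟨W, hxW, hW, by rw [← toProlSec_res, he]⟩

/-- A transversal unfolding is isomorphic to the unfolding defined by its connection. -/
noncomputable def isoProl : Iso L (prolUnfolding N hA) where
  equiv {V} := LinearEquiv.ofBijective _ (L.toProlSec_bijective hA hL hN (V := V))
  equiv_res h u := L.toProlSec_res hA hL hN h u
  equiv_bracket u u' := ProlSec.ext (L.L.anchor_bracket L.reflexive u u') fun j hj h => by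
    apply L.prolHom_injective hA hL hN hj
    refine (L.prolHom_toProlSec hA hL hN _ hj h).trans (Eq.symm ?_)
    refine (L.prolHom_bracket hA hL hN _ _).trans ?_
    rw [L.L.bracket_res]
    exact congrArg₂ (fun a b => L.L.bracket a b) (L.prolHom_toProlSec hA hL hN u hj h)
      (L.prolHom_toProlSec hA hL hN u' hj h)
  anchor_equiv _ := rfl
  equiv_incl s := ProlSec.ext (L.anchor_incl s) fun j hj h => by
    apply L.prolHom_injective hA hL hN hj
    refine (L.prolHom_toProlSec hA hL hN _ hj h).trans (Eq.symm ?_)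
    exact (L.prolHom_innerHom hA hL hN _).trans (L.incl_res h s)

end Unfolding

end Injective

end LieUnf

open LieUnf

theorem mainTheorem2
    {E : Type v} [NormedAddCommGroup E] [NormedSpace ℂ E] [FiniteDimensional ℂ E]
    {F : Type w} [NormedAddCommGroup F] [NormedSpace ℂ F] [FiniteDimensional ℂ F]
    {X : Type u} [TopologicalSpace X] [ChartedSpace E X] [IsManifold 𝓘(ℂ, E) ω X]
    {S : Type u} [TopologicalSpace S] [ChartedSpace F S] [IsManifold 𝓘(ℂ, F) ω S]
    (π : C^ω⟮𝓘(ℂ, E), X; 𝓘(ℂ, F), S⟯)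
    (hπ : Manifold.IsSubmersion 𝓘(ℂ, E) 𝓘(ℂ, F) ω π)
    (hfib : ∀ s : S, IsConnected (π ⁻¹' {s}))
    (A : Family π) :
    ∃ Φ : Quotient (unfoldingSetoid A) → FlatConnection (pushforward A hπ hfib),
      (∀ (L : TransversalUnfolding A) (U : Opens S) (v : VField F U) (V : Opens X)
        (hV : V ≤ pre π U) (u : L.1.L.Γ V), Related π (L.1.L.anchor u) v →
        ∃ ψ : LieOp A V, ψ.symbol = L.1.L.anchor u ∧
          (∀ (W : Opens X) (h : W ≤ V) (s : A.Γ W),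
            L.1.incl (ψ.op h s) = L.1.L.bracket (L.1.L.res h u) (L.1.incl s)) ∧
          USec.Rep ((Φ (Quotient.mk _ L)).map v) hV ψ) ∧
      (A.AdInjective → Function.Bijective Φ) := by
  refine ⟨Quotient.lift (fun L : TransversalUnfolding A => L.1.connection hπ hfib L.2)
    fun L M ⟨e⟩ => Unfolding.connection_congr hπ hfib L.2 M.2 e, ?_, fun hA => ⟨?_, fun N =>
      ⟨Quotient.mk _ ⟨prolUnfolding N hA, prolUnfolding_isTransversal hA⟩,
        prolUnfolding_connection hA⟩⟩⟩
  · intro L U v V hV u hu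
    obtain ⟨ψ, hψ⟩ := Unfolding.Acts.exists_of_projectable L.2 u (hu.projectable hV)
    exact ⟨ψ, hψ.symbol, hψ.op, L.1.connection_isConn hπ hfib L.2 v V hV u ψ hu hψ⟩
  · rintro ⟨L⟩ ⟨M⟩ h
    -- Both unfoldings are isomorphic to the one defined by their common connection.
    have hLM : L.1.connection hπ hfib L.2 = M.1.connection hπ hfib M.2 := h
    have hL := L.1.isoProl hA L.2 fun U v => L.1.connection_isConn hπ hfib L.2 v
    have hM := M.1.isoProl hA M.2 fun U v => M.1.connection_isConn hπ hfib M.2 v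
    rw [← hLM] at hM
    let L' : TransversalUnfolding A := ⟨prolUnfolding (L.1.connection hπ hfib L.2) hA,
      prolUnfolding_isTransversal hA⟩
    have h1 : L ≈ L' := ⟨hL⟩
    have h2 : M ≈ L' := ⟨hM⟩
    exact Quotient.sound (Setoid.trans h1 (Setoid.symm h2))
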